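/- Let $X$ be a connected compact complex manifold (for instance a compact Kähler manifold) and let $L$ be a holomorphic line bundle on $X$ of finite order, i.e. $L^{n}\cong\mathcal O_X$ for some $n\ge 1$. Let $\chi:\pi_1(X,x_0)\to \mathrm U(1)$ be a unitary character to which $L$ corresponds, i.e. $L\cong \tilde X\times_\chi\mathbb C=(\tilde X\times\mathbb C)/\big((c,z)\sim(gc,\chi(g)z)\big)$, where $\tilde X$ is the universal cover. Put $\Gamma=\operatorname{Im}\chi\subset \mathrm U(1)$, and let $p:Y=\tilde X/\operatorname{Ker}\chi\to X$ be the associated connected covering, on which $\Gamma$ acts as the Galois group. An $L$-twisted Higgs bundle on $X$ is a pair $(E,\theta)$ consisting of a holomorphic vector bundle $E$ and $\theta\in H^0(\operatorname{End}E\otimes L\otimes\Omega^1)$ with $\theta\wedge\theta=0$; for $L=\mathcal O$ it is called a Higgs bundle. Morphisms are bundle maps commuting with the Higgs fields, the tensor product is $(E\otimes F,\theta\otimes 1+1\otimes\eta)$, and the unit is $(\mathcal O,0)$. A Higgs bundle $(F,\varphi)$ on $Y$ satisfies $$\gamma^*F=F\quad\text{and}\quad\gamma^*\varphi=\gamma\varphi\qquad(\gamma\in\Gamma)\tag{$*$}$$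 if it is equipped with isomorphisms $\gamma^*F\cong F$, $\gamma\in\Gamma$, compatible with products in $\Gamma$ (a $\Gamma$-equivariant structure), which carry $\gamma^*\varphi$ to $\gamma\varphi$; here $\gamma$ acts on the left as a transformation of $Y$ and on the right as a scalar in $\mathrm U(1)$. Such Higgs bundles form a tensor category, whose morphisms are the morphisms of Higgs bundles that commute with these isomorphisms. Then: 1. There is an isomorphism $\tau:p^*L\cong\mathcal O_Y$ through which the canonical action of $\Gamma$ on $p^*L$ becomes the action $\gamma(y,z)=(\gamma y,\gamma z)$ on $Y\times\mathbb C$. 2. For every such $\tau$, the pullback $(E,\theta)\mapsto(p^*E,p^*\theta)$, where $p^*\theta$ is viewed as an $\operatorname{End}(p^*E)$-valued $1$-form through $\tau$ and $\gamma^*p^*E=p^*E$ is the canonical identification, is an equivalence of symmetric tensor categories from the category of $L$-twisted Higgs bundles on $X$ to the category of Higgs bundles on $Y$ satisfying $(*)$. 3. For every such $\tau$, a Higgs bundle $(F,\varphi)$ on $Y$ is isomorphic, as a Higgs bundle, to the pullback of some $L$-twisted Higgs bundle on $X$ if and only if $(\gamma^*F,\gamma^*\varphi)\cong(F,\gamma\varphi)$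 for every $\gamma\in\Gamma$, with no compatibility required between these isomorphisms. -/

import Mathlib

open scoped Manifold ContDiff TensorProduct
open CategoryTheory

universe w u

noncomputable section

/-! ### Holomorphic vector bundles

Throughout, a complex manifold is a manifold modelled on a complex vector space `V`, and holomorphic
means `C^ω` over `ℂ`. -/

/-- A holomorphic vector bundle on `X`, given by its fibres together with an atlas of local frames:
`frame i` is a frame over the open set `dom i` (its values outside `dom i` carry no information),
and the transition matrices between frames are holomorphic. -/
structure HolBundle (V : Type w) [NormedAddCommGroup V] [NormedSpace ℂ V]
    (X : Type u) [TopologicalSpace X] [ChartedSpace V X] where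
  fiber : X → Type
  [acg : ∀ x, AddCommGroup (fiber x)]
  [mod : ∀ x, Module ℂ (fiber x)]
  κ : Type
  [fin : Fintype κ]
  chart : Type u
  dom : chart → TopologicalSpace.Opens X
  exists_mem_dom : ∀ x, ∃ i, x ∈ dom i
  frame : chart → ∀ x, Module.Basis κ ℂ (fiber x)
  holo_transition : ∀ i j x, x ∈ dom i → x ∈ dom j → ∀ a b,
    ContMDiffAt 𝓘(ℂ, V) 𝓘(ℂ, ℂ) ω (fun x' => (frame j x').repr (frame i x' a) b) x

namespace HolBundle

attribute [instance] HolBundle.acg HolBundle.mod HolBundle.fin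

variable {V : Type w} [NormedAddCommGroup V] [NormedSpace ℂ V]
  {X : Type u} [TopologicalSpace X] [ChartedSpace V X]

section Sections

variable {W : Type*} [NormedAddCommGroup W] [NormedSpace ℂ W] {H : Type*} [TopologicalSpace H]
  {J : ModelWithCorners ℂ W H} {Z : Type*} [TopologicalSpace Z] [ChartedSpace H Z]
  {W' : Type*} [NormedAddCommGroup W'] [NormedSpace ℂ W'] {H' : Type*} [TopologicalSpace H']
  {J' : ModelWithCorners ℂ W' H'} {Z' : Type*} [TopologicalSpace Z'] [ChartedSpace H' Z']

variable (J) in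
/-- The section `s` of `E` along the map `g : Z → X` is holomorphic at `z`: its coordinates in the
local frames are. -/
def IsHolAt (E : HolBundle V X) (g : Z → X) (s : ∀ z, E.fiber (g z)) (z : Z) : Prop :=
  ∀ i, g z ∈ E.dom i → ∀ a,
    ContMDiffAt J 𝓘(ℂ, ℂ) ω (fun z' => (E.frame i (g z')).repr (s z') a) z

theorem isHolAt_of_frame (E : HolBundle V X) {g : Z → X} {s : ∀ z, E.fiber (g z)} {z : Z}
    (hg : ContMDiffAt J 𝓘(ℂ, V) ω g z) (i : E.chart) (hi : g z ∈ E.dom i)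
    (h : ∀ a, ContMDiffAt J 𝓘(ℂ, ℂ) ω (fun z' => (E.frame i (g z')).repr (s z') a) z) :
    E.IsHolAt J g s z := by
  intro j hj b
  have key : (fun z' => (E.frame j (g z')).repr (s z') b) = fun z' => ∑ a,
      (E.frame i (g z')).repr (s z') a * (E.frame j (g z')).repr (E.frame i (g z') a) b := by
    funext z'
    conv_lhs => rw [← (E.frame i (g z')).sum_repr (s z')]
    simp only [map_sum, map_smul, Finsupp.finsetSum_apply, Finsupp.smul_apply, smul_eq_mul]
  rw [key]
  refine contMDiffAt_finsetSum fun a _ => ?_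
  exact (h a).mul ((E.holo_transition i j (g z) hi hj a b).comp z hg)

theorem isHolAt_frame (E : HolBundle V X) {g : Z → X} {z : Z}
    (hg : ContMDiffAt J 𝓘(ℂ, V) ω g z) (i : E.chart) (hi : g z ∈ E.dom i) (a : E.κ) :
    E.IsHolAt J g (fun z' => E.frame i (g z') a) z :=
  fun j hj b => (E.holo_transition i j (g z) hi hj a b).comp z hg

theorem IsHolAt.add {E : HolBundle V X} {g : Z → X} {s t : ∀ z, E.fiber (g z)} {z : Z}
    (hs : E.IsHolAt J g s z) (ht : E.IsHolAt J g t z) :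
    E.IsHolAt J g (fun z' => s z' + t z') z := by
  intro i hi a
  have := (hs i hi a).add (ht i hi a)
  refine this.congr_of_eventuallyEq (Filter.Eventually.of_forall fun z' => ?_)
  simp

theorem IsHolAt.const_smul {E : HolBundle V X} {g : Z → X} {s : ∀ z, E.fiber (g z)} {z : Z}
    (c : ℂ) (hs : E.IsHolAt J g s z) : E.IsHolAt J g (fun z' => c • s z') z := by
  intro i hi a
  have := (contMDiffAt_const (c := c)).mul (hs i hi a)
  refine this.congr_of_eventuallyEq (Filter.Eventually.of_forall fun z' => ?_)
  simp

theorem isHolAt_zero (E : HolBundle V X) {g : Z → X} {z : Z} :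
    E.IsHolAt J g (fun _ => 0) z := by
  intro i hi a
  simpa using contMDiffAt_const

theorem IsHolAt.comp {E : HolBundle V X} {g : Z → X} {s : ∀ z, E.fiber (g z)} {h : Z' → Z}
    {z : Z'} (hs : E.IsHolAt J g s (h z)) (hh : ContMDiffAt J' J ω h z) :
    E.IsHolAt J' (fun z' => g (h z')) (fun z' => s (h z')) z :=
  fun i hi a => (hs i hi a).comp z hh

end Sections

/-- The identification of the fibres over equal points. -/
def cast (E : HolBundle V X) {x y : X} (h : x = y) : E.fiber x ≃ₗ[ℂ] E.fiber y :=
  h ▸ LinearEquiv.refl ℂ (E.fiber x)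

@[simp] theorem cast_rfl (E : HolBundle V X) {x : X} (h : x = x) (e : E.fiber x) :
    E.cast h e = e := rfl

/-- A morphism of holomorphic vector bundles: a holomorphic family of linear maps. -/
@[ext]
structure Hom (E F : HolBundle V X) where
  toFun : ∀ x, E.fiber x →ₗ[ℂ] F.fiber x
  holo : ∀ i a x, x ∈ E.dom i →
    F.IsHolAt 𝓘(ℂ, V) (fun x' => x') (fun x' => toFun x' (E.frame i x' a)) x

theorem Hom.isHolAt {E F : HolBundle V X} (f : Hom E F)
    {W : Type*} [NormedAddCommGroup W] [NormedSpace ℂ W] {H : Type*} [TopologicalSpace H]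
    {J : ModelWithCorners ℂ W H} {Z : Type*} [TopologicalSpace Z] [ChartedSpace H Z]
    {g : Z → X} {s : ∀ z, E.fiber (g z)} {z : Z}
    (hg : ContMDiffAt J 𝓘(ℂ, V) ω g z) (hs : E.IsHolAt J g s z) :
    F.IsHolAt J g (fun z' => f.toFun (g z') (s z')) z := by
  obtain ⟨i, hi⟩ := E.exists_mem_dom (g z)
  intro j hj b
  have key : (fun z' => (F.frame j (g z')).repr (f.toFun (g z') (s z')) b) = fun z' => ∑ a,
      (E.frame i (g z')).repr (s z') a *
        (F.frame j (g z')).repr (f.toFun (g z') (E.frame i (g z') a)) b := by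
    funext z'
    conv_lhs => rw [← (E.frame i (g z')).sum_repr (s z')]
    simp only [map_sum, map_smul, Finsupp.finsetSum_apply, Finsupp.smul_apply, smul_eq_mul]
  rw [key]
  refine contMDiffAt_finsetSum fun a _ => ?_
  exact (hs i hi a).mul ((f.holo i a (g z) hi j hj b).comp z hg)

instance : Category (HolBundle V X) where
  Hom := Hom
  id E :=
    { toFun := fun _ => LinearMap.id
      holo := fun i a _ hx => E.isHolAt_frame contMDiffAt_id i hx a }
  comp f g :=
    { toFun := fun x => g.toFun x ∘ₗ f.toFun x
      holo := fun i a x hx => g.isHolAt contMDiffAt_id (f.holo i a x hx) }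

@[ext] theorem hom_ext {E F : HolBundle V X} {f g : E ⟶ F}
    (h : ∀ x, Hom.toFun f x = Hom.toFun g x) : f = g :=
  Hom.ext (funext h)

@[simp] theorem id_toFun (E : HolBundle V X) (x : X) :
    Hom.toFun (𝟙 E) x = LinearMap.id := rfl

@[simp] theorem comp_toFun {E F G : HolBundle V X} (f : E ⟶ F) (g : F ⟶ G) (x : X) :
    Hom.toFun (f ≫ g) x = Hom.toFun g x ∘ₗ Hom.toFun f x := rfl

/-- A pointwise linear isomorphism, holomorphic in both directions. -/
def mkIso {E F : HolBundle V X} (e : ∀ x, E.fiber x ≃ₗ[ℂ] F.fiber x)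
    (h : ∀ i a x, x ∈ E.dom i →
      F.IsHolAt 𝓘(ℂ, V) (fun x' => x') (fun x' => e x' (E.frame i x' a)) x)
    (h' : ∀ i a x, x ∈ F.dom i →
      E.IsHolAt 𝓘(ℂ, V) (fun x' => x') (fun x' => (e x').symm (F.frame i x' a)) x) : E ≅ F where
  hom := Hom.mk (fun x => (e x).toLinearMap) h
  inv := Hom.mk (fun x => (e x).symm.toLinearMap) h'
  hom_inv_id := hom_ext fun x => by ext v; exact (e x).symm_apply_apply v
  inv_hom_id := hom_ext fun x => by ext v; exact (e x).apply_symm_apply v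

/-! ### Tensor products -/

/-- The trivial line bundle `𝓞`. -/
def unit : HolBundle V X where
  fiber := fun _ => ℂ
  κ := Unit
  chart := PUnit
  dom := fun _ => ⊤
  exists_mem_dom := fun _ => ⟨PUnit.unit, trivial⟩
  frame := fun _ _ => Module.Basis.singleton Unit ℂ
  holo_transition := fun _ _ _ _ _ _ _ => contMDiffAt_const

/-- The tensor product of holomorphic vector bundles. -/
def tensor (E F : HolBundle V X) : HolBundle V X where
  fiber := fun x => E.fiber x ⊗[ℂ] F.fiber x
  κ := E.κ × F.κ
  chart := E.chart × F.chart
  dom := fun i => E.dom i.1 ⊓ F.dom i.2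
  exists_mem_dom := fun x =>
    let ⟨i, hi⟩ := E.exists_mem_dom x
    let ⟨j, hj⟩ := F.exists_mem_dom x
    ⟨(i, j), hi, hj⟩
  frame := fun i x => (E.frame i.1 x).tensorProduct (F.frame i.2 x)
  holo_transition := fun i j x hi hj a b => by
    have := (F.holo_transition i.2 j.2 x hi.2 hj.2 a.2 b.2).mul
      (E.holo_transition i.1 j.1 x hi.1 hj.1 a.1 b.1)
    refine this.congr_of_eventuallyEq (Filter.Eventually.of_forall fun x' => ?_)
    obtain ⟨b₁, b₂⟩ := b
    beta_reduce
    rw [Module.Basis.tensorProduct_apply', Module.Basis.tensorProduct_repr_tmul_apply]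
    rfl

theorem isHolAt_tmul {E F : HolBundle V X}
    {W : Type*} [NormedAddCommGroup W] [NormedSpace ℂ W] {H : Type*} [TopologicalSpace H]
    {J : ModelWithCorners ℂ W H} {Z : Type*} [TopologicalSpace Z] [ChartedSpace H Z]
    {g : Z → X} {s : ∀ z, E.fiber (g z)} {t : ∀ z, F.fiber (g z)} {z : Z}
    (hs : E.IsHolAt J g s z) (ht : F.IsHolAt J g t z) :
    (tensor E F).IsHolAt J g (fun z' => s z' ⊗ₜ[ℂ] t z') z := by
  intro i hi a
  have := (ht i.2 hi.2 a.2).mul (hs i.1 hi.1 a.1)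
  refine this.congr_of_eventuallyEq (Filter.Eventually.of_forall fun x' => ?_)
  exact Module.Basis.tensorProduct_repr_tmul_apply _ _ _ _ _ _

theorem tensor_frame (E F : HolBundle V X) (i : (tensor E F).chart) (x : X)
    (a : (tensor E F).κ) :
    (tensor E F).frame i x a = E.frame i.1 x a.1 ⊗ₜ[ℂ] F.frame i.2 x a.2 :=
  Module.Basis.tensorProduct_apply' _ _ _

theorem unit_frame (i : (unit (V := V) (X := X)).chart) (x : X)
    (a : (unit (V := V) (X := X)).κ) : (unit (V := V)).frame i x a = (1 : ℂ) :=
  Module.Basis.singleton_apply Unit ℂ a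

theorem isHolAt_unit_const (c : ℂ) {x : X} :
    (unit (V := V)).IsHolAt 𝓘(ℂ, V) (fun x' : X => x') (fun _ => c) x := by
  intro i _ a
  exact contMDiffAt_const

/-- The tensor product of two morphisms. -/
def tensorHom {E F E' F' : HolBundle V X} (f : Hom E F) (g : Hom E' F') :
    Hom (tensor E E') (tensor F F') where
  toFun := fun x => TensorProduct.map (f.toFun x) (g.toFun x)
  holo := fun i a x hx => by
    simp only [tensor_frame]
    exact isHolAt_tmul (f.holo _ _ _ hx.1) (g.holo _ _ _ hx.2)

theorem isHolAt_frame' (E : HolBundle V X) (i : E.chart) (a : E.κ) {x : X} (hx : x ∈ E.dom i) :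
    E.IsHolAt 𝓘(ℂ, V) (fun x' => x') (fun x' => E.frame i x' a) x :=
  E.isHolAt_frame contMDiffAt_id i hx a

def associator (E F G : HolBundle V X) : tensor (tensor E F) G ≅ tensor E (tensor F G) :=
  mkIso (fun x => TensorProduct.assoc ℂ (E.fiber x) (F.fiber x) (G.fiber x))
    (fun i a x hx => by
      simp only [tensor_frame]
      exact isHolAt_tmul (E.isHolAt_frame' _ _ hx.1.1)
        (isHolAt_tmul (F.isHolAt_frame' _ _ hx.1.2) (G.isHolAt_frame' _ _ hx.2)))
    (fun i a x hx => by
      simp only [tensor_frame]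
      exact isHolAt_tmul (isHolAt_tmul (E.isHolAt_frame' _ _ hx.1)
        (F.isHolAt_frame' _ _ hx.2.1)) (G.isHolAt_frame' _ _ hx.2.2))

def leftUnitor (E : HolBundle V X) : tensor unit E ≅ E :=
  mkIso (fun x => TensorProduct.lid ℂ (E.fiber x))
    (fun i a x hx => by
      simp only [tensor_frame, unit_frame]
      have : ∀ x', TensorProduct.lid ℂ (E.fiber x') ((1 : ℂ) ⊗ₜ[ℂ] E.frame i.2 x' a.2) =
        E.frame i.2 x' a.2 := fun x' => by simp
      exact (funext this : (fun x' => TensorProduct.lid ℂ (E.fiber x')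
        ((1 : ℂ) ⊗ₜ[ℂ] E.frame i.2 x' a.2)) = _) ▸ E.isHolAt_frame' _ _ hx.2)
    (fun i a x hx => isHolAt_tmul (isHolAt_unit_const 1) (E.isHolAt_frame' _ _ hx))

def rightUnitor (E : HolBundle V X) : tensor E unit ≅ E :=
  mkIso (fun x => TensorProduct.rid ℂ (E.fiber x))
    (fun i a x hx => by
      simp only [tensor_frame, unit_frame]
      have : ∀ x', TensorProduct.rid ℂ (E.fiber x') (E.frame i.1 x' a.1 ⊗ₜ[ℂ] (1 : ℂ)) =
        E.frame i.1 x' a.1 := fun x' => by simp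
      exact (funext this : (fun x' => TensorProduct.rid ℂ (E.fiber x')
        (E.frame i.1 x' a.1 ⊗ₜ[ℂ] (1 : ℂ))) = _) ▸ E.isHolAt_frame' _ _ hx.1)
    (fun i a x hx => isHolAt_tmul (E.isHolAt_frame' _ _ hx) (isHolAt_unit_const 1))

def braiding (E F : HolBundle V X) : tensor E F ≅ tensor F E :=
  mkIso (fun x => TensorProduct.comm ℂ (E.fiber x) (F.fiber x))
    (fun i a x hx => by
      simp only [tensor_frame]
      exact isHolAt_tmul (F.isHolAt_frame' _ _ hx.2) (E.isHolAt_frame' _ _ hx.1))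
    (fun i a x hx => by
      simp only [tensor_frame]
      exact isHolAt_tmul (E.isHolAt_frame' _ _ hx.2) (F.isHolAt_frame' _ _ hx.1))

instance : MonoidalCategoryStruct (HolBundle V X) where
  tensorObj := tensor
  tensorUnit := unit
  tensorHom f g := tensorHom f g
  whiskerLeft E _ _ f := tensorHom (𝟙 E) f
  whiskerRight f E := tensorHom f (𝟙 E)
  associator := associator
  leftUnitor := leftUnitor
  rightUnitor := rightUnitor

instance : MonoidalCategory (HolBundle V X) where
  tensorHom_def f g := hom_ext fun x => TensorProduct.ext' fun _ _ => rfl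
  id_tensorHom_id E F := hom_ext fun x => TensorProduct.ext' fun _ _ => rfl
  tensorHom_comp_tensorHom _ _ _ _ := hom_ext fun x => TensorProduct.ext' fun _ _ => rfl
  whiskerLeft_id _ _ := hom_ext fun x => TensorProduct.ext' fun _ _ => rfl
  id_whiskerRight _ _ := hom_ext fun x => TensorProduct.ext' fun _ _ => rfl
  associator_naturality _ _ _ := hom_ext fun x => TensorProduct.ext_threefold fun _ _ _ => rfl
  leftUnitor_naturality f := hom_ext fun x => TensorProduct.ext' fun c v => by
    exact ((Hom.toFun f x).map_smul (c : ℂ) v).symm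
  rightUnitor_naturality f := hom_ext fun x => TensorProduct.ext' fun v c => by
    exact ((Hom.toFun f x).map_smul (c : ℂ) v).symm
  pentagon _ _ _ _ := hom_ext fun x => TensorProduct.ext_fourfold fun _ _ _ _ => rfl
  triangle E F := hom_ext fun x => TensorProduct.ext_threefold fun e c f => by
    exact (TensorProduct.smul_tmul (R := ℂ) (R' := ℂ)
      (M := E.fiber x) (N := F.fiber x) (c : ℂ) e f).symm

instance : SymmetricCategory (HolBundle V X) where
  braiding := braiding
  braiding_naturality_right _ _ _ _ := hom_ext fun x => TensorProduct.ext' fun _ _ => rfl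
  braiding_naturality_left _ _ := hom_ext fun x => TensorProduct.ext' fun _ _ => rfl
  hexagon_forward _ _ _ := hom_ext fun x => TensorProduct.ext_threefold fun _ _ _ => rfl
  hexagon_reverse E F G := hom_ext fun x => by
    refine (LinearMap.cancel_right (TensorProduct.assoc ℂ (E.fiber x) (F.fiber x)
      (G.fiber x)).surjective).1 ?_
    exact TensorProduct.ext_threefold fun _ _ _ => rfl
  symmetry _ _ := hom_ext fun x => TensorProduct.ext' fun _ _ => rfl

/-- The tensor powers of a holomorphic vector bundle. -/
def tensorPow (E : HolBundle V X) : ℕ → HolBundle V X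
  | 0 => unit
  | n + 1 => tensor (tensorPow E n) E

/-! ### Pullback -/

variable {Y : Type u} [TopologicalSpace Y] [ChartedSpace V Y]

/-- The pullback of a holomorphic vector bundle along a holomorphic map. -/
def pullback (p : C^ω⟮𝓘(ℂ, V), Y; 𝓘(ℂ, V), X⟯) (E : HolBundle V X) : HolBundle V Y where
  fiber := fun y => E.fiber (p y)
  κ := E.κ
  chart := E.chart
  dom := fun i => ⟨p ⁻¹' E.dom i, (E.dom i).isOpen.preimage p.contMDiff.continuous⟩
  exists_mem_dom := fun y => E.exists_mem_dom (p y)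
  frame := fun i y => E.frame i (p y)
  holo_transition := fun i j y hi hj a b =>
    (E.holo_transition i j (p y) hi hj a b).comp y p.contMDiff.contMDiffAt

/-- The pullback of a morphism. -/
def pullbackHom (p : C^ω⟮𝓘(ℂ, V), Y; 𝓘(ℂ, V), X⟯) {E F : HolBundle V X} (f : Hom E F) :
    Hom (pullback p E) (pullback p F) where
  toFun := fun y => f.toFun (p y)
  holo := fun i a y hy j hj b =>
    (f.holo i a (p y) hy j hj b).comp y p.contMDiff.contMDiffAt

end HolBundle

/-- A holomorphic line bundle. -/
structure HolLineBundle (V : Type w) [NormedAddCommGroup V] [NormedSpace ℂ V]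
    (X : Type u) [TopologicalSpace X] [ChartedSpace V X] extends HolBundle V X where
  rank_eq_one : Fintype.card κ = 1

namespace HolLineBundle

variable {V : Type w} [NormedAddCommGroup V] [NormedSpace ℂ V]
  {X : Type u} [TopologicalSpace X] [ChartedSpace V X]

/-- The trivial line bundle. -/
def trivial : HolLineBundle V X where
  toHolBundle := HolBundle.unit
  rank_eq_one := Fintype.card_unit

theorem tmul_comm (L : HolLineBundle V X) (x : X) (l l' : L.fiber x) :
    l ⊗ₜ[ℂ] l' = l' ⊗ₜ[ℂ] l := by
  obtain ⟨i, -⟩ := L.exists_mem_dom x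
  obtain ⟨k, hk⟩ := Fintype.card_eq_one_iff.1 L.rank_eq_one
  have key : ∀ m : L.fiber x, m = (L.frame i x).repr m k • L.frame i x k := fun m => by
    conv_lhs => rw [← (L.frame i x).sum_repr m]
    exact Fintype.sum_eq_single k fun j hj => absurd (hk j) hj
  rw [key l, key l']
  simp only [TensorProduct.smul_tmul', TensorProduct.tmul_smul]
  rw [smul_comm]

end HolLineBundle

/-! ### Higgs bundles -/

namespace HiggsAux

variable {E E' F F' G L M : Type*} [AddCommGroup E] [Module ℂ E] [AddCommGroup E'] [Module ℂ E']
  [AddCommGroup F] [Module ℂ F] [AddCommGroup F'] [Module ℂ F'] [AddCommGroup G] [Module ℂ G]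
  [AddCommGroup L] [Module ℂ L] [AddCommGroup M] [Module ℂ M]

/-- `a ⊗ 1 + 1 ⊗ b`, with the factor `L` moved to the right. -/
def tensorEnd (a : E →ₗ[ℂ] E ⊗[ℂ] L) (b : F →ₗ[ℂ] F ⊗[ℂ] L) :
    E ⊗[ℂ] F →ₗ[ℂ] (E ⊗[ℂ] F) ⊗[ℂ] L :=
  (TensorProduct.rightComm ℂ E L F).toLinearMap ∘ₗ a.rTensor F +
    (TensorProduct.assoc ℂ E F L).symm.toLinearMap ∘ₗ b.lTensor E

theorem tensorEnd_tmul (a : E →ₗ[ℂ] E ⊗[ℂ] L) (b : F →ₗ[ℂ] F ⊗[ℂ] L) (e : E) (f : F) :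
    tensorEnd a b (e ⊗ₜ f) = TensorProduct.rightComm ℂ E L F (a e ⊗ₜ f) +
      (TensorProduct.assoc ℂ E F L).symm (e ⊗ₜ b f) := rfl

theorem tensorEnd_add (a a' : E →ₗ[ℂ] E ⊗[ℂ] L) (b b' : F →ₗ[ℂ] F ⊗[ℂ] L) :
    tensorEnd (a + a') (b + b') = tensorEnd a b + tensorEnd a' b' :=
  TensorProduct.ext' fun e f => by
    simp only [LinearMap.add_apply, tensorEnd_tmul, map_add, TensorProduct.add_tmul,
      TensorProduct.tmul_add]
    abel

theorem tensorEnd_smul (c : ℂ) (a : E →ₗ[ℂ] E ⊗[ℂ] L) (b : F →ₗ[ℂ] F ⊗[ℂ] L) :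
    tensorEnd (c • a) (c • b) = c • tensorEnd a b :=
  TensorProduct.ext' fun e f => by
    simp only [LinearMap.smul_apply, tensorEnd_tmul, map_smul, TensorProduct.tmul_smul,
      ← TensorProduct.smul_tmul', smul_add]

theorem rTensor_tensorEnd_rightComm (a : E →ₗ[ℂ] E ⊗[ℂ] L) (b : F →ₗ[ℂ] F ⊗[ℂ] L)
    (t : E ⊗[ℂ] L) (f : F) :
    (tensorEnd a b).rTensor L (TensorProduct.rightComm ℂ E L F (t ⊗ₜ f)) =
      (TensorProduct.rightComm ℂ E L F).toLinearMap.rTensor L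
        (TensorProduct.rightComm ℂ (E ⊗[ℂ] L) L F (a.rTensor L t ⊗ₜ f)) +
      TensorProduct.rightComm ℂ (E ⊗[ℂ] F) L L
        ((TensorProduct.assoc ℂ (E ⊗[ℂ] F) L L).symm
          (TensorProduct.tensorTensorTensorComm ℂ E L F L (t ⊗ₜ b f))) := by
  induction t using TensorProduct.induction_on with
  | zero => simp
  | tmul e l =>
    generalize hu : b f = u
    simp only [TensorProduct.rightComm_tmul, LinearMap.rTensor_tmul, tensorEnd_tmul, hu,
      TensorProduct.add_tmul, LinearEquiv.coe_coe]
    congr 1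
    clear hu
    induction u using TensorProduct.induction_on with
    | zero => simp
    | tmul f' l' => simp
    | add u u' h h' => simp only [TensorProduct.tmul_add, TensorProduct.add_tmul, map_add, h, h']
  | add t t' h h' =>
    simp only [TensorProduct.add_tmul, map_add, h, h']
    abel

theorem rTensor_tensorEnd_assoc (a : E →ₗ[ℂ] E ⊗[ℂ] L) (b : F →ₗ[ℂ] F ⊗[ℂ] L)
    (e : E) (u : F ⊗[ℂ] L) :
    (tensorEnd a b).rTensor L ((TensorProduct.assoc ℂ E F L).symm (e ⊗ₜ u)) =
      (TensorProduct.assoc ℂ E F L).symm.toLinearMap.rTensor L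
        ((TensorProduct.assoc ℂ E (F ⊗[ℂ] L) L).symm (e ⊗ₜ b.rTensor L u)) +
      (TensorProduct.assoc ℂ (E ⊗[ℂ] F) L L).symm
          (TensorProduct.tensorTensorTensorComm ℂ E L F L (a e ⊗ₜ u)) := by
  induction u using TensorProduct.induction_on with
  | zero => simp
  | tmul f l =>
    generalize ht : a e = t
    simp only [TensorProduct.assoc_symm_tmul, LinearMap.rTensor_tmul, tensorEnd_tmul, ht,
      TensorProduct.add_tmul, LinearEquiv.coe_coe]
    rw [add_comm]
    congr 1
    clear ht
    induction t using TensorProduct.induction_on with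
    | zero => simp
    | tmul f' l' => simp
    | add u u' h h' => simp only [TensorProduct.add_tmul, map_add, h, h']
  | add t t' h h' =>
    simp only [TensorProduct.tmul_add, map_add, h, h']
    abel

theorem rightComm_eq_self (hL : ∀ l l' : L, l ⊗ₜ[ℂ] l' = l' ⊗ₜ[ℂ] l) (t : (E ⊗[ℂ] L) ⊗[ℂ] L) :
    TensorProduct.rightComm ℂ E L L t = t := by
  have : (TensorProduct.rightComm ℂ E L L).toLinearMap = LinearMap.id :=
    TensorProduct.ext_threefold fun e l l' => by
      have := congrArg (fun z => (TensorProduct.assoc ℂ E L L).symm (e ⊗ₜ z)) (hL l' l)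
      simpa using this
  exact LinearMap.congr_fun this t

theorem tensorEnd_comm (hL : ∀ l l' : L, l ⊗ₜ[ℂ] l' = l' ⊗ₜ[ℂ] l)
    (a a' : E →ₗ[ℂ] E ⊗[ℂ] L) (b b' : F →ₗ[ℂ] F ⊗[ℂ] L)
    (ha : ∀ e, a.rTensor L (a' e) = a'.rTensor L (a e))
    (hb : ∀ f, b.rTensor L (b' f) = b'.rTensor L (b f)) (t : E ⊗[ℂ] F) :
    (tensorEnd a b).rTensor L (tensorEnd a' b' t) =
      (tensorEnd a' b').rTensor L (tensorEnd a b t) := by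
  induction t using TensorProduct.induction_on with
  | zero => simp
  | tmul e f =>
    simp only [tensorEnd_tmul, map_add, rTensor_tensorEnd_rightComm, rTensor_tensorEnd_assoc,
      rightComm_eq_self hL, ha, hb]
    abel
  | add t t' h h' => simp only [map_add, h, h']

theorem map_tensorEnd (f : E →ₗ[ℂ] E') (g : F →ₗ[ℂ] F')
    (a : E →ₗ[ℂ] E ⊗[ℂ] L) (b : F →ₗ[ℂ] F ⊗[ℂ] L)
    (a' : E' →ₗ[ℂ] E' ⊗[ℂ] L) (b' : F' →ₗ[ℂ] F' ⊗[ℂ] L)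
    (ha : ∀ e, f.rTensor L (a e) = a' (f e)) (hb : ∀ e, g.rTensor L (b e) = b' (g e))
    (t : E ⊗[ℂ] F) :
    (TensorProduct.map f g).rTensor L (tensorEnd a b t) =
      tensorEnd a' b' (TensorProduct.map f g t) := by
  induction t using TensorProduct.induction_on with
  | zero => simp
  | tmul e e' =>
    simp only [tensorEnd_tmul, map_add, TensorProduct.map_tmul, ← ha, ← hb]
    congr 1
    · generalize a e = t
      induction t using TensorProduct.induction_on with
      | zero => simp
      | tmul _ _ => simp
      | add t t' h h' => simp only [TensorProduct.add_tmul, map_add, h, h']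
    · generalize b e' = t
      induction t using TensorProduct.induction_on with
      | zero => simp
      | tmul _ _ => simp
      | add t t' h h' => simp only [TensorProduct.tmul_add, map_add, h, h']
  | add t t' h h' => simp only [map_add, h, h']

theorem assoc_tensorEnd (a : E →ₗ[ℂ] E ⊗[ℂ] L) (b : F →ₗ[ℂ] F ⊗[ℂ] L) (c : G →ₗ[ℂ] G ⊗[ℂ] L)
    (t : (E ⊗[ℂ] F) ⊗[ℂ] G) :
    (TensorProduct.assoc ℂ E F G).toLinearMap.rTensor L (tensorEnd (tensorEnd a b) c t) =
      tensorEnd a (tensorEnd b c) (TensorProduct.assoc ℂ E F G t) := by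
  suffices h : (TensorProduct.assoc ℂ E F G).toLinearMap.rTensor L ∘ₗ
      tensorEnd (tensorEnd a b) c =
      tensorEnd a (tensorEnd b c) ∘ₗ (TensorProduct.assoc ℂ E F G).toLinearMap from
    LinearMap.congr_fun h t
  refine TensorProduct.ext_threefold fun e f g => ?_
  simp only [LinearMap.comp_apply, LinearEquiv.coe_coe, TensorProduct.assoc_tmul, tensorEnd_tmul,
    map_add, TensorProduct.add_tmul, TensorProduct.tmul_add, add_assoc]
  congr 1
  · generalize a e = t
    induction t using TensorProduct.induction_on with
    | zero => simp
    | tmul _ _ => simp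
    | add t t' h h' => simp only [TensorProduct.add_tmul, map_add, h, h']
  congr 1
  · generalize b f = t
    induction t using TensorProduct.induction_on with
    | zero => simp
    | tmul _ _ => simp
    | add t t' h h' => simp only [TensorProduct.add_tmul, TensorProduct.tmul_add, map_add, h, h']
  · generalize c g = t
    induction t using TensorProduct.induction_on with
    | zero => simp
    | tmul _ _ => simp
    | add t t' h h' => simp only [TensorProduct.tmul_add, map_add, h, h']

theorem comm_tensorEnd (a : E →ₗ[ℂ] E ⊗[ℂ] L) (b : F →ₗ[ℂ] F ⊗[ℂ] L) (t : E ⊗[ℂ] F) :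
    (TensorProduct.comm ℂ E F).toLinearMap.rTensor L (tensorEnd a b t) =
      tensorEnd b a (TensorProduct.comm ℂ E F t) := by
  induction t using TensorProduct.induction_on with
  | zero => simp
  | tmul e f =>
    simp only [TensorProduct.comm_tmul, tensorEnd_tmul, map_add]
    rw [add_comm]
    congr 1
    · generalize b f = t
      induction t using TensorProduct.induction_on with
      | zero => simp
      | tmul _ _ => simp
      | add t t' h h' => simp only [TensorProduct.add_tmul, TensorProduct.tmul_add, map_add, h, h']
    · generalize a e = t
      induction t using TensorProduct.induction_on with
      | zero => simp
      | tmul _ _ => simp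
      | add t t' h h' => simp only [TensorProduct.add_tmul, TensorProduct.tmul_add, map_add, h, h']
  | add t t' h h' => simp only [map_add, h, h']

theorem lid_tensorEnd (b : F →ₗ[ℂ] F ⊗[ℂ] L) (t : ℂ ⊗[ℂ] F) :
    (TensorProduct.lid ℂ F).toLinearMap.rTensor L (tensorEnd 0 b t) =
      b (TensorProduct.lid ℂ F t) := by
  induction t using TensorProduct.induction_on with
  | zero => simp
  | tmul c f =>
    simp only [tensorEnd_tmul, TensorProduct.lid_tmul, LinearMap.zero_apply,
      TensorProduct.zero_tmul, map_zero, zero_add, map_smul]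
    generalize b f = t
    induction t using TensorProduct.induction_on with
    | zero => simp
    | tmul _ _ => simp [TensorProduct.smul_tmul']
    | add t t' h h' => simp only [TensorProduct.tmul_add, map_add, smul_add, h, h']
  | add t t' h h' => simp only [map_add, h, h']

theorem rid_tensorEnd (a : E →ₗ[ℂ] E ⊗[ℂ] L) (t : E ⊗[ℂ] ℂ) :
    (TensorProduct.rid ℂ E).toLinearMap.rTensor L (tensorEnd a 0 t) =
      a (TensorProduct.rid ℂ E t) := by
  induction t using TensorProduct.induction_on with
  | zero => simp
  | tmul e c =>
    simp only [tensorEnd_tmul, TensorProduct.rid_tmul, LinearMap.zero_apply,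
      TensorProduct.tmul_zero, map_zero, add_zero, map_smul]
    generalize a e = t
    induction t using TensorProduct.induction_on with
    | zero => simp
    | tmul _ _ => simp [TensorProduct.smul_tmul']
    | add t t' h h' => simp only [TensorProduct.add_tmul, map_add, smul_add, h, h']
  | add t t' h h' => simp only [map_add, h, h']

theorem symm_tensorEnd (e : E ≃ₗ[ℂ] F) (a : E →ₗ[ℂ] E ⊗[ℂ] L) (b : F →ₗ[ℂ] F ⊗[ℂ] L)
    (h : ∀ v, e.toLinearMap.rTensor L (a v) = b (e v)) (v : F) :
    e.symm.toLinearMap.rTensor L (b v) = a (e.symm v) := by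
  obtain ⟨v, rfl⟩ := e.surjective v
  rw [← h, e.symm_apply_apply]
  generalize a v = t
  induction t using TensorProduct.induction_on with
  | zero => simp
  | tmul _ _ => simp
  | add t t' h h' => simp only [map_add, h, h']

theorem lTensor_comm (τ : L →ₗ[ℂ] M) (a a' : E →ₗ[ℂ] E ⊗[ℂ] L)
    (ha : ∀ e, a.rTensor L (a' e) = a'.rTensor L (a e)) (e : E) :
    (τ.lTensor E ∘ₗ a).rTensor M (τ.lTensor E (a' e)) =
      (τ.lTensor E ∘ₗ a').rTensor M (τ.lTensor E (a e)) := by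
  have key : ∀ (a : E →ₗ[ℂ] E ⊗[ℂ] L) (t : E ⊗[ℂ] L),
      (τ.lTensor E ∘ₗ a).rTensor M (τ.lTensor E t) =
        TensorProduct.map (τ.lTensor E) τ (a.rTensor L t) := fun a t => by
    induction t using TensorProduct.induction_on with
    | zero => simp
    | tmul _ _ => simp
    | add t t' h h' => simp only [map_add, h, h']
  rw [key, key, ha]

theorem lTensor_rTensor (τ : L →ₗ[ℂ] M) (f : E →ₗ[ℂ] F) (t : E ⊗[ℂ] L) :
    f.rTensor M (τ.lTensor E t) = τ.lTensor F (f.rTensor L t) := by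
  induction t using TensorProduct.induction_on with
  | zero => simp
  | tmul _ _ => simp
  | add t t' h h' => simp only [map_add, h, h']

/-- The composite `v ↦ (1 ⊗ τ) ∘ θ (d v)`. -/
def twistField {T T' : Type*} [AddCommGroup T] [Module ℂ T] [AddCommGroup T'] [Module ℂ T']
    (τ : L →ₗ[ℂ] M) (θ : T →ₗ[ℂ] E →ₗ[ℂ] E ⊗[ℂ] L) (d : T' →ₗ[ℂ] T) :
    T' →ₗ[ℂ] E →ₗ[ℂ] E ⊗[ℂ] M :=
  (θ ∘ₗ d).compr₂ (τ.lTensor E)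

theorem rTensor_lTensor_eq_smul {L' : Type*} [AddCommGroup L'] [Module ℂ L'] (f : E →ₗ[ℂ] E')
    (d : L →ₗ[ℂ] L') (τ : L →ₗ[ℂ] M) (τ' : L' →ₗ[ℂ] M) (c : ℂ) (h : ∀ l, τ l = c • τ' (d l))
    (t : E ⊗[ℂ] L) :
    f.rTensor M (τ.lTensor E t) = c • τ'.lTensor E' (TensorProduct.map f d t) := by
  induction t using TensorProduct.induction_on with
  | zero => simp
  | tmul _ _ => simp [h]
  | add t t' h h' => simp only [map_add, smul_add, h, h']

end HiggsAux

section Higgs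

variable {V : Type w} [NormedAddCommGroup V] [NormedSpace ℂ V]
  {X : Type u} [TopologicalSpace X] [ChartedSpace V X] [IsManifold 𝓘(ℂ, V) ω X]

/-- An `L`-twisted Higgs bundle `(E, θ)`: the Higgs field `θ ∈ H⁰(End E ⊗ L ⊗ Ω¹)` is a family of
linear maps `θ_x : T_x X → Hom(E_x, E_x ⊗ L_x)` which is holomorphic (as a fibrewise linear function
on the total space of the tangent bundle) and satisfies `θ ∧ θ = 0`. -/
structure TwistedHiggs (L : HolLineBundle V X) where
  bundle : HolBundle V X
  field : ∀ x : X, TangentSpace 𝓘(ℂ, V) x →ₗ[ℂ]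
    (bundle.fiber x →ₗ[ℂ] bundle.fiber x ⊗[ℂ] L.fiber x)
  holo : ∀ i a (v : TangentBundle 𝓘(ℂ, V) X), v.1 ∈ bundle.dom i →
    (HolBundle.tensor bundle L.toHolBundle).IsHolAt 𝓘(ℂ, V).tangent
      (fun v' : TangentBundle 𝓘(ℂ, V) X => v'.1)
      (fun v' => field v'.1 v'.2 (bundle.frame i v'.1 a)) v
  integrable : ∀ (x : X) (v v' : TangentSpace 𝓘(ℂ, V) x) (e : bundle.fiber x),
    (field x v).rTensor (L.fiber x) (field x v' e) =
      (field x v').rTensor (L.fiber x) (field x v e)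

namespace TwistedHiggs

open HolBundle

variable {L : HolLineBundle V X}

theorem contMDiff_tangentProj :
    ContMDiff 𝓘(ℂ, V).tangent 𝓘(ℂ, V) ω (fun v : TangentBundle 𝓘(ℂ, V) X => v.1) :=
  Bundle.contMDiff_proj (TangentSpace 𝓘(ℂ, V))

/-- A morphism of `L`-twisted Higgs bundles: a morphism of bundles commuting with the fields. -/
@[ext]
structure Hom (P Q : TwistedHiggs L) where
  hom : P.bundle ⟶ Q.bundle
  comm : ∀ (x : X) (v : TangentSpace 𝓘(ℂ, V) x) (e : P.bundle.fiber x),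
    (HolBundle.Hom.toFun hom x).rTensor (L.fiber x) (P.field x v e) =
      Q.field x v (HolBundle.Hom.toFun hom x e)

instance : Category (TwistedHiggs L) where
  Hom := Hom
  id P :=
    { hom := 𝟙 P.bundle
      comm := fun x v e => by
        simp only [id_toFun, LinearMap.rTensor_id, LinearMap.id_apply] }
  comp f g :=
    { hom := f.hom ≫ g.hom
      comm := fun x v e => by
        simp only [comp_toFun, LinearMap.rTensor_comp, LinearMap.comp_apply, f.comm, g.comm] }

@[ext] theorem hom_ext {P Q : TwistedHiggs L} {f g : P ⟶ Q} (h : Hom.hom f = Hom.hom g) : f = g :=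
  Hom.ext h

@[simp] theorem id_hom (P : TwistedHiggs L) : Hom.hom (𝟙 P) = 𝟙 P.bundle := rfl

@[simp] theorem comp_hom {P Q R : TwistedHiggs L} (f : P ⟶ Q) (g : Q ⟶ R) :
    Hom.hom (f ≫ g) = Hom.hom f ≫ Hom.hom g := rfl

theorem isHolAt_iso_hom {E F : HolBundle V X} (e : E ≅ F)
    {s : ∀ v : TangentBundle 𝓘(ℂ, V) X, E.fiber v.1} {v : TangentBundle 𝓘(ℂ, V) X}
    (hs : E.IsHolAt 𝓘(ℂ, V).tangent (fun v' => v'.1) s v) :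
    F.IsHolAt 𝓘(ℂ, V).tangent (fun v' => v'.1) (fun v' => HolBundle.Hom.toFun e.hom v'.1 (s v')) v :=
  HolBundle.Hom.isHolAt e.hom contMDiff_tangentProj.contMDiffAt hs

/-- The canonical isomorphism `(E ⊗ F) ⊗ G ≅ (E ⊗ G) ⊗ F`. -/
def rightCommIso (E F G : HolBundle V X) : tensor (tensor E F) G ≅ tensor (tensor E G) F :=
  mkIso (fun x => TensorProduct.rightComm ℂ (E.fiber x) (F.fiber x) (G.fiber x))
    (fun i a x hx => by
      simp only [tensor_frame]
      exact isHolAt_tmul (isHolAt_tmul (E.isHolAt_frame' _ _ hx.1.1) (G.isHolAt_frame' _ _ hx.2))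
        (F.isHolAt_frame' _ _ hx.1.2))
    (fun i a x hx => by
      simp only [tensor_frame]
      exact isHolAt_tmul (isHolAt_tmul (E.isHolAt_frame' _ _ hx.1.1) (F.isHolAt_frame' _ _ hx.2))
        (G.isHolAt_frame' _ _ hx.1.2))

/-- `(E, θ) ⊗ (F, η) = (E ⊗ F, θ ⊗ 1 + 1 ⊗ η)`. -/
def tensor (P Q : TwistedHiggs L) : TwistedHiggs L where
  bundle := HolBundle.tensor P.bundle Q.bundle
  field := fun x =>
    { toFun := fun v => HiggsAux.tensorEnd (P.field x v) (Q.field x v)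
      map_add' := fun v v' => by
        rw [map_add, map_add]
        exact HiggsAux.tensorEnd_add _ _ _ _
      map_smul' := fun c v => by
        rw [map_smul, map_smul]
        exact HiggsAux.tensorEnd_smul _ _ _ }
  holo := fun i a v hv => by
    have hP := isHolAt_iso_hom (rightCommIso P.bundle L.toHolBundle Q.bundle)
      (isHolAt_tmul (P.holo i.1 a.1 v hv.1)
        (Q.bundle.isHolAt_frame contMDiff_tangentProj.contMDiffAt i.2 hv.2 a.2))
    have hQ := isHolAt_iso_hom (HolBundle.associator P.bundle Q.bundle L.toHolBundle).symm
      (isHolAt_tmul (P.bundle.isHolAt_frame contMDiff_tangentProj.contMDiffAt i.1 hv.1 a.1)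
        (Q.holo i.2 a.2 v hv.2))
    have := hP.add hQ
    simp only [tensor_frame]
    exact this
  integrable := fun x v v' e =>
    HiggsAux.tensorEnd_comm (L.tmul_comm x) _ _ _ _ (P.integrable x v v') (Q.integrable x v v') e

/-- The unit `(𝓞, 0)`. -/
def unit : TwistedHiggs L where
  bundle := HolBundle.unit
  field := fun _ => 0
  holo := fun _ _ _ _ => isHolAt_zero _
  integrable := fun _ _ _ _ => by simp

def tensorHom {P Q P' Q' : TwistedHiggs L} (f : Hom P Q) (g : Hom P' Q') :
    Hom (tensor P P') (tensor Q Q') where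
  hom := HolBundle.tensorHom f.hom g.hom
  comm := fun x v e => HiggsAux.map_tensorEnd _ _ _ _ _ _ (f.comm x v) (g.comm x v) e

/-- A bundle isomorphism commuting with the Higgs fields is an isomorphism of Higgs bundles. -/
def mkIso {P Q : TwistedHiggs L} (e : P.bundle ≅ Q.bundle)
    (h : ∀ x v t, (HolBundle.Hom.toFun e.hom x).rTensor (L.fiber x) (P.field x v t) =
      Q.field x v (HolBundle.Hom.toFun e.hom x t)) : P ≅ Q where
  hom := Hom.mk e.hom h
  inv := Hom.mk e.inv fun x v t => by
    have h₁ : ∀ s, HolBundle.Hom.toFun e.inv x (HolBundle.Hom.toFun e.hom x s) = s := fun s =>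
      LinearMap.congr_fun (congrArg (fun k => HolBundle.Hom.toFun k x) e.hom_inv_id) s
    have h₂ : ∀ s, HolBundle.Hom.toFun e.hom x (HolBundle.Hom.toFun e.inv x s) = s := fun s =>
      LinearMap.congr_fun (congrArg (fun k => HolBundle.Hom.toFun k x) e.inv_hom_id) s
    exact HiggsAux.symm_tensorEnd
      { HolBundle.Hom.toFun e.hom x with
        invFun := HolBundle.Hom.toFun e.inv x
        left_inv := h₁
        right_inv := h₂ } _ _ (h x v) t
  hom_inv_id := hom_ext e.hom_inv_id
  inv_hom_id := hom_ext e.inv_hom_id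

instance : MonoidalCategoryStruct (TwistedHiggs L) where
  tensorObj := tensor
  tensorUnit := unit
  tensorHom f g := tensorHom f g
  whiskerLeft P _ _ f := tensorHom (𝟙 P) f
  whiskerRight f P := tensorHom f (𝟙 P)
  associator P Q R := mkIso (HolBundle.associator P.bundle Q.bundle R.bundle)
    fun _ _ t => HiggsAux.assoc_tensorEnd _ _ _ t
  leftUnitor P := mkIso (HolBundle.leftUnitor P.bundle) fun _ _ t => HiggsAux.lid_tensorEnd _ t
  rightUnitor P := mkIso (HolBundle.rightUnitor P.bundle) fun _ _ t => HiggsAux.rid_tensorEnd _ t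

instance : MonoidalCategory (TwistedHiggs L) where
  tensorHom_def f g := hom_ext (MonoidalCategory.tensorHom_def (Hom.hom f) (Hom.hom g))
  id_tensorHom_id P Q := hom_ext (MonoidalCategory.id_tensorHom_id P.bundle Q.bundle)
  tensorHom_comp_tensorHom f g h k := hom_ext
    (MonoidalCategory.tensorHom_comp_tensorHom (Hom.hom f) (Hom.hom g) (Hom.hom h) (Hom.hom k))
  whiskerLeft_id P Q := hom_ext (MonoidalCategory.whiskerLeft_id P.bundle Q.bundle)
  id_whiskerRight P Q := hom_ext (MonoidalCategory.id_whiskerRight P.bundle Q.bundle)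
  associator_naturality f g h := hom_ext
    (MonoidalCategory.associator_naturality (Hom.hom f) (Hom.hom g) (Hom.hom h))
  leftUnitor_naturality f := hom_ext (MonoidalCategory.leftUnitor_naturality (Hom.hom f))
  rightUnitor_naturality f := hom_ext (MonoidalCategory.rightUnitor_naturality (Hom.hom f))
  pentagon P Q R S := hom_ext
    (MonoidalCategory.pentagon P.bundle Q.bundle R.bundle S.bundle)
  triangle P Q := hom_ext (MonoidalCategory.triangle P.bundle Q.bundle)

instance : SymmetricCategory (TwistedHiggs L) where
  braiding P Q := mkIso (HolBundle.braiding P.bundle Q.bundle)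
    fun _ _ t => HiggsAux.comm_tensorEnd _ _ t
  braiding_naturality_right P _ _ f := hom_ext
    (BraidedCategory.braiding_naturality_right P.bundle (Hom.hom f))
  braiding_naturality_left f P := hom_ext
    (BraidedCategory.braiding_naturality_left (Hom.hom f) P.bundle)
  hexagon_forward P Q R := hom_ext
    (BraidedCategory.hexagon_forward P.bundle Q.bundle R.bundle)
  hexagon_reverse P Q R := hom_ext
    (BraidedCategory.hexagon_reverse P.bundle Q.bundle R.bundle)
  symmetry P Q := hom_ext (SymmetricCategory.symmetry P.bundle Q.bundle)

/-- The Higgs bundle `(E, c θ)`. -/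
def scale (c : ℂ) (P : TwistedHiggs L) : TwistedHiggs L where
  bundle := P.bundle
  field := fun x => c • P.field x
  holo := fun i a v hv => (P.holo i a v hv).const_smul c
  integrable := fun x v v' e => by
    simp only [LinearMap.smul_apply, LinearMap.rTensor_smul, map_smul, P.integrable x v v' e]

/-! ### Pullback of Higgs bundles -/

variable {Y : Type u} [TopologicalSpace Y] [ChartedSpace V Y] [IsManifold 𝓘(ℂ, V) ω Y]

/-- The pullback `(p^*E, p^*θ)` of an `L`-twisted Higgs bundle along a holomorphic map `p`, viewed
as an `M`-twisted Higgs bundle through a morphism `τ : p^*L → M`. -/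
def pullbackObj (p : C^ω⟮𝓘(ℂ, V), Y; 𝓘(ℂ, V), X⟯) {M : HolLineBundle V Y}
    (τ : HolBundle.pullback p L.toHolBundle ⟶ M.toHolBundle) (P : TwistedHiggs L) :
    TwistedHiggs M where
  bundle := HolBundle.pullback p P.bundle
  field := fun y =>
    HiggsAux.twistField (HolBundle.Hom.toFun τ y) (P.field (p y))
      (mfderiv 𝓘(ℂ, V) 𝓘(ℂ, V) p y).toLinearMap
  holo := fun i a v hv => by
    have h₀ : ContMDiff 𝓘(ℂ, V).tangent 𝓘(ℂ, V).tangent ω (tangentMap 𝓘(ℂ, V) 𝓘(ℂ, V) p) :=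
      p.contMDiff.contMDiff_tangentMap le_rfl
    have h₁ := (P.holo i a (tangentMap 𝓘(ℂ, V) 𝓘(ℂ, V) p v) hv).comp h₀.contMDiffAt
    exact HolBundle.Hom.isHolAt
      (HolBundle.tensorHom (𝟙 (HolBundle.pullback p P.bundle)) τ)
      contMDiff_tangentProj.contMDiffAt
      (s := fun v' : TangentBundle 𝓘(ℂ, V) Y =>
        P.field (p v'.1) (mfderiv 𝓘(ℂ, V) 𝓘(ℂ, V) p v'.1 v'.2) (P.bundle.frame i (p v'.1) a)) h₁
  integrable := fun y v v' e =>
    HiggsAux.lTensor_comm _ _ _ (fun e => P.integrable (p y) _ _ e) e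

theorem pullbackObj_field (p : C^ω⟮𝓘(ℂ, V), Y; 𝓘(ℂ, V), X⟯) {M : HolLineBundle V Y}
    (τ : HolBundle.pullback p L.toHolBundle ⟶ M.toHolBundle) (P : TwistedHiggs L) (y : Y)
    (v : TangentSpace 𝓘(ℂ, V) y) (e : P.bundle.fiber (p y)) :
    (pullbackObj p τ P).field y v e = (HolBundle.Hom.toFun τ y).lTensor (P.bundle.fiber (p y))
      (P.field (p y) (mfderiv 𝓘(ℂ, V) 𝓘(ℂ, V) p y v) e) := rfl

end TwistedHiggs

/-- A Higgs bundle `(F, φ)`, `φ ∈ H⁰(End F ⊗ Ω¹)`: a Higgs bundle twisted by the trivial line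
bundle. -/
abbrev HiggsBundle (V : Type w) [NormedAddCommGroup V] [NormedSpace ℂ V] (X : Type u)
    [TopologicalSpace X] [ChartedSpace V X] [IsManifold 𝓘(ℂ, V) ω X] :=
  TwistedHiggs (HolLineBundle.trivial (V := V) (X := X))

/-- The canonical isomorphism `p^*𝓞 = 𝓞`. -/
def HolBundle.pullbackUnit {Y : Type u} [TopologicalSpace Y] [ChartedSpace V Y]
    (p : C^ω⟮𝓘(ℂ, V), Y; 𝓘(ℂ, V), X⟯) :
    HolBundle.pullback p (HolBundle.unit (V := V) (X := X)) ≅ HolBundle.unit (V := V) (X := Y) :=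
  HolBundle.mkIso (fun _ => LinearEquiv.refl ℂ ℂ)
    (fun _ _ _ _ => fun _ _ _ =>
      contMDiffAt_const (c := (Module.Basis.singleton Unit ℂ).repr _ _))
    (fun _ _ _ _ => fun _ _ _ =>
      contMDiffAt_const (c := (Module.Basis.singleton Unit ℂ).repr _ _))

/-- The pullback `(p^*F, p^*φ)` of an ordinary Higgs bundle. -/
def HiggsBundle.pullback {Y : Type u} [TopologicalSpace Y] [ChartedSpace V Y]
    [IsManifold 𝓘(ℂ, V) ω Y] (p : C^ω⟮𝓘(ℂ, V), Y; 𝓘(ℂ, V), X⟯) (P : HiggsBundle V X) :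
    HiggsBundle V Y :=
  TwistedHiggs.pullbackObj p (HolBundle.pullbackUnit p).hom P

theorem HiggsBundle.pullback_field {Y : Type u} [TopologicalSpace Y] [ChartedSpace V Y]
    [IsManifold 𝓘(ℂ, V) ω Y] (p : C^ω⟮𝓘(ℂ, V), Y; 𝓘(ℂ, V), X⟯) (P : HiggsBundle V X) (y : Y)
    (v : TangentSpace 𝓘(ℂ, V) y) (e : P.bundle.fiber (p y)) :
    (HiggsBundle.pullback p P).field y v e =
      P.field (p y) (mfderiv 𝓘(ℂ, V) 𝓘(ℂ, V) p y v) e :=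
  LinearMap.congr_fun (LinearMap.lTensor_id (P.bundle.fiber (p y))
    ((HolLineBundle.trivial (V := V) (X := X)).fiber (p y)))
    (P.field (p y) (mfderiv 𝓘(ℂ, V) 𝓘(ℂ, V) p y v) e)

end Higgs

/-! ### Equivariant Higgs bundles -/

/-- A group acting by holomorphic maps. -/
class HolomorphicAction (V : Type w) [NormedAddCommGroup V] [NormedSpace ℂ V] (G : Type*) [Group G]
    (Y : Type u) [TopologicalSpace Y] [ChartedSpace V Y] [MulAction G Y] : Prop where
  contMDiff_smul : ∀ g : G, ContMDiff 𝓘(ℂ, V) 𝓘(ℂ, V) ω (fun y : Y => g • y)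

section Equivariant

variable {V : Type w} [NormedAddCommGroup V] [NormedSpace ℂ V]
  {Y : Type u} [TopologicalSpace Y] [ChartedSpace V Y]

variable (V Y) in
/-- The transformation of `Y` given by a group element. -/
def smulMap {G : Type*} [Group G] [MulAction G Y] [HolomorphicAction V G Y] (g : G) :
    C^ω⟮𝓘(ℂ, V), Y; 𝓘(ℂ, V), Y⟯ :=
  ⟨fun y => g • y, HolomorphicAction.contMDiff_smul g⟩

theorem HolBundle.cast_tensor {E F : HolBundle V Y} {y y' : Y} (h : y = y') (t : E.fiber y ⊗[ℂ] F.fiber y) :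
    (HolBundle.tensor E F).cast h t =
      TensorProduct.map (E.cast h).toLinearMap (F.cast h).toLinearMap t := by
  subst h
  exact (LinearMap.congr_fun (TensorProduct.map_id) t).symm

theorem HolBundle.cast_unit {y y' : Y} (h : y = y') (c : ℂ) :
    (HolBundle.unit (V := V)).cast h c = c := by
  subst h
  rfl

variable [IsManifold 𝓘(ℂ, V) ω Y] (Γ : Subgroup Circle) [MulAction Γ Y] [HolomorphicAction V Γ Y]

variable (V Y) in
/-- For a group `Γ ⊆ U(1)` acting on `Y`, a Higgs bundle `(F, φ)` on `Y` with identifications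
`lin γ : γ^*F = F`, compatible with products in `Γ`, under which `γ^*φ = γ φ`.
Each `lin γ` is invertible by `lin_one` and `lin_mul`. -/
structure EquivariantHiggs where
  higgs : HiggsBundle V Y
  lin : ∀ γ : Γ, HolBundle.Hom (HolBundle.pullback (smulMap V Y γ) higgs.bundle) higgs.bundle
  lin_one : ∀ (y : Y) (e : higgs.bundle.fiber ((1 : Γ) • y)),
    (lin 1).toFun y e = higgs.bundle.cast (one_smul Γ y) e
  lin_mul : ∀ (γ δ : Γ) (y : Y) (e : higgs.bundle.fiber ((γ * δ) • y)),
    (lin (γ * δ)).toFun y e =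
      (lin δ).toFun y ((lin γ).toFun (δ • y) (higgs.bundle.cast (mul_smul γ δ y) e))
  lin_field : ∀ (γ : Γ) (y : Y) (v : TangentSpace 𝓘(ℂ, V) y) (e : higgs.bundle.fiber (γ • y)),
    ((lin γ).toFun y).rTensor ℂ ((HiggsBundle.pullback (smulMap V Y γ) higgs).field y v e) =
      ((γ : Circle) : ℂ) • higgs.field y v ((lin γ).toFun y e)

namespace EquivariantHiggs

variable {Γ}

/-- A morphism of equivariant Higgs bundles. -/
@[ext]
structure Hom (P Q : EquivariantHiggs V Y Γ) where
  hom : P.higgs ⟶ Q.higgs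
  comm : ∀ (γ : Γ) (y : Y) (e : P.higgs.bundle.fiber (γ • y)),
    (HolBundle.Hom.toFun (TwistedHiggs.Hom.hom hom) y) ((P.lin γ).toFun y e) =
      (Q.lin γ).toFun y (HolBundle.Hom.toFun (TwistedHiggs.Hom.hom hom) (γ • y) e)

instance : Category (EquivariantHiggs V Y Γ) where
  Hom := Hom
  id P := { hom := 𝟙 P.higgs, comm := fun _ _ _ => rfl }
  comp f g :=
    { hom := f.hom ≫ g.hom
      comm := fun γ y e => by
        simp only [TwistedHiggs.comp_hom, HolBundle.comp_toFun, LinearMap.comp_apply, f.comm,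
          g.comm] }

@[ext] theorem hom_ext {P Q : EquivariantHiggs V Y Γ} {f g : P ⟶ Q}
    (h : Hom.hom f = Hom.hom g) : f = g :=
  Hom.ext h

/-- The tensor product of equivariant Higgs bundles. -/
def tensor (P Q : EquivariantHiggs V Y Γ) : EquivariantHiggs V Y Γ where
  higgs := TwistedHiggs.tensor P.higgs Q.higgs
  lin := fun γ =>
    { toFun := fun y => TensorProduct.map ((P.lin γ).toFun y) ((Q.lin γ).toFun y)
      holo := (HolBundle.tensorHom (P.lin γ) (Q.lin γ)).holo }
  lin_one := fun y t => by
    have h : TensorProduct.map ((P.lin 1).toFun y) ((Q.lin 1).toFun y) =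
        TensorProduct.map (P.higgs.bundle.cast (one_smul Γ y)).toLinearMap
          (Q.higgs.bundle.cast (one_smul Γ y)).toLinearMap := by
      congr 1
      · exact LinearMap.ext (P.lin_one y)
      · exact LinearMap.ext (Q.lin_one y)
    exact (LinearMap.congr_fun h t).trans (HolBundle.cast_tensor _ t).symm
  lin_mul := fun γ δ y t => by
    have h : TensorProduct.map ((P.lin (γ * δ)).toFun y) ((Q.lin (γ * δ)).toFun y) =
        TensorProduct.map ((P.lin δ).toFun y) ((Q.lin δ).toFun y) ∘ₗ
        TensorProduct.map ((P.lin γ).toFun (δ • y)) ((Q.lin γ).toFun (δ • y)) ∘ₗ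
        TensorProduct.map (P.higgs.bundle.cast (mul_smul γ δ y)).toLinearMap
          (Q.higgs.bundle.cast (mul_smul γ δ y)).toLinearMap :=
      TensorProduct.ext' fun e f => by
        exact congrArg₂ (fun a b => a ⊗ₜ[ℂ] b) (P.lin_mul γ δ y e) (Q.lin_mul γ δ y f)
    refine (LinearMap.congr_fun h t).trans ?_
    exact congrArg (fun s => TensorProduct.map ((P.lin δ).toFun y) ((Q.lin δ).toFun y)
      (TensorProduct.map ((P.lin γ).toFun (δ • y)) ((Q.lin γ).toFun (δ • y)) s))
      (HolBundle.cast_tensor _ t).symm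
  lin_field := fun γ y v t => by
    have h : ∀ (P : EquivariantHiggs V Y Γ) (e : P.higgs.bundle.fiber (γ • y)),
        ((P.lin γ).toFun y).rTensor ℂ
          (P.higgs.field (γ • y) (mfderiv 𝓘(ℂ, V) 𝓘(ℂ, V) (smulMap V Y γ) y v) e) =
        (((γ : Circle) : ℂ) • P.higgs.field y v) ((P.lin γ).toFun y e) := fun P e =>
      (congrArg _ (HiggsBundle.pullback_field (smulMap V Y γ) P.higgs y v e)).symm.trans
        (P.lin_field γ y v e)
    have h₁ := HiggsAux.map_tensorEnd _ _ _ _ _ _ (h P) (h Q) t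
    have h₂ := HiggsBundle.pullback_field (smulMap V Y γ) (TwistedHiggs.tensor P.higgs Q.higgs)
      y v t
    refine (congrArg _ h₂).trans (h₁.trans ?_)
    exact LinearMap.congr_fun (HiggsAux.tensorEnd_smul _ _ _) _

/-- The unit `(𝓞, 0)`, with the canonical identifications `γ^*𝓞 = 𝓞`. -/
def unit : EquivariantHiggs V Y Γ where
  higgs := TwistedHiggs.unit
  lin := fun γ => (HolBundle.pullbackUnit (smulMap V Y γ)).hom
  lin_one := fun y c => (HolBundle.cast_unit (one_smul Γ y) c).symm
  lin_mul := fun γ δ y c => (HolBundle.cast_unit (mul_smul γ δ y) c).symm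
  lin_field := fun γ y v c => by
    refine (congrArg _ (HiggsBundle.pullback_field (smulMap V Y γ) TwistedHiggs.unit y v c)).trans
      ?_
    exact (LinearMap.map_zero _).trans (smul_zero _).symm

def tensorHom {P Q P' Q' : EquivariantHiggs V Y Γ} (f : Hom P Q) (g : Hom P' Q') :
    Hom (tensor P P') (tensor Q Q') where
  hom := TwistedHiggs.tensorHom f.hom g.hom
  comm := fun γ y t => by
    have h : TensorProduct.map (HolBundle.Hom.toFun (TwistedHiggs.Hom.hom f.hom) y)
          (HolBundle.Hom.toFun (TwistedHiggs.Hom.hom g.hom) y) ∘ₗ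
        TensorProduct.map ((P.lin γ).toFun y) ((P'.lin γ).toFun y) =
        TensorProduct.map ((Q.lin γ).toFun y) ((Q'.lin γ).toFun y) ∘ₗ
        TensorProduct.map (HolBundle.Hom.toFun (TwistedHiggs.Hom.hom f.hom) (γ • y))
          (HolBundle.Hom.toFun (TwistedHiggs.Hom.hom g.hom) (γ • y)) :=
      TensorProduct.ext' fun e e' => by
        exact congrArg₂ (fun a b => a ⊗ₜ[ℂ] b) (f.comm γ y e) (g.comm γ y e')
    exact LinearMap.congr_fun h t

/-- An isomorphism of Higgs bundles commuting with the identifications is an isomorphism of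
equivariant Higgs bundles. -/
def mkIso {P Q : EquivariantHiggs V Y Γ} (f : P.higgs ≅ Q.higgs)
    (h : ∀ (γ : Γ) (y : Y) (e : P.higgs.bundle.fiber (γ • y)),
      (HolBundle.Hom.toFun (TwistedHiggs.Hom.hom f.hom) y) ((P.lin γ).toFun y e) =
        (Q.lin γ).toFun y (HolBundle.Hom.toFun (TwistedHiggs.Hom.hom f.hom) (γ • y) e)) :
    P ≅ Q where
  hom := Hom.mk f.hom h
  inv := Hom.mk f.inv fun γ y e => by
    have h₁ : ∀ x s, HolBundle.Hom.toFun (TwistedHiggs.Hom.hom f.inv) x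
        (HolBundle.Hom.toFun (TwistedHiggs.Hom.hom f.hom) x s) = s := fun x s =>
      LinearMap.congr_fun (congrArg (fun k => HolBundle.Hom.toFun (TwistedHiggs.Hom.hom k) x)
        f.hom_inv_id) s
    have h₂ : ∀ x s, HolBundle.Hom.toFun (TwistedHiggs.Hom.hom f.hom) x
        (HolBundle.Hom.toFun (TwistedHiggs.Hom.hom f.inv) x s) = s := fun x s =>
      LinearMap.congr_fun (congrArg (fun k => HolBundle.Hom.toFun (TwistedHiggs.Hom.hom k) x)
        f.inv_hom_id) s
    have := h γ y (HolBundle.Hom.toFun (TwistedHiggs.Hom.hom f.inv) (γ • y) e)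
    rw [h₂] at this
    rw [← this, h₁]
  hom_inv_id := hom_ext f.hom_inv_id
  inv_hom_id := hom_ext f.inv_hom_id

instance : MonoidalCategoryStruct (EquivariantHiggs V Y Γ) where
  tensorObj := tensor
  tensorUnit := unit
  tensorHom f g := tensorHom f g
  whiskerLeft P _ _ f := tensorHom (𝟙 P) f
  whiskerRight f P := tensorHom f (𝟙 P)
  associator P Q R := mkIso (MonoidalCategoryStruct.associator P.higgs Q.higgs R.higgs)
    fun γ y t => LinearMap.congr_fun (f :=
      (TensorProduct.assoc ℂ _ _ _).toLinearMap ∘ₗ TensorProduct.map (TensorProduct.map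
        ((P.lin γ).toFun y) ((Q.lin γ).toFun y)) ((R.lin γ).toFun y))
      (g := TensorProduct.map ((P.lin γ).toFun y) (TensorProduct.map
        ((Q.lin γ).toFun y) ((R.lin γ).toFun y)) ∘ₗ (TensorProduct.assoc ℂ _ _ _).toLinearMap)
      (TensorProduct.ext_threefold fun _ _ _ => rfl) t
  leftUnitor P := mkIso (MonoidalCategoryStruct.leftUnitor P.higgs)
    fun γ y t => LinearMap.congr_fun (f :=
      (TensorProduct.lid ℂ _).toLinearMap ∘ₗ TensorProduct.map LinearMap.id ((P.lin γ).toFun y))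
      (g := (P.lin γ).toFun y ∘ₗ (TensorProduct.lid ℂ _).toLinearMap)
      (TensorProduct.ext' fun c e => (((P.lin γ).toFun y).map_smul c e).symm) t
  rightUnitor P := mkIso (MonoidalCategoryStruct.rightUnitor P.higgs)
    fun γ y t => LinearMap.congr_fun (f :=
      (TensorProduct.rid ℂ _).toLinearMap ∘ₗ TensorProduct.map ((P.lin γ).toFun y) LinearMap.id)
      (g := (P.lin γ).toFun y ∘ₗ (TensorProduct.rid ℂ _).toLinearMap)
      (TensorProduct.ext' fun e c => (((P.lin γ).toFun y).map_smul c e).symm) t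

instance : MonoidalCategory (EquivariantHiggs V Y Γ) where
  tensorHom_def f g := hom_ext (MonoidalCategory.tensorHom_def (Hom.hom f) (Hom.hom g))
  id_tensorHom_id P Q := hom_ext (MonoidalCategory.id_tensorHom_id P.higgs Q.higgs)
  tensorHom_comp_tensorHom f g h k := hom_ext
    (MonoidalCategory.tensorHom_comp_tensorHom (Hom.hom f) (Hom.hom g) (Hom.hom h) (Hom.hom k))
  whiskerLeft_id P Q := hom_ext (MonoidalCategory.whiskerLeft_id P.higgs Q.higgs)
  id_whiskerRight P Q := hom_ext (MonoidalCategory.id_whiskerRight P.higgs Q.higgs)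
  associator_naturality f g h := hom_ext
    (MonoidalCategory.associator_naturality (Hom.hom f) (Hom.hom g) (Hom.hom h))
  leftUnitor_naturality f := hom_ext (MonoidalCategory.leftUnitor_naturality (Hom.hom f))
  rightUnitor_naturality f := hom_ext (MonoidalCategory.rightUnitor_naturality (Hom.hom f))
  pentagon P Q R S := hom_ext (MonoidalCategory.pentagon P.higgs Q.higgs R.higgs S.higgs)
  triangle P Q := hom_ext (MonoidalCategory.triangle P.higgs Q.higgs)

instance : SymmetricCategory (EquivariantHiggs V Y Γ) where
  braiding P Q := mkIso (BraidedCategory.braiding P.higgs Q.higgs)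
    fun γ y t => LinearMap.congr_fun (f :=
      (TensorProduct.comm ℂ _ _).toLinearMap ∘ₗ
        TensorProduct.map ((P.lin γ).toFun y) ((Q.lin γ).toFun y))
      (g := TensorProduct.map ((Q.lin γ).toFun y) ((P.lin γ).toFun y) ∘ₗ
        (TensorProduct.comm ℂ _ _).toLinearMap)
      (TensorProduct.ext' fun _ _ => rfl) t
  braiding_naturality_right P _ _ f := hom_ext
    (BraidedCategory.braiding_naturality_right P.higgs (Hom.hom f))
  braiding_naturality_left f P := hom_ext
    (BraidedCategory.braiding_naturality_left (Hom.hom f) P.higgs)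
  hexagon_forward P Q R := hom_ext (BraidedCategory.hexagon_forward P.higgs Q.higgs R.higgs)
  hexagon_reverse P Q R := hom_ext (BraidedCategory.hexagon_reverse P.higgs Q.higgs R.higgs)
  symmetry P Q := hom_ext (SymmetricCategory.symmetry P.higgs Q.higgs)

end EquivariantHiggs

end Equivariant

/-! ### The cyclic cover and the pullback functor -/

section Cover

variable {V : Type w} [NormedAddCommGroup V] [NormedSpace ℂ V]
  {X : Type u} [TopologicalSpace X] [ChartedSpace V X]

/-- An isomorphism of the line bundle `L` with the flat line bundle `X̃ ×_χ ℂ` of a unitary character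
`χ` of `π₁(X, x₀)`, that is, with the quotient of `X̃ × ℂ` by `(c, z) ∼ (g c, χ(g) z)`. Here `X̃` is
the universal cover, whose points are homotopy classes of paths `c` starting at `x₀`. The
isomorphism is given by the nowhere vanishing holomorphic section `c ↦ [c, 1]` of the pullback of
`L` to `X̃`. -/
structure FlatFrame (L : HolLineBundle V X) (x₀ : X) (χ : FundamentalGroup X x₀ →* Circle) where
  toFun : ∀ {x : X}, Path.Homotopic.Quotient x₀ x → L.fiber x
  ne_zero : ∀ {x : X} (c : Path.Homotopic.Quotient x₀ x), toFun c ≠ 0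
  equivariant : ∀ (g : FundamentalGroup X x₀) {x : X} (c : Path.Homotopic.Quotient x₀ x),
    toFun (g.toPath.trans c) = ((χ g)⁻¹ : Circle).1 • toFun c
  holo : ∀ {x : X} (c : Path.Homotopic.Quotient x₀ x), ∃ U : Set X, IsOpen U ∧ x ∈ U ∧
    ∃ s : ∀ x', L.fiber x', L.toHolBundle.IsHolAt 𝓘(ℂ, V) (fun x' => x') s x ∧
      ∀ (x' : X) (d : Path x x'), Set.range d ⊆ U →
        toFun (c.trans (Path.Homotopic.Quotient.mk d)) = s x'

variable {Y : Type u} [TopologicalSpace Y] [ChartedSpace V Y]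

/-- `p : Y → X` is the covering `X̃ / Ker χ → X` attached to a unitary character `χ` of `π₁(X, x₀)`,
with its action of the Galois group `Γ = Im χ` by deck transformations: the image of `π₁(Y, y₀)` is
`Ker χ`, and `χ(g)` moves the base point `y₀` along the lift of the loop `g`. -/
structure IsCharacterCover {x₀ : X} (χ : FundamentalGroup X x₀ →* Circle) [MulAction χ.range Y]
    (p : C^ω⟮𝓘(ℂ, V), Y; 𝓘(ℂ, V), X⟯) (y₀ : Y) : Prop where
  base : p y₀ = x₀
  isCoveringMap : IsCoveringMap p
  isLocalDiffeomorph : IsLocalDiffeomorph 𝓘(ℂ, V) 𝓘(ℂ, V) ω p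
  range_eq_ker : (FundamentalGroup.mapOfEq ⟨p, p.contMDiff.continuous⟩ base).range = χ.ker
  deck : ∀ (γ : χ.range) (y : Y), p (γ • y) = p y
  monodromy : ∀ l : Path x₀ x₀, ∃ c : Path y₀
    (χ.rangeRestrict (FundamentalGroup.fromPath (Path.Homotopic.Quotient.mk l)) • y₀),
      ∀ t, p (c t) = l t

/-- An isomorphism `τ : p^*L ≅ 𝓞` through which the canonical `Γ`-action on `p^*L` becomes the
action `γ (y, z) = (γ y, γ z)` on `Y × ℂ`; equivalently, an isomorphism `L ≅ Y ×_Γ ℂ`. -/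
def IsEquivariantTrivialization (Γ : Subgroup Circle) [MulAction Γ Y]
    (p : C^ω⟮𝓘(ℂ, V), Y; 𝓘(ℂ, V), X⟯) (hp : ∀ (γ : Γ) (y : Y), p (γ • y) = p y)
    (L : HolLineBundle V X)
    (τ : HolBundle.pullback p L.toHolBundle ≅ (HolLineBundle.trivial (V := V) (X := Y)).toHolBundle) :
    Prop :=
  ∀ (γ : Γ) (y : Y) (l : L.fiber (p (γ • y))),
    (show ℂ from HolBundle.Hom.toFun τ.hom (γ • y) l) =
      ((γ : Circle) : ℂ) * (show ℂ from HolBundle.Hom.toFun τ.hom y (L.cast (hp γ y) l))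

theorem HolBundle.cast_frame (E : HolBundle V X) {x x' : X} (h : x = x') (i : E.chart) (a : E.κ) :
    E.cast h (E.frame i x a) = E.frame i x' a := by
  subst h
  rfl

theorem HolBundle.pullback_cast (p : C^ω⟮𝓘(ℂ, V), Y; 𝓘(ℂ, V), X⟯) (E : HolBundle V X) {y y' : Y}
    (h : y = y') (e : E.fiber (p y)) :
    (HolBundle.pullback p E).cast h e = E.cast (congrArg p h) e := by
  subst h
  rfl

theorem HolBundle.Hom.toFun_cast {E F : HolBundle V X} (f : HolBundle.Hom E F) {x x' : X}
    (h : x = x') (e : E.fiber x) : F.cast h (f.toFun x e) = f.toFun x' (E.cast h e) := by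
  subst h
  rfl

section

variable [IsManifold 𝓘(ℂ, V) ω X]

theorem TwistedHiggs.field_cast {L : HolLineBundle V X} (P : TwistedHiggs L)
    {v v' : TangentBundle 𝓘(ℂ, V) X} (h : v = v') (h' : v.1 = v'.1) (e : P.bundle.fiber v.1) :
    TensorProduct.map (P.bundle.cast h').toLinearMap (L.cast h').toLinearMap (P.field v.1 v.2 e) =
      P.field v'.1 v'.2 (P.bundle.cast h' e) := by
  subst h
  exact LinearMap.congr_fun TensorProduct.map_id _

end

variable {Γ : Subgroup Circle} [MulAction Γ Y] [HolomorphicAction V Γ Y]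

/-- The canonical identification `γ^*p^*E = p^*E`. -/
def HolBundle.pullbackLin (p : C^ω⟮𝓘(ℂ, V), Y; 𝓘(ℂ, V), X⟯)
    (hp : ∀ (γ : Γ) (y : Y), p (γ • y) = p y) (E : HolBundle V X) (γ : Γ) :
    HolBundle.Hom (HolBundle.pullback (smulMap V Y γ) (HolBundle.pullback p E))
      (HolBundle.pullback p E) where
  toFun := fun y => (E.cast (hp γ y)).toLinearMap
  holo := fun i a y hy => by
    have h₁ : (fun y' : Y => E.cast (hp γ y') (E.frame i (p (γ • y')) a)) =
        fun y' => E.frame i (p y') a := funext fun y' => E.cast_frame _ i a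
    have h₂ : p y ∈ E.dom i := (hp γ y) ▸ hy
    have h₃ := (HolBundle.pullback p E).isHolAt_frame' i a (x := y) h₂
    exact h₁ ▸ h₃

variable [IsManifold 𝓘(ℂ, V) ω X] [IsManifold 𝓘(ℂ, V) ω Y]

/-- The pullback functor `(E, θ) ↦ (p^*E, p^*θ)` from `L`-twisted Higgs bundles on `X` to equivariant
Higgs bundles on `Y`, where `p^*L` is identified with `𝓞` through `τ`, and `γ^*p^*E = p^*E` is the
canonical identification. -/
def pullbackFunctor (p : C^ω⟮𝓘(ℂ, V), Y; 𝓘(ℂ, V), X⟯)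
    (hp : ∀ (γ : Γ) (y : Y), p (γ • y) = p y) {L : HolLineBundle V X}
    (τ : HolBundle.pullback p L.toHolBundle ≅ (HolLineBundle.trivial (V := V) (X := Y)).toHolBundle)
    (hτ : IsEquivariantTrivialization Γ p hp L τ) :
    TwistedHiggs L ⥤ EquivariantHiggs V Y Γ where
  obj P :=
    { higgs := TwistedHiggs.pullbackObj p τ.hom P
      lin := HolBundle.pullbackLin p hp P.bundle
      lin_one := fun y e => (HolBundle.pullback_cast p P.bundle (one_smul Γ y) e).symm
      lin_mul := fun γ δ y e => by
        have h : ∀ {x₁ x₂ x₃ x₄ : X} (h₁ : x₁ = x₂) (h₂ : x₂ = x₃) (h₃ : x₃ = x₄) (h₄ : x₁ = x₄)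
            (e : P.bundle.fiber x₁),
            P.bundle.cast h₄ e = P.bundle.cast h₃ (P.bundle.cast h₂ (P.bundle.cast h₁ e)) := by
          intro _ _ _ _ h₁ h₂ h₃ h₄ e
          subst h₁ h₂ h₃
          rfl
        exact (h (congrArg p (mul_smul γ δ y)) (hp γ (δ • y)) (hp δ y) (hp (γ * δ) y) e).trans
          (congrArg (fun s => P.bundle.cast (hp δ y) (P.bundle.cast (hp γ (δ • y)) s))
            (HolBundle.pullback_cast p P.bundle (mul_smul γ δ y) e).symm)
      lin_field := fun γ y v e => by
        have h₀ : (p : Y → X) ∘ smulMap V Y γ = p := funext (hp γ)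
        have h₁ : (⟨p (γ • y), mfderiv 𝓘(ℂ, V) 𝓘(ℂ, V) p (γ • y)
            (mfderiv 𝓘(ℂ, V) 𝓘(ℂ, V) (smulMap V Y γ) y v)⟩ : TangentBundle 𝓘(ℂ, V) X) =
            ⟨p y, mfderiv 𝓘(ℂ, V) 𝓘(ℂ, V) p y v⟩ := by
          have h := tangentMap_comp_at (I := 𝓘(ℂ, V)) (I' := 𝓘(ℂ, V)) (I'' := 𝓘(ℂ, V))
            (g := p) (f := smulMap V Y γ) (⟨y, v⟩ : TangentBundle 𝓘(ℂ, V) Y)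
            (p.contMDiff.mdifferentiable (by simp) _)
            ((smulMap V Y γ).contMDiff.mdifferentiable (by simp) _)
          rw [h₀] at h
          exact h.symm
        have h₂ := TwistedHiggs.field_cast P h₁ (hp γ y) e
        have h₃ := HiggsAux.rTensor_lTensor_eq_smul (P.bundle.cast (hp γ y)).toLinearMap
          (L.cast (hp γ y)).toLinearMap (HolBundle.Hom.toFun τ.hom (γ • y))
          (HolBundle.Hom.toFun τ.hom y) ((γ : Circle) : ℂ) (hτ γ y)
          (P.field (p (γ • y)) (mfderiv 𝓘(ℂ, V) 𝓘(ℂ, V) p (γ • y)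
            (mfderiv 𝓘(ℂ, V) 𝓘(ℂ, V) (smulMap V Y γ) y v)) e)
        refine (congrArg _ (HiggsBundle.pullback_field (smulMap V Y γ)
          (TwistedHiggs.pullbackObj p τ.hom P) y v e)).trans (h₃.trans ?_)
        exact congrArg (fun s => ((γ : Circle) : ℂ) •
          (HolBundle.Hom.toFun τ.hom y).lTensor (P.bundle.fiber (p y)) s) h₂ }
  map f :=
    { hom :=
        { hom := HolBundle.pullbackHom p (TwistedHiggs.Hom.hom f)
          comm := fun y v e => by
            refine (HiggsAux.lTensor_rTensor _ _ _).trans ?_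
            exact congrArg _ (TwistedHiggs.Hom.comm f (p y) _ e) }
      comm := fun γ y e =>
        (HolBundle.Hom.toFun_cast (TwistedHiggs.Hom.hom f) (hp γ y) e).symm }
  map_id _ := rfl
  map_comp _ _ := rfl

end Cover

end

/-!
The character `χ` has kernel the image of `π₁(Y)`, so `p : Y → X` is a Galois covering with group
`Γ = Im χ` (`IsCharacterCover.isGaloisCover`), and everything is descent along `p`.

The frame `c ↦ [c, 1]` of the pullback of `L` to the universal cover is constant along loops in
`Ker χ`, so it comes from a nowhere vanishing section `t` of `p^*L` with `γ^*t = γ⁻¹ t`. Sending `t`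
to `1` gives the trivialization `τ`
(`IsCharacterCover.exists_isEquivariantTrivialization`).

For the equivalence, a morphism or a Higgs field on `Y` is regarded as a family indexed by the
points of `Y`; if it is `Γ`-invariant it descends to a family over `X` (`IsGaloisCover.exists_descent`),
which is holomorphic because `p` has local holomorphic sections. Morphisms of equivariant Higgs
bundles are invariant by definition. An equivariant bundle descends to the bundle whose fibre at `x`
is the fibre at a chosen point above `x` (`EquivariantHiggs.descend`), and a field with `γ^*φ = γ φ`
becomes invariant once its values are tensored with the section `t`, since the factors `γ` and `γ⁻¹`
cancel (`EquivariantHiggs.fieldConj_invariant`). The tensor structure is the tautological one.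

In the last part, the isomorphisms `γ^*F ≅ F` have to be made compatible. A holomorphic function on
`Y` with `Γ`-invariant absolute value is constant, by the maximum principle on the compact base
(`IsGaloisCover.eq_of_norm_invariant`). Applied to `t ^ n`, a function on `Y` as `L ^ n` is trivial,
this shows that `Γ` consists of `n`-th roots of unity (`IsGaloisCover.finite`), so `Γ` is cyclic of
some order `m`. Let `O` be the operator on sections of `F` given by an isomorphism over a generator.
Then `A = O ^ m` is an automorphism of `(F, φ)`, and its characteristic polynomial `P` is
`Γ`-invariant because `O` commutes with `A`; so `P` has constant coefficients, and `P(A) = 0` with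
`P(0) ≠ 0`. Hence some polynomial in `A` is an `m`-th root of `A⁻¹`
(`Polynomial.exists_dvd_X_mul_pow_sub_one`); its product with `O` has `m`-th power `1`
(`IsGaloisCover.IsLift.exists_pow_eq_one`) and so defines an equivariant structure
(`EquivariantHiggs.ofRep`), to which descent applies.
-/

noncomputable section

/-! ### Identifications of fibres -/

namespace HolBundle

variable {V : Type w} [NormedAddCommGroup V] [NormedSpace ℂ V]
  {X : Type u} [TopologicalSpace X] [ChartedSpace V X]
  {W : Type*} [NormedAddCommGroup W] [NormedSpace ℂ W] {H : Type*} [TopologicalSpace H]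
  {J : ModelWithCorners ℂ W H} {Z : Type*} [TopologicalSpace Z] [ChartedSpace H Z]

@[simp] theorem cast_cast (E : HolBundle V X) {x y z : X} (h : x = y) (h' : y = z)
    (e : E.fiber x) : E.cast h' (E.cast h e) = E.cast (h.trans h') e := by
  subst h h'
  rfl

theorem repr_cast (E : HolBundle V X) {x y : X} (h : x = y) (i : E.chart) (e : E.fiber x) :
    (E.frame i y).repr (E.cast h e) = (E.frame i x).repr e := by
  subst h
  rfl

/-- Holomorphy at a point is local, also in the map along which the section is taken. -/
theorem IsHolAt.congr_along {E : HolBundle V X} {g g' : Z → X} {s : ∀ z, E.fiber (g z)}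
    {s' : ∀ z, E.fiber (g' z)} {z : Z} (hs : E.IsHolAt J g s z)
    (h : ∀ᶠ z' in nhds z, ∃ hz : g z' = g' z', E.cast hz (s z') = s' z') :
    E.IsHolAt J g' s' z := by
  intro i hi a
  obtain ⟨hz, -⟩ := h.self_of_nhds
  refine (hs i (hz ▸ hi) a).congr_of_eventuallyEq (h.mono fun z' h' => ?_)
  obtain ⟨hz', h'⟩ := h'
  change (E.frame i (g' z')).repr (s' z') a = (E.frame i (g z')).repr (s z') a
  rw [← h', repr_cast]

theorem IsHolAt.congr {E : HolBundle V X} {g : Z → X} {s s' : ∀ z, E.fiber (g z)} {z : Z}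
    (hs : E.IsHolAt J g s z) (h : ∀ᶠ z' in nhds z, s z' = s' z') : E.IsHolAt J g s' z :=
  hs.congr_along (h.mono fun _ h' => ⟨rfl, h'⟩)

theorem hom_inv_toFun {E F : HolBundle V X} (f : E ≅ F) (x : X) (e : E.fiber x) :
    Hom.toFun f.inv x (Hom.toFun f.hom x e) = e :=
  LinearMap.congr_fun (congrArg (fun k => Hom.toFun k x) f.hom_inv_id) e

theorem inv_hom_toFun {E F : HolBundle V X} (f : E ≅ F) (x : X) (e : F.fiber x) :
    Hom.toFun f.hom x (Hom.toFun f.inv x e) = e :=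
  LinearMap.congr_fun (congrArg (fun k => Hom.toFun k x) f.inv_hom_id) e

/-- The fibre of an isomorphism of bundles. -/
def fiberEquiv {E F : HolBundle V X} (f : E ≅ F) (x : X) : E.fiber x ≃ₗ[ℂ] F.fiber x :=
  LinearEquiv.ofLinearMap (Hom.toFun f.hom x) (Hom.toFun f.inv x)
    (LinearMap.ext (inv_hom_toFun f x)) (LinearMap.ext (hom_inv_toFun f x))

end HolBundle

/-! ### Galois coverings -/

section Galois

variable {V : Type w} [NormedAddCommGroup V] [NormedSpace ℂ V]
  {X : Type u} [TopologicalSpace X] [ChartedSpace V X]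
  {Y : Type u} [TopologicalSpace Y] [ChartedSpace V Y]
  {Γ : Subgroup Circle} [MulAction Γ Y]

variable (Γ) in
/-- `p : Y → X` is a surjective local biholomorphism whose fibres are the free orbits of `Γ`. -/
structure IsGaloisCover (p : C^ω⟮𝓘(ℂ, V), Y; 𝓘(ℂ, V), X⟯) : Prop where
  surjective : Function.Surjective p
  isLocalDiffeomorph : IsLocalDiffeomorph 𝓘(ℂ, V) 𝓘(ℂ, V) ω p
  deck : ∀ (γ : Γ) (y : Y), p (γ • y) = p y
  exists_smul_eq : ∀ {y y' : Y}, p y = p y' → ∃ γ : Γ, γ • y' = y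
  eq_one : ∀ {γ : Γ} {y : Y}, γ • y = y → γ = 1

namespace IsGaloisCover

variable {p : C^ω⟮𝓘(ℂ, V), Y; 𝓘(ℂ, V), X⟯}

theorem smul_left_injective (hp : IsGaloisCover Γ p) {γ δ : Γ} {y : Y} (h : γ • y = δ • y) :
    γ = δ := by
  have : (δ⁻¹ * γ) • y = y := by rw [mul_smul, h, inv_smul_smul]
  exact (inv_mul_eq_one.1 (hp.eq_one this)).symm

/-- A set-theoretic section of the covering. -/
def sec (hp : IsGaloisCover Γ p) : X → Y :=
  Function.surjInv hp.surjective

@[simp] theorem apply_sec (hp : IsGaloisCover Γ p) (x : X) : p (hp.sec x) = x :=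
  Function.surjInv_eq hp.surjective x

/-- Through every point of `Y` and inside every neighbourhood of it there passes a local holomorphic
section of the covering. It is extended to all of `X` as a set-theoretic section. -/
theorem exists_localSection (hp : IsGaloisCover Γ p) (y : Y) {N : Set Y} (hN : IsOpen N)
    (hy : y ∈ N) : ∃ (U : TopologicalSpace.Opens X) (s : X → Y), p y ∈ U ∧ s (p y) = y ∧
      (∀ x, p (s x) = x) ∧ (∀ x ∈ U, ContMDiffAt 𝓘(ℂ, V) 𝓘(ℂ, V) ω s x) ∧ ∀ x ∈ U, s x ∈ N := by
  classical
  have hl := hp.isLocalDiffeomorph y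
  set q := hl.localInverse
  have hU : IsOpen (q.source ∩ q ⁻¹' N) :=
    hl.localInverse_contMDiffOn.continuousOn.isOpen_inter_preimage q.open_source hN
  have hqy : q (p y) = y := hl.localInverse_left_inv hl.localInverse_mem_target
  have hyU : p y ∈ q.source ∩ q ⁻¹' N :=
    ⟨hl.localInverse_mem_source, by simpa only [Set.mem_preimage, hqy] using hy⟩
  refine ⟨⟨_, hU⟩, fun x => if x ∈ q.source ∩ q ⁻¹' N then q x else hp.sec x, hyU, ?_, ?_, ?_, ?_⟩
  · simp only [if_pos hyU, hqy]
  · intro x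
    dsimp only
    split_ifs with h
    · exact hl.localInverse_right_inv h.1
    · exact hp.apply_sec x
  · intro x hx
    refine (hl.localInverse_contMDiffOn.contMDiffAt
      (q.open_source.mem_nhds hx.1)).congr_of_eventuallyEq ?_
    filter_upwards [hU.mem_nhds hx] with x' hx'
    exact if_pos hx'
  · intro x hx
    simp only [if_pos (show x ∈ q.source ∩ q ⁻¹' N from hx)]
    exact hx.2

/-- Holomorphy of a function on the base may be tested on the covering. -/
theorem contMDiffAt_of_comp (hp : IsGaloisCover Γ p) {f : X → ℂ} {y : Y}
    (h : ContMDiffAt 𝓘(ℂ, V) 𝓘(ℂ, ℂ) ω (fun y' => f (p y')) y) :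
    ContMDiffAt 𝓘(ℂ, V) 𝓘(ℂ, ℂ) ω f (p y) := by
  obtain ⟨U, s, hU, hs, hps, hsm, -⟩ := hp.exists_localSection y isOpen_univ trivial
  have := ContMDiffAt.comp (I' := 𝓘(ℂ, V)) (p y) (g := fun y' => f (p y')) (f := s)
    (by rw [hs]; exact h) (hsm _ hU)
  simpa only [Function.comp_def, hps] using this

theorem isHolAt_of_comp (hp : IsGaloisCover Γ p) {E : HolBundle V X} {s : ∀ x, E.fiber x} {y : Y}
    (h : E.IsHolAt 𝓘(ℂ, V) p (fun y' => s (p y')) y) :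
    E.IsHolAt 𝓘(ℂ, V) (fun x => x) s (p y) :=
  fun i hi a => hp.contMDiffAt_of_comp (h i hi a)

/-- The differential of the covering at a point. -/
def tangentEquiv (hp : IsGaloisCover Γ p) (y : Y) :
    TangentSpace 𝓘(ℂ, V) y ≃L[ℂ] TangentSpace 𝓘(ℂ, V) (p y) :=
  hp.isLocalDiffeomorph.mfderivToContinuousLinearEquiv (by simp) y

section Action

variable [HolomorphicAction V Γ Y]

/-- Two lifts of the same map differ locally by a fixed element of the Galois group. -/
theorem eventually_smul_eq (hp : IsGaloisCover Γ p) {T : Type*} [TopologicalSpace T]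
    {g g' : T → Y} {t : T}
    (hg : ContinuousAt g t) (hg' : ContinuousAt g' t) (h : ∀ t, p (g t) = p (g' t)) :
    ∃ γ : Γ, ∀ᶠ t' in nhds t, γ • g' t' = g t' := by
  obtain ⟨γ, hγ⟩ := hp.exists_smul_eq (h t)
  refine ⟨γ, ?_⟩
  obtain ⟨q, hq⟩ : ∃ q : X → Y, ∀ᶠ y in nhds (g t), q (p y) = y :=
    ⟨_, (hp.isLocalDiffeomorph (g t)).localInverse_eventuallyEq_left⟩
  have hc : ContinuousAt (fun t' => γ • g' t') t :=
    ((HolomorphicAction.contMDiff_smul (V := V) γ).continuous.continuousAt).comp hg'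
  have h₁ := hg.eventually hq
  have h₂ := hc.eventually (hγ.symm ▸ hq)
  filter_upwards [h₁, h₂] with t' h₁ h₂
  rw [← h₁, ← h₂, hp.deck, h]

/-- The chain rule for `p ∘ γ = p`. The two sides live over `p (γ y)` and `p y`, so they are
compared in the tangent bundle. -/
theorem mfderiv_smul (hp : IsGaloisCover Γ p) (γ : Γ) (y : Y) (v : TangentSpace 𝓘(ℂ, V) y) :
    (⟨p (γ • y), hp.tangentEquiv (γ • y)
      (mfderiv 𝓘(ℂ, V) 𝓘(ℂ, V) (smulMap V Y γ) y v)⟩ : TangentBundle 𝓘(ℂ, V) X) =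
      ⟨p y, hp.tangentEquiv y v⟩ := by
  have h := tangentMap_comp_at (I := 𝓘(ℂ, V)) (I' := 𝓘(ℂ, V)) (I'' := 𝓘(ℂ, V))
    (g := p) (f := smulMap V Y γ) (⟨y, v⟩ : TangentBundle 𝓘(ℂ, V) Y)
    (p.contMDiff.mdifferentiable (by simp) _)
    ((smulMap V Y γ).contMDiff.mdifferentiable (by simp) _)
  rw [show (p : Y → X) ∘ smulMap V Y γ = p from funext (hp.deck γ)] at h
  exact h.symm

/-- The lift of a vector field on the base is invariant under the Galois group. -/
theorem tangentEquiv_symm_smul (hp : IsGaloisCover Γ p) (γ : Γ) (y : Y)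
    (w : ∀ x : X, TangentSpace 𝓘(ℂ, V) x) :
    (hp.tangentEquiv (γ • y)).symm (w (p (γ • y))) =
      mfderiv 𝓘(ℂ, V) 𝓘(ℂ, V) (smulMap V Y γ) y ((hp.tangentEquiv y).symm (w (p y))) := by
  have h := hp.mfderiv_smul γ y ((hp.tangentEquiv y).symm (w (p y)))
  rw [ContinuousLinearEquiv.apply_symm_apply] at h
  have key : ∀ t : TangentBundle 𝓘(ℂ, V) X, t = ⟨p y, w (p y)⟩ → w t.1 = t.2 := by
    rintro _ rfl
    rfl
  exact (ContinuousLinearEquiv.symm_apply_eq _).2 (key _ h)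

end Action

variable [IsManifold 𝓘(ℂ, V) ω X] [IsManifold 𝓘(ℂ, V) ω Y]

/-- Holomorphy of a function on the tangent bundle of the base may be tested on the tangent bundle
of the covering. -/
theorem contMDiffAt_of_comp_tangentMap (hp : IsGaloisCover Γ p)
    {f : TangentBundle 𝓘(ℂ, V) X → ℂ} {v : TangentBundle 𝓘(ℂ, V) Y}
    (h : ContMDiffAt 𝓘(ℂ, V).tangent 𝓘(ℂ, ℂ) ω
      (fun v' => f (tangentMap 𝓘(ℂ, V) 𝓘(ℂ, V) p v')) v) :
    ContMDiffAt 𝓘(ℂ, V).tangent 𝓘(ℂ, ℂ) ω f (tangentMap 𝓘(ℂ, V) 𝓘(ℂ, V) p v) := by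
  obtain ⟨U, s, hU, hs, hps, hsm, -⟩ := hp.exists_localSection v.1 isOpen_univ trivial
  have hsU : ContMDiffOn 𝓘(ℂ, V) 𝓘(ℂ, V) ω s U := fun x hx => (hsm x hx).contMDiffWithinAt
  have hT := hsU.contMDiffOn_tangentMapWithin (m := ω) (by simp) U.isOpen.uniqueMDiffOn
  have hO : IsOpen (Bundle.TotalSpace.proj ⁻¹' (U : Set X) : Set (TangentBundle 𝓘(ℂ, V) X)) :=
    U.isOpen.preimage (FiberBundle.continuous_proj V (TangentSpace 𝓘(ℂ, V)))
  have hT' : ∀ v' : TangentBundle 𝓘(ℂ, V) X, v'.1 ∈ U →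
      tangentMapWithin 𝓘(ℂ, V) 𝓘(ℂ, V) s U v' = tangentMap 𝓘(ℂ, V) 𝓘(ℂ, V) s v' := fun v' hv' =>
    tangentMapWithin_eq_tangentMap (U.isOpen.uniqueMDiffWithinAt hv')
      ((hsm _ hv').mdifferentiableAt (by simp))
  have hsT : ∀ v' : TangentBundle 𝓘(ℂ, V) X, v'.1 ∈ U → tangentMap 𝓘(ℂ, V) 𝓘(ℂ, V) p
      (tangentMap 𝓘(ℂ, V) 𝓘(ℂ, V) s v') = v' := fun v' hv' => by
    rw [← tangentMap_comp_at _ (p.contMDiff.mdifferentiable (by simp) _)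
      ((hsm _ hv').mdifferentiableAt (by simp)),
      show (p : Y → X) ∘ s = id from funext hps, tangentMap_id, id]
  have hvT : tangentMap 𝓘(ℂ, V) 𝓘(ℂ, V) s (tangentMap 𝓘(ℂ, V) 𝓘(ℂ, V) p v) = v := by
    have h₁ := hsT (tangentMap 𝓘(ℂ, V) 𝓘(ℂ, V) p v) hU
    obtain ⟨y, v⟩ := v
    have h₂ : (tangentMap 𝓘(ℂ, V) 𝓘(ℂ, V) s (tangentMap 𝓘(ℂ, V) 𝓘(ℂ, V) p ⟨y, v⟩)).1 = y := hs
    generalize tangentMap 𝓘(ℂ, V) 𝓘(ℂ, V) s (tangentMap 𝓘(ℂ, V) 𝓘(ℂ, V) p ⟨y, v⟩) = v₂ at h₁ h₂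
    obtain ⟨y₂, v₂⟩ := v₂
    dsimp only at h₂
    subst h₂
    exact congrArg _ ((hp.tangentEquiv y₂).injective
      (eq_of_heq (Bundle.TotalSpace.mk.inj h₁).2))
  have h₁ := hT.contMDiffAt (hO.mem_nhds (x := tangentMap 𝓘(ℂ, V) 𝓘(ℂ, V) p v) hU)
  have h₂ := ContMDiffAt.comp (tangentMap 𝓘(ℂ, V) 𝓘(ℂ, V) p v)
    (g := fun v' => f (tangentMap 𝓘(ℂ, V) 𝓘(ℂ, V) p v')) (by rw [hT' _ hU, hvT]; exact h) h₁
  refine h₂.congr_of_eventuallyEq ?_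
  filter_upwards [hO.mem_nhds (x := tangentMap 𝓘(ℂ, V) 𝓘(ℂ, V) p v) hU] with v' hv'
  dsimp only [Function.comp_apply]
  rw [hT' _ hv', hsT _ hv']

end IsGaloisCover

end Galois

/-! ### The pullback functor is fully faithful -/

section Descent

variable {V : Type w} [NormedAddCommGroup V] [NormedSpace ℂ V]
  {X : Type u} [TopologicalSpace X] [ChartedSpace V X] [IsManifold 𝓘(ℂ, V) ω X]
  {Y : Type u} [TopologicalSpace Y] [ChartedSpace V Y] [IsManifold 𝓘(ℂ, V) ω Y]
  {Γ : Subgroup Circle} [MulAction Γ Y]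
  {p : C^ω⟮𝓘(ℂ, V), Y; 𝓘(ℂ, V), X⟯}

omit [IsManifold 𝓘(ℂ, V) ω X] [IsManifold 𝓘(ℂ, V) ω Y] in
/-- A `Γ`-invariant family over the covering descends to the base. Invariance is a heterogeneous
equality, since `β (p (γ y))` and `β (p y)` are equal but not definitionally so. -/
theorem IsGaloisCover.exists_descent (hp : IsGaloisCover Γ p) {β : X → Type*}
    (h : ∀ y, β (p y)) (hc : ∀ (γ : Γ) y, HEq (h (γ • y)) (h y)) :
    ∃ f : ∀ x, β x, ∀ y, f (p y) = h y := by
  have key : ∀ {x x' : X} (e : x = x') (b : β x), HEq (e ▸ b : β x') b := by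
    intro x x' e b
    subst e
    rfl
  refine ⟨fun x => hp.apply_sec x ▸ h (hp.sec x), fun y => eq_of_heq ((key _ _).trans ?_)⟩
  obtain ⟨γ, hγ⟩ := hp.exists_smul_eq (hp.apply_sec (p y))
  rw [← hγ]
  exact hc γ y

variable [HolomorphicAction V Γ Y] {L : HolLineBundle V X}
  {τ : HolBundle.pullback p L.toHolBundle ≅ (HolLineBundle.trivial (V := V) (X := Y)).toHolBundle}

theorem pullbackFunctor_faithful (hp : IsGaloisCover Γ p)
    (hτ : IsEquivariantTrivialization Γ p hp.deck L τ) :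
    (pullbackFunctor p hp.deck τ hτ).Faithful where
  map_injective {P Q f g} h := by
    refine TwistedHiggs.hom_ext (HolBundle.hom_ext fun x => ?_)
    obtain ⟨y, rfl⟩ := hp.surjective x
    exact congrArg (fun k => HolBundle.Hom.toFun (TwistedHiggs.Hom.hom
      (EquivariantHiggs.Hom.hom k)) y) h

/-- A morphism on the covering that commutes with the action of `Γ` is an invariant family of linear
maps, so it descends. It commutes with the Higgs fields on the base because `τ` is injective on
fibres. -/
theorem pullbackFunctor_full (hp : IsGaloisCover Γ p)
    (hτ : IsEquivariantTrivialization Γ p hp.deck L τ) :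
    (pullbackFunctor p hp.deck τ hτ).Full where
  map_surjective {P Q} k := by
    set K : HolBundle.Hom (HolBundle.pullback p P.bundle) (HolBundle.pullback p Q.bundle) :=
      TwistedHiggs.Hom.hom (EquivariantHiggs.Hom.hom k)
    have hinv : ∀ (γ : Γ) (y : Y), HEq (K.toFun (γ • y)) (K.toFun y) := by
      intro γ y
      have h : ∀ {x x' : X} (e : x = x') (A : P.bundle.fiber x →ₗ[ℂ] Q.bundle.fiber x)
          (B : P.bundle.fiber x' →ₗ[ℂ] Q.bundle.fiber x'),
          (∀ v, B (P.bundle.cast e v) = Q.bundle.cast e (A v)) → HEq A B := by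
        intro x x' e A B h
        subst e
        exact heq_of_eq (LinearMap.ext fun v => (h v).symm)
      exact h (hp.deck γ y) _ _ (EquivariantHiggs.Hom.comm k γ y)
    obtain ⟨f, hf⟩ := hp.exists_descent
      (β := fun x => P.bundle.fiber x →ₗ[ℂ] Q.bundle.fiber x) K.toFun hinv
    let f' : HolBundle.Hom P.bundle Q.bundle :=
      { toFun := f
        holo := fun i a x hx => by
          obtain ⟨y, rfl⟩ := hp.surjective x
          refine hp.isHolAt_of_comp (E := Q.bundle)
            (s := fun x' => f x' (P.bundle.frame i x' a)) ?_
          simp only [hf]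
          exact K.holo i a y hx }
    refine ⟨TwistedHiggs.Hom.mk f' fun x v e => ?_, ?_⟩
    · obtain ⟨y, rfl⟩ := hp.surjective x
      obtain ⟨v, rfl⟩ := (hp.tangentEquiv y).surjective v
      have h₁ := TwistedHiggs.Hom.comm (EquivariantHiggs.Hom.hom k) y v e
      have hinj : Function.Injective ((HolBundle.fiberEquiv τ y).toLinearMap.lTensor
          (Q.bundle.fiber (p y))) :=
        (LinearEquiv.lTensor (Q.bundle.fiber (p y)) (HolBundle.fiberEquiv τ y)).injective
      refine hinj ?_
      refine (HiggsAux.lTensor_rTensor (HolBundle.fiberEquiv τ y).toLinearMap _ _).symm.trans ?_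
      change (f (p y)).rTensor _ _ = _
      rw [hf]
      refine h₁.trans ?_
      change _ = (HolBundle.fiberEquiv τ y).toLinearMap.lTensor _ (Q.field (p y) _ (f (p y) e))
      rw [hf]
      rfl
    · exact EquivariantHiggs.hom_ext (TwistedHiggs.hom_ext (HolBundle.hom_ext fun y => hf y))

/-! ### The tensor structure on the pullback functor -/

namespace HiggsAux

theorem tensorEnd_lTensor {E F L M : Type*} [AddCommGroup E] [Module ℂ E] [AddCommGroup F]
    [Module ℂ F] [AddCommGroup L] [Module ℂ L] [AddCommGroup M] [Module ℂ M] (τ : L →ₗ[ℂ] M)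
    (a : E →ₗ[ℂ] E ⊗[ℂ] L) (b : F →ₗ[ℂ] F ⊗[ℂ] L) (t : E ⊗[ℂ] F) :
    tensorEnd (τ.lTensor E ∘ₗ a) (τ.lTensor F ∘ₗ b) t =
      τ.lTensor (E ⊗[ℂ] F) (tensorEnd a b t) := by
  induction t using TensorProduct.induction_on with
  | zero => simp
  | tmul e f =>
    simp only [tensorEnd_tmul, map_add, LinearMap.comp_apply]
    congr 1
    · generalize a e = t
      induction t using TensorProduct.induction_on with
      | zero => simp
      | tmul _ _ => simp
      | add t t' h h' => simp only [TensorProduct.add_tmul, map_add, h, h']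
    · generalize b f = t
      induction t using TensorProduct.induction_on with
      | zero => simp
      | tmul _ _ => simp
      | add t t' h h' => simp only [TensorProduct.tmul_add, map_add, h, h']
  | add t t' h h' => simp only [map_add, h, h']

end HiggsAux

omit [IsManifold 𝓘(ℂ, V) ω X] [IsManifold 𝓘(ℂ, V) ω Y] in
/-- The identification `p^*E ⊗ p^*F = p^*(E ⊗ F)`. -/
def HolBundle.pullbackTensor (p : C^ω⟮𝓘(ℂ, V), Y; 𝓘(ℂ, V), X⟯) (E F : HolBundle V X) :
    HolBundle.tensor (HolBundle.pullback p E) (HolBundle.pullback p F) ≅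
      HolBundle.pullback p (HolBundle.tensor E F) :=
  HolBundle.mkIso (fun y => LinearEquiv.refl ℂ (E.fiber (p y) ⊗[ℂ] F.fiber (p y)))
    (fun i a _ hy => (HolBundle.pullback p (HolBundle.tensor E F)).isHolAt_frame' i a hy)
    (fun i a _ hy => (HolBundle.tensor (HolBundle.pullback p E)
      (HolBundle.pullback p F)).isHolAt_frame' i a hy)

/-- The identification `(𝓞, 0) = p^*(𝓞, 0)` of equivariant Higgs bundles. -/
def pullbackFunctorUnitIso (hp : ∀ (γ : Γ) (y : Y), p (γ • y) = p y)
    (hτ : IsEquivariantTrivialization Γ p hp L τ) :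
    EquivariantHiggs.unit ≅ (pullbackFunctor p hp τ hτ).obj TwistedHiggs.unit :=
  EquivariantHiggs.mkIso (TwistedHiggs.mkIso (HolBundle.pullbackUnit p).symm
    fun y v t => by
      refine (map_zero _).trans ?_
      exact (map_zero ((HolBundle.Hom.toFun τ.hom y).lTensor ℂ)).symm) fun γ y e =>
    (HolBundle.cast_unit (V := V) (hp γ y) e).symm

/-- The identification `p^*E ⊗ p^*F = p^*(E ⊗ F)` of equivariant Higgs bundles. -/
def pullbackFunctorTensorIso (hp : ∀ (γ : Γ) (y : Y), p (γ • y) = p y)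
    (hτ : IsEquivariantTrivialization Γ p hp L τ) (P Q : TwistedHiggs L) :
    EquivariantHiggs.tensor ((pullbackFunctor p hp τ hτ).obj P)
      ((pullbackFunctor p hp τ hτ).obj Q) ≅
      (pullbackFunctor p hp τ hτ).obj (TwistedHiggs.tensor P Q) :=
  EquivariantHiggs.mkIso
    (TwistedHiggs.mkIso (HolBundle.pullbackTensor p P.bundle Q.bundle) fun y v t =>
      (LinearMap.congr_fun (LinearMap.rTensor_id _ _) _).trans
        (HiggsAux.tensorEnd_lTensor (HolBundle.Hom.toFun τ.hom y)
          (P.field (p y) (mfderiv 𝓘(ℂ, V) 𝓘(ℂ, V) p y v))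
          (Q.field (p y) (mfderiv 𝓘(ℂ, V) 𝓘(ℂ, V) p y v)) t)) fun γ y e =>
    (HolBundle.cast_tensor (hp γ y) e).symm

/-- The coherence conditions hold on pure tensors by definition, because the fibre of a pullback at
`y` is the fibre at `p y`. -/
theorem pullbackFunctor_braided (hp : ∀ (γ : Γ) (y : Y), p (γ • y) = p y)
    (hτ : IsEquivariantTrivialization Γ p hp L τ) :
    Nonempty (pullbackFunctor p hp τ hτ).Braided := by
  let core : (pullbackFunctor p hp τ hτ).CoreMonoidal :=
    { εIso := pullbackFunctorUnitIso hp hτ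
      μIso := pullbackFunctorTensorIso hp hτ
      μIso_hom_natural_left := fun f Q => EquivariantHiggs.hom_ext (TwistedHiggs.hom_ext
        (HolBundle.hom_ext fun y => TensorProduct.ext' fun _ _ => rfl))
      μIso_hom_natural_right := fun P f => EquivariantHiggs.hom_ext (TwistedHiggs.hom_ext
        (HolBundle.hom_ext fun y => TensorProduct.ext' fun _ _ => rfl))
      associativity := fun P Q R => EquivariantHiggs.hom_ext (TwistedHiggs.hom_ext
        (HolBundle.hom_ext fun y => TensorProduct.ext_threefold fun _ _ _ => rfl))
      left_unitality := fun P => EquivariantHiggs.hom_ext (TwistedHiggs.hom_ext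
        (HolBundle.hom_ext fun y => TensorProduct.ext (LinearMap.ext fun c => LinearMap.ext fun e =>
          Eq.refl ((show ℂ from c) • (show P.bundle.fiber (p y) from e)))))
      right_unitality := fun P => EquivariantHiggs.hom_ext (TwistedHiggs.hom_ext
        (HolBundle.hom_ext fun y => TensorProduct.ext (LinearMap.ext fun e => LinearMap.ext fun c =>
          Eq.refl ((show ℂ from c) • (show P.bundle.fiber (p y) from e))))) }
  let _ := core.toMonoidal
  refine ⟨{ braided := fun P Q => ?_ }⟩
  change (pullbackFunctorTensorIso hp hτ P Q).hom ≫ _ =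
    _ ≫ (pullbackFunctorTensorIso hp hτ Q P).hom
  exact EquivariantHiggs.hom_ext (TwistedHiggs.hom_ext
    (HolBundle.hom_ext fun y => TensorProduct.ext (LinearMap.ext fun e => LinearMap.ext fun f =>
      Eq.refl ((show Q.bundle.fiber (p y) from f) ⊗ₜ[ℂ] (show P.bundle.fiber (p y) from e)))))

end Descent

/-! ### Descent of equivariant Higgs bundles -/

namespace HiggsAux

/-- The algebra behind the integrability of the descended Higgs field. -/
theorem rTensor_map_conj {E F L M : Type*} [AddCommGroup E] [Module ℂ E] [AddCommGroup F]
    [Module ℂ F] [AddCommGroup L] [Module ℂ L] [AddCommGroup M] [Module ℂ M]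
    (ψ : E →ₗ[ℂ] F) (ψ' : F →ₗ[ℂ] E) (h : ∀ f, ψ (ψ' f) = f) (σ : M →ₗ[ℂ] L)
    (a : F →ₗ[ℂ] F ⊗[ℂ] M) (t : F ⊗[ℂ] M) :
    (TensorProduct.map ψ' σ ∘ₗ a ∘ₗ ψ).rTensor L (TensorProduct.map ψ' σ t) =
      TensorProduct.map (TensorProduct.map ψ' σ) σ (a.rTensor M t) := by
  induction t using TensorProduct.induction_on with
  | zero => simp
  | tmul _ _ => simp [h]
  | add t t' h h' => simp only [map_add, h, h']

end HiggsAux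

section Descent

variable {V : Type w} [NormedAddCommGroup V] [NormedSpace ℂ V]
  {X : Type u} [TopologicalSpace X] [ChartedSpace V X]
  {Y : Type u} [TopologicalSpace Y] [ChartedSpace V Y] [IsManifold 𝓘(ℂ, V) ω Y]
  {Γ : Subgroup Circle} [MulAction Γ Y] [HolomorphicAction V Γ Y]
  {p : C^ω⟮𝓘(ℂ, V), Y; 𝓘(ℂ, V), X⟯}
  {W : Type*} [NormedAddCommGroup W] [NormedSpace ℂ W] {H : Type*} [TopologicalSpace H]
  {J : ModelWithCorners ℂ W H} {Z : Type*} [TopologicalSpace Z] [ChartedSpace H Z]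

omit [IsManifold 𝓘(ℂ, V) ω Y] in
/-- A family of linear maps which is holomorphic on local frames is holomorphic on holomorphic
sections. -/
theorem HolBundle.IsHolAt.map {E : HolBundle V Y} {G : HolBundle V X} {g : Z → Y} {g' : Z → X}
    {s : ∀ z, E.fiber (g z)} {z : Z} (hs : E.IsHolAt J g s z)
    (A : ∀ z, E.fiber (g z) →ₗ[ℂ] G.fiber (g' z))
    (hA : ∀ i a, g z ∈ E.dom i → G.IsHolAt J g' (fun z' => A z' (E.frame i (g z') a)) z) :
    G.IsHolAt J g' (fun z' => A z' (s z')) z := by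
  obtain ⟨i, hi⟩ := E.exists_mem_dom (g z)
  intro j hj b
  have key : (fun z' => (G.frame j (g' z')).repr (A z' (s z')) b) = fun z' => ∑ a,
      (E.frame i (g z')).repr (s z') a *
        (G.frame j (g' z')).repr (A z' (E.frame i (g z') a)) b := by
    funext z'
    conv_lhs => rw [← (E.frame i (g z')).sum_repr (s z')]
    simp only [map_sum, map_smul, Finsupp.finsetSum_apply, Finsupp.smul_apply, smul_eq_mul]
  rw [key]
  exact contMDiffAt_finsetSum fun a _ => (hs i hi a).mul (hA i a hi j hj b)

/-- The Higgs field takes holomorphic sections to holomorphic sections. -/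
theorem TwistedHiggs.isHolAt_field {L : HolLineBundle V Y} (P : TwistedHiggs L)
    {s : ∀ v : TangentBundle 𝓘(ℂ, V) Y, P.bundle.fiber v.1} {v : TangentBundle 𝓘(ℂ, V) Y}
    (hs : P.bundle.IsHolAt 𝓘(ℂ, V).tangent (fun v' => v'.1) s v) :
    (HolBundle.tensor P.bundle L.toHolBundle).IsHolAt 𝓘(ℂ, V).tangent
      (fun v' : TangentBundle 𝓘(ℂ, V) Y => v'.1) (fun v' => P.field v'.1 v'.2 (s v')) v :=
  hs.map (G := HolBundle.tensor P.bundle L.toHolBundle) (g' := fun v' => v'.1)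
    (fun v' => P.field v'.1 v'.2) fun i a hi => P.holo i a v hi

namespace EquivariantHiggs

variable (P : EquivariantHiggs V Y Γ)

/-- The map `F_y → F_{y'}` between the fibres over two points with the same image in `X` that is
given by the `Γ`-equivariant structure. -/
def transportHom (hp : IsGaloisCover Γ p) {y y' : Y} (h : p y = p y') :
    P.higgs.bundle.fiber y →ₗ[ℂ] P.higgs.bundle.fiber y' :=
  (P.lin (hp.exists_smul_eq h).choose).toFun y' ∘ₗ
    (P.higgs.bundle.cast (hp.exists_smul_eq h).choose_spec.symm).toLinearMap

theorem transportHom_eq (hp : IsGaloisCover Γ p) {y y' : Y} (h : p y = p y') {γ : Γ}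
    (hγ : γ • y' = y) (e : P.higgs.bundle.fiber y) :
    P.transportHom hp h e = (P.lin γ).toFun y' (P.higgs.bundle.cast hγ.symm e) := by
  obtain rfl : γ = (hp.exists_smul_eq h).choose :=
    hp.smul_left_injective (hγ.trans (hp.exists_smul_eq h).choose_spec.symm)
  rfl

@[simp] theorem transportHom_self (hp : IsGaloisCover Γ p) {y : Y} (h : p y = p y)
    (e : P.higgs.bundle.fiber y) : P.transportHom hp h e = e := by
  rw [P.transportHom_eq hp h (one_smul Γ y), P.lin_one, HolBundle.cast_cast, HolBundle.cast_rfl]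

@[simp] theorem transportHom_trans (hp : IsGaloisCover Γ p) {y y' y'' : Y} (h : p y = p y')
    (h' : p y' = p y'') (e : P.higgs.bundle.fiber y) :
    P.transportHom hp h' (P.transportHom hp h e) = P.transportHom hp (h.trans h') e := by
  obtain ⟨γ, rfl⟩ := hp.exists_smul_eq h
  obtain ⟨δ, rfl⟩ := hp.exists_smul_eq h'
  rw [P.transportHom_eq hp h rfl, P.transportHom_eq hp h' rfl,
    P.transportHom_eq hp (h.trans h') (mul_smul γ δ y''), P.lin_mul, HolBundle.cast_cast]
  rfl

/-- `transportHom` as an isomorphism of fibres. -/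
def transport (hp : IsGaloisCover Γ p) {y y' : Y} (h : p y = p y') :
    P.higgs.bundle.fiber y ≃ₗ[ℂ] P.higgs.bundle.fiber y' :=
  LinearEquiv.ofLinearMap (P.transportHom hp h) (P.transportHom hp h.symm)
    (LinearMap.ext fun e => by simp) (LinearMap.ext fun e => by simp)

theorem transport_apply (hp : IsGaloisCover Γ p) {y y' : Y} (h : p y = p y')
    (e : P.higgs.bundle.fiber y) : P.transport hp h e = P.transportHom hp h e := rfl

/-- Transport between two lifts `g`, `g'` of the same map preserves holomorphy: locally `g` and `g'`
differ by a fixed element of `Γ`. -/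
theorem isHolAt_transportHom (hp : IsGaloisCover Γ p) {g g' : Z → Y} {z : Z}
    (hg : ContinuousAt g z) (hg' : ContMDiffAt J 𝓘(ℂ, V) ω g' z)
    (h : ∀ z', p (g z') = p (g' z')) {s : ∀ z', P.higgs.bundle.fiber (g z')}
    (hs : P.higgs.bundle.IsHolAt J g s z) :
    P.higgs.bundle.IsHolAt J g' (fun z' => P.transportHom hp (h z') (s z')) z := by
  classical
  obtain ⟨γ, hγ⟩ := hp.eventually_smul_eq hg hg'.continuousAt h
  let s' : ∀ z', P.higgs.bundle.fiber (γ • g' z') := fun z' =>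
    if hz : g z' = γ • g' z' then P.higgs.bundle.cast hz (s z') else 0
  have hs' : P.higgs.bundle.IsHolAt J (fun z' => γ • g' z') s' z :=
    hs.congr_along (hγ.mono fun z' hz => ⟨hz.symm, by simp only [s', dif_pos hz.symm]⟩)
  have := (P.lin γ).isHolAt hg' (s := s') hs'
  refine this.congr (hγ.mono fun z' hz => ?_)
  rw [P.transportHom_eq hp (h z') hz]
  simp only [s', dif_pos hz.symm]

/-- A local frame of the descended bundle: a local section of the covering, extended to a
set-theoretic section on all of `X`, and a local frame upstairs. -/
structure DescentChart (hp : IsGaloisCover Γ p) (F : HolBundle V Y) where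
  dom : TopologicalSpace.Opens X
  sec : X → Y
  chart : F.chart
  apply_sec : ∀ x, p (sec x) = x
  holo : ∀ x ∈ dom, ContMDiffAt 𝓘(ℂ, V) 𝓘(ℂ, V) ω sec x
  mem_dom : ∀ x ∈ dom, sec x ∈ F.dom chart

/-- The bundle on `X` obtained by descent. Its fibre at `x` is the fibre of `F` at a chosen point
above `x`. -/
def descend (hp : IsGaloisCover Γ p) : HolBundle V X where
  fiber := fun x => P.higgs.bundle.fiber (hp.sec x)
  κ := P.higgs.bundle.κ
  chart := DescentChart hp P.higgs.bundle
  dom := fun c => c.dom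
  exists_mem_dom := fun x => by
    obtain ⟨i, hi⟩ := P.higgs.bundle.exists_mem_dom (hp.sec x)
    obtain ⟨U, s, hU, -, hps, hs, hsi⟩ :=
      hp.exists_localSection (hp.sec x) (P.higgs.bundle.dom i).isOpen hi
    exact ⟨⟨U, s, i, hps, hs, hsi⟩, by simpa only [hp.apply_sec] using hU⟩
  frame := fun c x => (P.higgs.bundle.frame c.chart (c.sec x)).map
    (P.transport hp ((c.apply_sec x).trans (hp.apply_sec x).symm))
  holo_transition := fun c d x hc hd a b => by
    have h₁ := P.higgs.bundle.isHolAt_frame (c.holo x hc) c.chart (c.mem_dom x hc) a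
    have h₂ := P.isHolAt_transportHom hp (c.holo x hc).continuousAt (d.holo x hd)
      (fun x' => (c.apply_sec x').trans (d.apply_sec x').symm) h₁ d.chart (d.mem_dom x hd) b
    refine h₂.congr_of_eventuallyEq (Filter.Eventually.of_forall fun x' => ?_)
    have h₃ : ∀ e, (P.transport hp ((d.apply_sec x').trans (hp.apply_sec x').symm)).symm e =
      P.transportHom hp ((hp.apply_sec x').trans (d.apply_sec x').symm) e := fun _ => rfl
    simp only [Module.Basis.map_apply, Module.Basis.map_repr, LinearEquiv.trans_apply,
      transport_apply, h₃, transportHom_trans]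

/-- The isomorphism of the pullback of the descended bundle with the original one. -/
def descendIso (hp : IsGaloisCover Γ p) :
    HolBundle.pullback p (P.descend hp) ≅ P.higgs.bundle :=
  HolBundle.mkIso (fun y => P.transport hp (hp.apply_sec (p y)))
    (fun c a y hy => by
      have hc : ContMDiffAt 𝓘(ℂ, V) 𝓘(ℂ, V) ω (fun y' => c.sec (p y')) y :=
        ContMDiffAt.comp y (c.holo (p y) hy) p.contMDiff.contMDiffAt
      have h₁ := P.higgs.bundle.isHolAt_frame hc c.chart (c.mem_dom (p y) hy) a
      have h₂ := P.isHolAt_transportHom hp hc.continuousAt contMDiffAt_id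
        (fun y' => c.apply_sec (p y')) h₁
      refine h₂.congr (Filter.Eventually.of_forall fun y' => ?_)
      exact (P.transportHom_trans hp ((c.apply_sec (p y')).trans (hp.apply_sec (p y')).symm)
        (hp.apply_sec (p y')) _).symm.trans (congrArg (P.transportHom hp (hp.apply_sec (p y')))
          ((P.higgs.bundle.frame c.chart (c.sec (p y'))).map_apply (P.transport hp
            ((c.apply_sec (p y')).trans (hp.apply_sec (p y')).symm)) a).symm))
    (fun i a y hy => by
      obtain ⟨c, hc⟩ := (P.descend hp).exists_mem_dom (p y)
      refine HolBundle.isHolAt_of_frame _ contMDiffAt_id c hc fun b => ?_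
      have hs : ContMDiffAt 𝓘(ℂ, V) 𝓘(ℂ, V) ω (fun y' => c.sec (p y')) y :=
        ContMDiffAt.comp y (c.holo (p y) hc) p.contMDiff.contMDiffAt
      have h₁ := P.isHolAt_transportHom hp continuousAt_id hs
        (fun y' => (c.apply_sec (p y')).symm) (P.higgs.bundle.isHolAt_frame' i a hy)
      refine (h₁ c.chart (c.mem_dom _ hc) b).congr_of_eventuallyEq
        (Filter.Eventually.of_forall fun y' => ?_)
      exact congrArg (fun e => (P.higgs.bundle.frame c.chart (c.sec (p y'))).repr e b)
        (P.transportHom_trans hp (hp.apply_sec (p y')).symm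
          ((hp.apply_sec (p y')).trans (c.apply_sec (p y')).symm) _))

theorem descendIso_toFun (hp : IsGaloisCover Γ p) (y : Y) (e : (P.descend hp).fiber (p y)) :
    HolBundle.Hom.toFun (P.descendIso hp).hom y e =
      P.transportHom hp (hp.apply_sec (p y)) e := rfl

/-- Under `descendIso` the canonical identification `γ^*p^*E = p^*E` becomes the given structure. -/
theorem descendIso_equivariant (hp : IsGaloisCover Γ p) (γ : Γ) (y : Y)
    (e : (P.descend hp).fiber (p (γ • y))) :
    HolBundle.Hom.toFun (P.descendIso hp).hom y ((P.descend hp).cast (hp.deck γ y) e) =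
      (P.lin γ).toFun y (HolBundle.Hom.toFun (P.descendIso hp).hom (γ • y) e) := by
  have h₁ : ∀ {x : X} (h : p (γ • y) = x) (h' : p (hp.sec (p (γ • y))) = p y)
      (h'' : p (hp.sec x) = p y),
      P.transportHom hp h'' ((P.descend hp).cast h e) = P.transportHom hp h' e := by
    intro x h h' h''
    subst h
    rfl
  have h₂ := P.transportHom_eq hp (hp.deck γ y) rfl
    (P.transportHom hp (hp.apply_sec (p (γ • y))) e)
  rw [descendIso_toFun, h₁ (hp.deck γ y) ((hp.apply_sec _).trans (hp.deck γ y)), descendIso_toFun]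
  exact (P.transportHom_trans hp _ _ _).symm.trans h₂

end EquivariantHiggs

end Descent

namespace HiggsAux

/-- The field `v ↦ (ψ' ⊗ σ) ∘ φ (d v) ∘ ψ`. -/
def conjField {E F L M T T' : Type*} [AddCommGroup E] [Module ℂ E] [AddCommGroup F] [Module ℂ F]
    [AddCommGroup L] [Module ℂ L] [AddCommGroup M] [Module ℂ M] [AddCommGroup T] [Module ℂ T]
    [AddCommGroup T'] [Module ℂ T'] (ψ : E →ₗ[ℂ] F) (ψ' : F →ₗ[ℂ] E) (σ : M →ₗ[ℂ] L)
    (φ : T →ₗ[ℂ] F →ₗ[ℂ] F ⊗[ℂ] M) (d : T' →ₗ[ℂ] T) : T' →ₗ[ℂ] E →ₗ[ℂ] E ⊗[ℂ] L where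
  toFun := fun v => TensorProduct.map ψ' σ ∘ₗ φ (d v) ∘ₗ ψ
  map_add' := fun v v' => by
    rw [map_add, map_add, LinearMap.add_comp, LinearMap.comp_add]
  map_smul' := fun c v => by
    rw [map_smul, map_smul, LinearMap.smul_comp, LinearMap.comp_smul]
    rfl

/-- The algebra behind the invariance of the descended Higgs field: the factor by which the Higgs
field changes under `l : F₁ → F₂` cancels the one in the action on the trivialized line. -/
theorem map_conj_eq {E₁ E₂ F₁ F₂ L₁ L₂ M : Type*} [AddCommGroup E₁] [Module ℂ E₁]
    [AddCommGroup E₂] [Module ℂ E₂] [AddCommGroup F₁] [Module ℂ F₁] [AddCommGroup F₂] [Module ℂ F₂]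
    [AddCommGroup L₁] [Module ℂ L₁] [AddCommGroup L₂] [Module ℂ L₂] [AddCommGroup M] [Module ℂ M]
    {ψ₁ : E₁ →ₗ[ℂ] F₁} {ψ₁' : F₁ →ₗ[ℂ] E₁} {ψ₂ : E₂ →ₗ[ℂ] F₂} {ψ₂' : F₂ →ₗ[ℂ] E₂}
    (h₁ : ∀ f, ψ₁ (ψ₁' f) = f) (h₂ : ∀ e, ψ₂' (ψ₂ e) = e)
    {σ₁ : M →ₗ[ℂ] L₁} {σ₂ : M →ₗ[ℂ] L₂} {cE : E₁ →ₗ[ℂ] E₂} {cL : L₁ →ₗ[ℂ] L₂} {l : F₁ →ₗ[ℂ] F₂}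
    {φ₁ : F₁ →ₗ[ℂ] F₁ ⊗[ℂ] M} {φ₂ : F₂ →ₗ[ℂ] F₂ ⊗[ℂ] M} {a : ℂ}
    (hψ : ∀ e, ψ₂ (cE e) = l (ψ₁ e)) (hσ : ∀ c, a • cL (σ₁ c) = σ₂ c)
    (hφ : ∀ f, l.rTensor M (φ₁ f) = a • φ₂ (l f)) (e : E₁) :
    TensorProduct.map cE cL (TensorProduct.map ψ₁' σ₁ (φ₁ (ψ₁ e))) =
      TensorProduct.map ψ₂' σ₂ (φ₂ (ψ₂ (cE e))) := by
  have hψ' : ∀ f, cE (ψ₁' f) = ψ₂' (l f) := fun f => by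
    rw [← h₂ (cE (ψ₁' f)), hψ, h₁]
  have key : TensorProduct.map cE cL ∘ₗ TensorProduct.map ψ₁' σ₁ =
      TensorProduct.map ψ₂' (cL ∘ₗ σ₁) ∘ₗ l.rTensor M :=
    TensorProduct.ext' fun f c => by simp [hψ']
  have hσ' : σ₂ = a • (cL ∘ₗ σ₁) := LinearMap.ext fun c => (hσ c).symm
  have := LinearMap.congr_fun key (φ₁ (ψ₁ e))
  simp only [LinearMap.comp_apply] at this
  rw [this, hφ, map_smul, hψ, hσ', TensorProduct.map_smul_right, LinearMap.smul_apply]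

end HiggsAux

section Descent

variable {V : Type w} [NormedAddCommGroup V] [NormedSpace ℂ V]
  {X : Type u} [TopologicalSpace X] [ChartedSpace V X] [IsManifold 𝓘(ℂ, V) ω X]
  {Y : Type u} [TopologicalSpace Y] [ChartedSpace V Y] [IsManifold 𝓘(ℂ, V) ω Y]
  {Γ : Subgroup Circle} [MulAction Γ Y] [HolomorphicAction V Γ Y]
  {p : C^ω⟮𝓘(ℂ, V), Y; 𝓘(ℂ, V), X⟯} {L : HolLineBundle V X}

omit [IsManifold 𝓘(ℂ, V) ω X] [IsManifold 𝓘(ℂ, V) ω Y] in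
/-- The value of a morphism `F → p^*E` at a point, as a map to the fibre of `E`. -/
def HolBundle.Hom.toPullback {E : HolBundle V X} {F : HolBundle V Y}
    (f : HolBundle.Hom F (HolBundle.pullback p E)) (y : Y) : F.fiber y →ₗ[ℂ] E.fiber (p y) :=
  f.toFun y

/-- The `p^*L`-valued Higgs field at a point of `Y` that corresponds, under isomorphisms
`Ψ : p^*E ≅ F` and `τ : p^*L ≅ 𝓞`, to a Higgs field on `F`, as a function of tangent vectors
of `X`. -/
def IsGaloisCover.fieldConj (hp : IsGaloisCover Γ p) {E : HolBundle V X} (F : HiggsBundle V Y)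
    (Ψ : HolBundle.pullback p E ≅ F.bundle)
    (τ : HolBundle.pullback p L.toHolBundle ≅ (HolLineBundle.trivial (V := V) (X := Y)).toHolBundle)
    (y : Y) :
    TangentSpace 𝓘(ℂ, V) (p y) →ₗ[ℂ] (E.fiber (p y) →ₗ[ℂ] E.fiber (p y) ⊗[ℂ] L.fiber (p y)) :=
  HiggsAux.conjField (HolBundle.Hom.toFun Ψ.hom y) (HolBundle.Hom.toPullback Ψ.inv y)
    (HolBundle.Hom.toPullback τ.inv y) (F.field y) (hp.tangentEquiv y).symm.toLinearMap

omit [IsManifold 𝓘(ℂ, V) ω X] [HolomorphicAction V Γ Y] in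
theorem IsGaloisCover.fieldConj_tangentEquiv (hp : IsGaloisCover Γ p) {E : HolBundle V X}
    (F : HiggsBundle V Y) (Ψ : HolBundle.pullback p E ≅ F.bundle)
    (τ : HolBundle.pullback p L.toHolBundle ≅ (HolLineBundle.trivial (V := V) (X := Y)).toHolBundle)
    (y : Y) (v : TangentSpace 𝓘(ℂ, V) y) (e : E.fiber (p y)) :
    hp.fieldConj F Ψ τ y (hp.tangentEquiv y v) e =
      TensorProduct.map (HolBundle.Hom.toPullback Ψ.inv y) (HolBundle.Hom.toPullback τ.inv y)
        (F.field y v (HolBundle.Hom.toFun Ψ.hom y e)) :=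
  congrArg (fun w => TensorProduct.map (HolBundle.Hom.toPullback Ψ.inv y)
    (HolBundle.Hom.toPullback τ.inv y) (F.field y w (HolBundle.Hom.toFun Ψ.hom y e)))
    ((hp.tangentEquiv y).symm_apply_apply v)

omit [IsManifold 𝓘(ℂ, V) ω X] in
/-- A criterion for two values of a Higgs field at equal points to agree. -/
theorem TwistedHiggs.heq_field {E : HolBundle V X} {x x' : X} (h : x = x')
    {A : TangentSpace 𝓘(ℂ, V) x →ₗ[ℂ] (E.fiber x →ₗ[ℂ] E.fiber x ⊗[ℂ] L.fiber x)}
    {B : TangentSpace 𝓘(ℂ, V) x' →ₗ[ℂ] (E.fiber x' →ₗ[ℂ] E.fiber x' ⊗[ℂ] L.fiber x')}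
    (hAB : ∀ v', ∃ v, (⟨x, v⟩ : TangentBundle 𝓘(ℂ, V) X) = ⟨x', v'⟩ ∧ ∀ e,
      TensorProduct.map (E.cast h).toLinearMap (L.cast h).toLinearMap (A v e) =
        B v' (E.cast h e)) : HEq A B := by
  subst h
  refine heq_of_eq (LinearMap.ext fun v' => LinearMap.ext fun e => ?_)
  obtain ⟨v, hv, hAB⟩ := hAB v'
  obtain rfl : v = v' := eq_of_heq (Bundle.TotalSpace.mk.inj hv).2
  exact (LinearMap.congr_fun TensorProduct.map_id _).symm.trans (hAB e)

variable {τ : HolBundle.pullback p L.toHolBundle ≅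
  (HolLineBundle.trivial (V := V) (X := Y)).toHolBundle}

omit [IsManifold 𝓘(ℂ, V) ω X] in
/-- The field that is to be descended takes the same value at all points of a fibre: this is where
`γ^*φ = γ φ` meets the factor `γ` in the equivariance of `τ`. -/
theorem EquivariantHiggs.fieldConj_invariant (P : EquivariantHiggs V Y Γ) (hp : IsGaloisCover Γ p)
    (hτ : IsEquivariantTrivialization Γ p hp.deck L τ) (γ : Γ) (y : Y) :
    HEq (hp.fieldConj P.higgs (P.descendIso hp) τ (γ • y))
      (hp.fieldConj P.higgs (P.descendIso hp) τ y) := by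
  refine TwistedHiggs.heq_field (hp.deck γ y) fun v' => ?_
  obtain ⟨w, rfl⟩ := (hp.tangentEquiv y).surjective v'
  refine ⟨_, hp.mfderiv_smul γ y w, fun e => ?_⟩
  refine (congrArg _ (hp.fieldConj_tangentEquiv _ _ _ (γ • y) _ e)).trans
    (Eq.trans ?_ (hp.fieldConj_tangentEquiv _ _ _ y w _).symm)
  refine HiggsAux.map_conj_eq (a := ((γ : Circle) : ℂ))
    (HolBundle.inv_hom_toFun (P.descendIso hp) (γ • y))
    (HolBundle.hom_inv_toFun (P.descendIso hp) y) (P.descendIso_equivariant hp γ y)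
    (fun c => ?_) (fun f => ?_) e
  · have h := hτ γ y (HolBundle.Hom.toFun τ.inv (γ • y) c)
    refine (HolBundle.hom_inv_toFun τ y _).symm.trans ?_
    refine congrArg (HolBundle.Hom.toFun τ.inv y) ((map_smul _ _ _).trans ?_)
    exact h.symm.trans (HolBundle.inv_hom_toFun τ (γ • y) c)
  · exact (congrArg _ (HiggsBundle.pullback_field (smulMap V Y γ) P.higgs y w f)).symm.trans
      (P.lin_field γ y w f)

/-- Every equivariant Higgs bundle is a pullback. -/
theorem EquivariantHiggs.exists_descend (P : EquivariantHiggs V Y Γ) (hp : IsGaloisCover Γ p)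
    (hτ : IsEquivariantTrivialization Γ p hp.deck L τ) :
    ∃ E : TwistedHiggs L, Nonempty ((pullbackFunctor p hp.deck τ hτ).obj E ≅ P) := by
  set Ψ := P.descendIso hp
  obtain ⟨θ, hθ⟩ := hp.exists_descent
    (β := fun x => TangentSpace 𝓘(ℂ, V) x →ₗ[ℂ]
      ((P.descend hp).fiber x →ₗ[ℂ] (P.descend hp).fiber x ⊗[ℂ] L.fiber x))
    (hp.fieldConj P.higgs Ψ τ)
    (P.fieldConj_invariant hp hτ)
  have hθ' : ∀ (y : Y) (v : TangentSpace 𝓘(ℂ, V) y) e, θ (p y) (hp.tangentEquiv y v) e =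
      TensorProduct.map (HolBundle.Hom.toPullback Ψ.inv y) (HolBundle.Hom.toPullback τ.inv y)
        (P.higgs.field y v (HolBundle.Hom.toFun Ψ.hom y e)) := fun y v e => by
    rw [hθ]
    exact hp.fieldConj_tangentEquiv P.higgs Ψ τ y v e
  let E : TwistedHiggs L :=
    { bundle := P.descend hp
      field := θ
      holo := fun i a v hv => by
        obtain ⟨x, v⟩ := v
        obtain ⟨y, rfl⟩ := hp.surjective x
        obtain ⟨v, rfl⟩ := (hp.tangentEquiv y).surjective v
        intro j hj b
        refine hp.contMDiffAt_of_comp_tangentMap (v := ⟨y, v⟩) ?_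
        have h₁ : (HolBundle.pullback p (P.descend hp)).IsHolAt 𝓘(ℂ, V).tangent
            (fun v' : TangentBundle 𝓘(ℂ, V) Y => v'.1)
            (fun v' => (P.descend hp).frame i (p v'.1) a) ⟨y, v⟩ :=
          HolBundle.isHolAt_frame (HolBundle.pullback p (P.descend hp))
            (g := fun v' : TangentBundle 𝓘(ℂ, V) Y => v'.1) (z := ⟨y, v⟩)
            TwistedHiggs.contMDiff_tangentProj.contMDiffAt i (show p y ∈ _ from hv) a
        have h₂ := P.higgs.isHolAt_field (TwistedHiggs.isHolAt_iso_hom Ψ h₁)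
        have h₃ := HolBundle.Hom.isHolAt (HolBundle.tensorHom Ψ.inv τ.inv)
          TwistedHiggs.contMDiff_tangentProj.contMDiffAt h₂ j hj b
        refine h₃.congr_of_eventuallyEq (Filter.Eventually.of_forall fun v' => ?_)
        exact congrArg (fun t => (((P.descend hp).tensor L.toHolBundle).frame j (p v'.1)).repr t b)
          (hθ' v'.1 v'.2 _)
      integrable := fun x v v' e => by
        obtain ⟨y, rfl⟩ := hp.surjective x
        obtain ⟨v, rfl⟩ := (hp.tangentEquiv y).surjective v
        obtain ⟨v', rfl⟩ := (hp.tangentEquiv y).surjective v'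
        have h₁ : ∀ v, θ (p y) (hp.tangentEquiv y v) =
            TensorProduct.map (HolBundle.Hom.toPullback Ψ.inv y)
                (HolBundle.Hom.toPullback τ.inv y) ∘ₗ
              P.higgs.field y v ∘ₗ HolBundle.Hom.toFun Ψ.hom y := fun v =>
          LinearMap.ext (hθ' y v)
        rw [h₁ v, h₁ v']
        refine (HiggsAux.rTensor_map_conj _ _ (HolBundle.inv_hom_toFun Ψ y) _ _ _).trans ?_
        refine Eq.trans ?_
          (HiggsAux.rTensor_map_conj _ _ (HolBundle.inv_hom_toFun Ψ y) _ _ _).symm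
        exact congrArg _ (P.higgs.integrable y v v' _) }
  refine ⟨E, ⟨EquivariantHiggs.mkIso (TwistedHiggs.mkIso Ψ fun y v e => ?_)
    (P.descendIso_equivariant hp)⟩⟩
  have key : (HolBundle.Hom.toFun Ψ.hom y).rTensor ℂ ∘ₗ
      (HolBundle.Hom.toFun τ.hom y).lTensor ((P.descend hp).fiber (p y)) ∘ₗ
      TensorProduct.map (HolBundle.Hom.toPullback Ψ.inv y) (HolBundle.Hom.toPullback τ.inv y) =
      LinearMap.id :=
    TensorProduct.ext' fun f c => congrArg₂ (fun a b => a ⊗ₜ[ℂ] b)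
      (HolBundle.inv_hom_toFun Ψ y f) (HolBundle.inv_hom_toFun τ y c)
  refine Eq.trans ?_ (LinearMap.congr_fun key (P.higgs.field y v (HolBundle.Hom.toFun Ψ.hom y e)))
  exact congrArg (fun t => (HolBundle.Hom.toFun Ψ.hom y).rTensor ℂ
    ((HolBundle.Hom.toFun τ.hom y).lTensor ((P.descend hp).fiber (p y)) t)) (hθ' y v e)

theorem pullbackFunctor_isEquivalence (hp : IsGaloisCover Γ p)
    (hτ : IsEquivariantTrivialization Γ p hp.deck L τ) :
    (pullbackFunctor p hp.deck τ hτ).IsEquivalence where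
  faithful := pullbackFunctor_faithful hp hτ
  full := pullbackFunctor_full hp hτ
  essSurj := ⟨fun P => P.exists_descend hp hτ⟩

end Descent

/-! ### The covering attached to a unitary character -/

theorem FlatFrame.cast_toFun {V : Type w} [NormedAddCommGroup V] [NormedSpace ℂ V]
    {X : Type u} [TopologicalSpace X] [ChartedSpace V X] {L : HolLineBundle V X}
    {x₀ : X} {χ : FundamentalGroup X x₀ →* Circle}
    (s : FlatFrame L x₀ χ) {x x' : X} (h : x = x') (c : Path x₀ x) (c' : Path x₀ x')
    (hc : ∀ t, c t = c' t) :
    L.cast h (s.toFun (Path.Homotopic.Quotient.mk c)) =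
      s.toFun (Path.Homotopic.Quotient.mk c') := by
  subst h
  obtain rfl : c = c' := by
    ext t
    exact hc t
  rfl

namespace IsCharacterCover

variable {V : Type w} [NormedAddCommGroup V] [NormedSpace ℂ V]
  {X : Type u} [TopologicalSpace X] [ChartedSpace V X]
  {Y : Type u} [TopologicalSpace Y] [ChartedSpace V Y]
  {p : C^ω⟮𝓘(ℂ, V), Y; 𝓘(ℂ, V), X⟯} {y₀ : Y} {χ : FundamentalGroup X (p y₀) →* Circle}
  [MulAction χ.range Y]

/-- Monodromy along `l` is computed by any lift `c` of `l`. -/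
theorem monodromy_eq (cov : IsCoveringMap p) {x x' : X} {y y' : Y} (l : Path x x') (c : Path y y')
    (h : p y = x) (h' : p y' = x') (hc : ∀ t, p (c t) = l t) :
    cov.monodromy (Path.Homotopic.Quotient.mk l) ⟨y, h⟩ = ⟨y', h'⟩ := by
  subst h h'
  refine cov.monodromy_eq_of_map_eq (ex := ⟨y, rfl⟩) (ey := ⟨y', rfl⟩)
    (Path.Homotopic.Quotient.mk c) ?_
  rw [← Path.Homotopic.Quotient.mk_map, Path.Homotopic.Quotient.cast_rfl_rfl]
  congr 1
  ext t
  exact hc t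

/-- The character is trivial on loops that lift to loops. -/
theorem map_loop_mem_ker (hp : IsCharacterCover χ p y₀) (c : Path y₀ y₀) :
    χ (FundamentalGroup.fromPath (Path.Homotopic.Quotient.mk (c.map p.contMDiff.continuous))) =
      1 := by
  have h : FundamentalGroup.mapOfEq ⟨p, p.contMDiff.continuous⟩ hp.base
      (FundamentalGroup.fromPath (Path.Homotopic.Quotient.mk c)) ∈ χ.ker :=
    hp.range_eq_ker ▸ ⟨_, rfl⟩
  rw [FundamentalGroup.mapOfEq_apply] at h
  exact h

theorem exists_lift (hp : IsCharacterCover χ p y₀) (γ : χ.range) :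
    ∃ (l : Path (p y₀) (p y₀)) (c : Path y₀ (γ • y₀)), (∀ t, p (c t) = l t) ∧
      χ (FundamentalGroup.fromPath (Path.Homotopic.Quotient.mk l)) = γ := by
  obtain ⟨_, ⟨g, rfl⟩⟩ := γ
  obtain ⟨l, rfl⟩ := Path.Homotopic.Quotient.mk_surjective g
  obtain ⟨c, hc⟩ := hp.monodromy l
  exact ⟨l, c, hc, rfl⟩

variable [PathConnectedSpace Y]

/-- The covering attached to a character is Galois, with Galois group the image of the
character. -/
theorem isGaloisCover [HolomorphicAction V χ.range Y] [PathConnectedSpace X]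
    (hp : IsCharacterCover χ p y₀) : IsGaloisCover χ.range p where
  surjective := fun x => by
    obtain ⟨l⟩ := PathConnectedSpace.joined (p y₀) x
    exact ⟨_, (hp.isCoveringMap.monodromy (Path.Homotopic.Quotient.mk l) ⟨y₀, rfl⟩).2⟩
  isLocalDiffeomorph := hp.isLocalDiffeomorph
  deck := hp.deck
  exists_smul_eq := fun {y y'} h => by
    obtain ⟨d⟩ := PathConnectedSpace.joined y₀ y
    obtain ⟨d'⟩ := PathConnectedSpace.joined y₀ y'
    have hpc := p.contMDiff.continuous
    -- The loop that follows the image of `d` and returns along the image of `d'`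
    let l : Path (p y₀) (p y₀) := (d.map hpc).trans (((d'.map hpc).cast rfl h).symm)
    obtain ⟨γ, c, hc⟩ : ∃ (γ : χ.range) (c : Path y₀ (γ • y₀)), ∀ t, p (c t) = l t :=
      ⟨_, hp.monodromy l⟩
    have h₁ := monodromy_eq hp.isCoveringMap l c rfl (hp.deck γ y₀) hc
    have h₂ := monodromy_eq hp.isCoveringMap (d.map hpc) d rfl rfl fun _ => rfl
    have h₃ := monodromy_eq hp.isCoveringMap (((d'.map hpc).cast rfl h).symm)
      ((d'.map (HolomorphicAction.contMDiff_smul (V := V) γ).continuous).symm)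
      ((hp.deck γ y').trans h.symm) (hp.deck γ y₀) fun t => hp.deck γ _
    rw [show Path.Homotopic.Quotient.mk l = (Path.Homotopic.Quotient.mk (d.map hpc)).trans
      (Path.Homotopic.Quotient.mk (((d'.map hpc).cast rfl h).symm)) from rfl,
      hp.isCoveringMap.monodromy_trans_apply, h₂, ← h₃] at h₁
    exact ⟨γ, (congrArg Subtype.val ((hp.isCoveringMap.monodromy_bijective _).1 h₁)).symm⟩
  eq_one := fun {γ y} h => by
    have h₁ : (fun y : Y => γ • y) = id := hp.isCoveringMap.eq_of_comp_eq
      (HolomorphicAction.contMDiff_smul (V := V) γ).continuous continuous_id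
      (funext fun y => hp.deck γ y) y h
    obtain ⟨l, c, hc, hl⟩ := hp.exists_lift γ
    have h₂ : y₀ = γ • y₀ := (congrFun h₁ y₀).symm
    have h₃ := hp.map_loop_mem_ker (c.cast rfl h₂)
    have h₄ : (c.cast rfl h₂).map p.contMDiff.continuous = l := by
      ext t
      exact hc t
    rw [h₄, hl] at h₃
    exact Subtype.ext h₃

variable {L : HolLineBundle V X} (s : FlatFrame L (p y₀) χ)

/-- The section of `p^*L` on `Y = X̃ / Ker χ` induced by the flat frame `c ↦ [c, 1]` on `X̃`. -/
def flatSection (s : FlatFrame L (p y₀) χ) (y : Y) : L.fiber (p y) :=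
  s.toFun (Path.Homotopic.Quotient.mk
    ((PathConnectedSpace.somePath y₀ y).map p.contMDiff.continuous))

/-- The flat section does not depend on the path: two paths to `y` differ by a loop in `Y`, on whose
image the character is trivial. -/
theorem flatSection_eq (hp : IsCharacterCover χ p y₀) {y : Y} (d : Path y₀ y) :
    flatSection s y =
      s.toFun (Path.Homotopic.Quotient.mk (d.map p.contMDiff.continuous)) := by
  set d' := PathConnectedSpace.somePath y₀ y
  have hpc := p.contMDiff.continuous
  have h₁ := hp.map_loop_mem_ker (d'.trans d.symm)
  have h₂ := s.equivariant (FundamentalGroup.fromPath (Path.Homotopic.Quotient.mk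
    ((d'.trans d.symm).map hpc))) (Path.Homotopic.Quotient.mk (d.map hpc))
  have h₃ : (FundamentalGroup.fromPath (Path.Homotopic.Quotient.mk
      ((d'.trans d.symm).map hpc))).toPath.trans (Path.Homotopic.Quotient.mk (d.map hpc)) =
      Path.Homotopic.Quotient.mk (d'.map hpc) := by
    rw [Path.map_trans, Path.Homotopic.Quotient.mk_trans]
    refine (Path.Homotopic.Quotient.trans_assoc _ _ _).trans ?_
    rw [← Path.map_symm, Path.Homotopic.Quotient.mk_symm, Path.Homotopic.Quotient.symm_trans,
      Path.Homotopic.Quotient.trans_refl]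
  rw [h₁, h₃] at h₂
  refine h₂.trans ?_
  rw [inv_one, Circle.coe_one, one_smul]

omit [MulAction χ.range Y] in
theorem flatSection_ne_zero (y : Y) : flatSection s y ≠ 0 := s.ne_zero _

/-- The path to `γ y` may be taken as a lift of a loop `l` with `χ l = γ` followed by the translate
by `γ` of a path to `y`, so that the equivariance of the flat frame under `l` applies. -/
theorem cast_flatSection_smul [HolomorphicAction V χ.range Y] (hp : IsCharacterCover χ p y₀)
    (γ : χ.range) (y : Y) :
    L.cast (hp.deck γ y) (flatSection s (γ • y)) =
      ((γ⁻¹ : Circle) : ℂ) • flatSection s y := by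
  obtain ⟨l, c, hc, hl⟩ := hp.exists_lift γ
  obtain ⟨d⟩ := PathConnectedSpace.joined y₀ y
  have hpc := p.contMDiff.continuous
  have hγ := (HolomorphicAction.contMDiff_smul (V := V) (Y := Y) γ).continuous
  rw [flatSection_eq s hp d, flatSection_eq s hp (c.trans (d.map hγ)),
    s.cast_toFun (hp.deck γ y) _ (l.trans (d.map hpc)), ← hl]
  · exact s.equivariant (FundamentalGroup.fromPath (Path.Homotopic.Quotient.mk l))
      (Path.Homotopic.Quotient.mk (d.map hpc))
  · intro t
    rw [Path.map_coe, Function.comp_apply, Path.trans_apply, Path.trans_apply]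
    split_ifs
    · exact hc _
    · exact hp.deck γ _

/-- Near `y` the section can be computed along paths that stay in a small neighbourhood of `y`,
where the flat frame is given by a holomorphic local section. -/
theorem isHolAt_flatSection [LocallyPathConnectedSpace Y] (hp : IsCharacterCover χ p y₀) (y : Y) :
    L.IsHolAt 𝓘(ℂ, V) p (flatSection s) y := by
  obtain ⟨d⟩ := PathConnectedSpace.joined y₀ y
  have hpc := p.contMDiff.continuous
  obtain ⟨U, hU, hy, t, ht, hst⟩ := s.holo (Path.Homotopic.Quotient.mk (d.map hpc))
  obtain ⟨N, ⟨hN, hNc⟩, hNU⟩ := (path_connected_basis y).mem_iff.1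
    (hpc.continuousAt.preimage_mem_nhds (hU.mem_nhds hy))
  have h₁ : L.IsHolAt 𝓘(ℂ, V) p (fun y' => t (p y')) y :=
    ht.comp p.contMDiff.contMDiffAt
  refine h₁.congr ?_
  filter_upwards [hN] with y' hy'
  obtain ⟨e, he⟩ := hNc.joinedIn y (mem_of_mem_nhds hN) y' hy'
  rw [flatSection_eq s hp (d.trans e), Path.map_trans]
  refine (hst (p y') (e.map hpc) ?_).symm
  rintro _ ⟨r, rfl⟩
  exact hNU (he r)

end IsCharacterCover

/-! ### Trivialization of line bundles -/

section Trivialization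

variable {V : Type w} [NormedAddCommGroup V] [NormedSpace ℂ V]
  {Y : Type u} [TopologicalSpace Y] [ChartedSpace V Y]

theorem HolLineBundle.exists_smul_eq (M : HolLineBundle V Y) {y : Y} {t : M.fiber y} (ht : t ≠ 0)
    (m : M.fiber y) : ∃ c : ℂ, m = c • t := by
  have : Module.finrank ℂ (M.fiber y) = 1 := by
    obtain ⟨i, -⟩ := M.exists_mem_dom y
    rw [Module.finrank_eq_card_basis (M.frame i y), M.rank_eq_one]
  obtain ⟨c, hc⟩ := (finrank_eq_one_iff_of_nonzero' t ht).1 this m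
  exact ⟨c, hc.symm⟩

/-- A nowhere vanishing holomorphic section trivializes a line bundle. -/
theorem HolLineBundle.exists_iso_trivial (M : HolLineBundle V Y) (t : ∀ y, M.fiber y)
    (ht : ∀ y, t y ≠ 0) (hol : ∀ y, M.IsHolAt 𝓘(ℂ, V) (fun y' => y') t y) :
    ∃ τ : M.toHolBundle ≅ (HolLineBundle.trivial (V := V) (X := Y)).toHolBundle,
      ∀ (y : Y) (c : ℂ), HolBundle.Hom.toFun τ.hom y (c • t y) = c := by
  let e : ∀ y, ℂ ≃ₗ[ℂ] M.fiber y := fun y =>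
    LinearEquiv.ofBijective (LinearMap.toSpanSingleton ℂ (M.fiber y) (t y))
      ⟨smul_left_injective ℂ (ht y), fun m => by
        obtain ⟨c, rfl⟩ := M.exists_smul_eq (ht y) m
        exact ⟨c, rfl⟩⟩
  have he : ∀ y c, (e y).symm (c • t y) = c := fun y c => (e y).symm_apply_apply c
  obtain ⟨k, hk⟩ := Fintype.card_eq_one_iff.1 M.rank_eq_one
  refine ⟨HolBundle.mkIso (fun y => (e y).symm) (fun i a y hy => ?_) (fun i a y _ => ?_), he⟩
  · intro _ _ b
    have hne : ∀ y', (M.frame i y').repr (t y') k ≠ 0 := fun y' h0 => by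
      refine ht y' ((M.frame i y').repr.injective (Finsupp.ext fun k' => ?_))
      rw [hk k', h0, map_zero, Finsupp.zero_apply]
    have h₁ := ((M.isHolAt_frame' i a hy i hy k).div₀ (hol y i hy k) (hne y))
    refine h₁.congr_of_eventuallyEq (Filter.Eventually.of_forall fun y' => ?_)
    obtain ⟨c, hc⟩ := M.exists_smul_eq (ht y') (M.frame i y' a)
    change (Module.Basis.singleton Unit ℂ).repr ((e y').symm (M.frame i y' a)) b =
      (M.frame i y').repr (M.frame i y' a) k / (M.frame i y').repr (t y') k
    rw [hc, he, map_smul, Finsupp.smul_apply, smul_eq_mul, mul_div_cancel_right₀ _ (hne y')]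
    exact Module.Basis.singleton_repr Unit ℂ c b
  · have h₁ : (fun y' => e y' (HolBundle.unit.frame i y' a)) = t := funext fun y' => by
      exact (congrArg (e y') (HolBundle.unit_frame (V := V) i y' a)).trans (one_smul ℂ (t y'))
    have h₂ := hol y
    rw [← h₁] at h₂
    exact h₂

end Trivialization

/-- The trivialization of `p^*L` by the flat section is equivariant. -/
theorem IsCharacterCover.exists_isEquivariantTrivialization
    {V : Type w} [NormedAddCommGroup V] [NormedSpace ℂ V]
    {X : Type u} [TopologicalSpace X] [ChartedSpace V X]
    {Y : Type u} [TopologicalSpace Y] [ChartedSpace V Y]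
    {p : C^ω⟮𝓘(ℂ, V), Y; 𝓘(ℂ, V), X⟯} {y₀ : Y} {χ : FundamentalGroup X (p y₀) →* Circle}
    [MulAction χ.range Y] [HolomorphicAction V χ.range Y] [PathConnectedSpace Y]
    [LocallyPathConnectedSpace Y] {L : HolLineBundle V X} (s : FlatFrame L (p y₀) χ)
    (hp : IsCharacterCover χ p y₀) :
    ∃ τ, IsEquivariantTrivialization χ.range p hp.deck L τ := by
  let M : HolLineBundle V Y :=
    { toHolBundle := HolBundle.pullback p L.toHolBundle
      rank_eq_one := L.rank_eq_one }
  obtain ⟨τ, hτ⟩ := M.exists_iso_trivial (flatSection s) (flatSection_ne_zero s)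
    (isHolAt_flatSection s hp)
  refine ⟨τ, fun γ y l => ?_⟩
  obtain ⟨c, rfl⟩ := M.exists_smul_eq (flatSection_ne_zero s (γ • y)) l
  refine (hτ (γ • y) c).trans ?_
  have h₁ : L.cast (hp.deck γ y) (c • flatSection s (γ • y)) =
      (c * ((γ⁻¹ : Circle) : ℂ)) • flatSection s y := by
    rw [map_smul, cast_flatSection_smul s hp, smul_smul]
  have h₂ := (congrArg (HolBundle.Hom.toFun τ.hom y) h₁).trans (hτ y _)
  refine Eq.trans ?_ (congrArg (fun z : ℂ => ((γ : Circle) : ℂ) * z) h₂).symm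
  rw [Circle.coe_inv, mul_left_comm, mul_inv_cancel₀ (Circle.coe_ne_zero _), mul_one]

/-! ### The maximum principle and the finiteness of the Galois group -/

theorem HiggsAux.eq_zero_or_eq_zero_of_tmul {E F : Type*} [AddCommGroup E] [Module ℂ E]
    [AddCommGroup F] [Module ℂ F] {e : E} {f : F} (h : e ⊗ₜ[ℂ] f = 0) : e = 0 ∨ f = 0 := by
  by_contra! hne
  have b := Module.Basis.ofVectorSpace ℂ E
  have c := Module.Basis.ofVectorSpace ℂ F
  obtain ⟨i, hi⟩ := Finsupp.ne_iff.1 ((map_ne_zero_iff b.repr b.repr.injective).2 hne.1)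
  obtain ⟨j, hj⟩ := Finsupp.ne_iff.1 ((map_ne_zero_iff c.repr c.repr.injective).2 hne.2)
  have := Module.Basis.tensorProduct_repr_tmul_apply b c e f i j
  rw [h, map_zero] at this
  exact mul_ne_zero hj hi this.symm

section TensorPower

variable {V : Type w} [NormedAddCommGroup V] [NormedSpace ℂ V]
  {X : Type u} [TopologicalSpace X] [ChartedSpace V X]
  {Y : Type u} [TopologicalSpace Y] [ChartedSpace V Y]

/-- The tensor power of a vector. -/
def HolBundle.tpow (E : HolBundle V X) {x : X} (e : E.fiber x) : ∀ n, (E.tensorPow n).fiber x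
  | 0 => (1 : ℂ)
  | n + 1 => HolBundle.tpow E e n ⊗ₜ[ℂ] e

theorem HolBundle.tpow_ne_zero (E : HolBundle V X) {x : X} {e : E.fiber x} (he : e ≠ 0) (n : ℕ) :
    E.tpow e n ≠ 0 := by
  induction n with
  | zero => exact one_ne_zero (α := ℂ)
  | succ n ih =>
    intro h
    exact (HiggsAux.eq_zero_or_eq_zero_of_tmul h).elim ih he

theorem HolBundle.tpow_smul (E : HolBundle V X) {x : X} (c : ℂ) (e : E.fiber x) (n : ℕ) :
    E.tpow (c • e) n = c ^ n • E.tpow e n := by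
  induction n with
  | zero => exact (one_smul ℂ _).symm.trans (by rw [pow_zero]; rfl)
  | succ n ih =>
    change E.tpow (c • e) n ⊗ₜ[ℂ] (c • e) = c ^ (n + 1) • (E.tpow e n ⊗ₜ[ℂ] e)
    rw [ih, TensorProduct.smul_tmul_smul, pow_succ]

theorem HolBundle.IsHolAt.tpow {E : HolBundle V X} {g : Y → X} {s : ∀ y, E.fiber (g y)} {y : Y}
    (hs : E.IsHolAt 𝓘(ℂ, V) g s y) (n : ℕ) :
    (E.tensorPow n).IsHolAt 𝓘(ℂ, V) g (fun y' => E.tpow (s y') n) y := by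
  induction n with
  | zero => exact fun i _ a =>
    contMDiffAt_const (c := (Module.Basis.singleton Unit ℂ).repr (1 : ℂ) a)
  | succ n ih => exact HolBundle.isHolAt_tmul ih hs

end TensorPower

section Finite

variable {V : Type w} [NormedAddCommGroup V] [NormedSpace ℂ V]
  {X : Type u} [TopologicalSpace X] [ChartedSpace V X] [CompactSpace X]
  {Y : Type u} [TopologicalSpace Y] [ChartedSpace V Y] [IsManifold 𝓘(ℂ, V) ω Y] [ConnectedSpace Y]
  {Γ : Subgroup Circle} [MulAction Γ Y]
  {p : C^ω⟮𝓘(ℂ, V), Y; 𝓘(ℂ, V), X⟯}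

/-- A holomorphic function on the covering whose absolute value is `Γ`-invariant is constant: its
absolute value comes from the compact base, so it has a maximum. -/
theorem IsGaloisCover.eq_of_norm_invariant (hp : IsGaloisCover Γ p) {f : Y → ℂ}
    (hf : ∀ y, ContMDiffAt 𝓘(ℂ, V) 𝓘(ℂ, ℂ) ω f y) (h : ∀ (γ : Γ) y, ‖f (γ • y)‖ = ‖f y‖)
    (y y' : Y) : f y = f y' := by
  have hfc : ContMDiff 𝓘(ℂ, V) 𝓘(ℂ, ℂ) ω f := hf
  obtain ⟨N, hN⟩ := hp.exists_descent (β := fun _ => ℝ) (fun y => ‖f y‖)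
    fun γ y => heq_of_eq (h γ y)
  have hq : IsOpenQuotientMap p :=
    ⟨hp.surjective, p.contMDiff.continuous, hp.isLocalDiffeomorph.isOpenMap⟩
  have hNc : Continuous N := by
    rw [hq.isQuotientMap.continuous_iff, show N ∘ p = fun y => ‖f y‖ from funext hN]
    exact hfc.continuous.norm
  obtain ⟨x, -, hx⟩ := isCompact_univ.exists_isMaxOn ⟨p y, trivial⟩ hNc.continuousOn
  obtain ⟨y₁, rfl⟩ := hp.surjective x
  have hmax : IsMaxOn (norm ∘ f) Set.univ y₁ := fun y₂ _ => by
    have := hx (Set.mem_univ (p y₂))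
    simp only [Set.mem_ofPred_eq, hN] at this
    exact this
  have : IsManifold 𝓘(ℂ, V) 1 Y := IsManifold.of_le (n := ω) le_top
  have key := MDifferentiableOn.eqOn_of_isPreconnected_of_isMaxOn_norm (I := 𝓘(ℂ, V))
    (hfc.mdifferentiable (by simp)).mdifferentiableOn isPreconnected_univ isOpen_univ trivial hmax
  exact (key (Set.mem_univ y)).trans (key (Set.mem_univ y')).symm

/-- If some power of `L` is trivial, the Galois group is finite: for the nowhere vanishing section
`t` of `p^*L` corresponding to `1`, the power `t ^ n` is a nowhere vanishing holomorphic function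
`f` with `f (γ y) = γ⁻ⁿ f y`, and it is constant by the maximum principle. -/
theorem IsGaloisCover.finite (hp : IsGaloisCover Γ p) {L : HolLineBundle V X}
    {τ : HolBundle.pullback p L.toHolBundle ≅
      (HolLineBundle.trivial (V := V) (X := Y)).toHolBundle}
    (hτ : IsEquivariantTrivialization Γ p hp.deck L τ)
    (hL : ∃ n : ℕ, 0 < n ∧ Nonempty (L.tensorPow n ≅ HolBundle.unit)) : Finite Γ := by
  obtain ⟨n, hn, ⟨ψ⟩⟩ := hL
  let t : ∀ y, L.fiber (p y) := fun y => HolBundle.Hom.toFun τ.inv y (1 : ℂ)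
  have ht : ∀ (γ : Γ) y, L.cast (hp.deck γ y) (t (γ • y)) = (((γ : Circle) : ℂ))⁻¹ • t y :=
    fun γ y => by
      have hγ : ((γ : Circle) : ℂ) ≠ 0 := Circle.coe_ne_zero _
      have h := (hτ γ y (t (γ • y))).symm.trans (HolBundle.inv_hom_toFun τ (γ • y) (1 : ℂ))
      have h' : (HolBundle.Hom.toFun τ.hom y (L.cast (hp.deck γ y) (t (γ • y))) : ℂ) =
          (((γ : Circle) : ℂ))⁻¹ • (1 : ℂ) :=
        ((eq_inv_mul_iff_mul_eq₀ hγ).2 h).trans (smul_eq_mul _ _).symm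
      exact (HolBundle.hom_inv_toFun τ y _).symm.trans
        ((congrArg (HolBundle.Hom.toFun τ.inv y) h').trans
          (map_smul (HolBundle.Hom.toFun τ.inv y) _ _))
  have ht0 : ∀ y, t y ≠ 0 := fun y h0 => by
    have h := HolBundle.inv_hom_toFun τ y (1 : ℂ)
    exact zero_ne_one (α := ℂ) (((congrArg (HolBundle.Hom.toFun τ.hom y) h0).trans
      (map_zero (HolBundle.Hom.toFun τ.hom y))).symm.trans h)
  have hthol : ∀ y, L.IsHolAt 𝓘(ℂ, V) p t y := fun y =>
    HolBundle.Hom.isHolAt τ.inv contMDiffAt_id (HolBundle.isHolAt_unit_const 1)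
  let f : Y → ℂ := fun y => HolBundle.Hom.toFun ψ.hom (p y) (L.tpow (t y) n)
  have hf0 : ∀ y, f y ≠ 0 := fun y h0 =>
    L.tpow_ne_zero (ht0 y) n ((HolBundle.fiberEquiv ψ (p y)).map_eq_zero_iff.1 h0)
  have hfhol : ∀ y, ContMDiffAt 𝓘(ℂ, V) 𝓘(ℂ, ℂ) ω f y := fun y =>
    (HolBundle.Hom.isHolAt ψ.hom p.contMDiff.contMDiffAt ((hthol y).tpow n) PUnit.unit trivial
      ()).congr_of_eventuallyEq (Filter.Eventually.of_forall fun y' =>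
        (Module.Basis.singleton_repr Unit ℂ (f y') ()).symm)
  have hfγ : ∀ (γ : Γ) y, f (γ • y) = (((γ : Circle) : ℂ))⁻¹ ^ n * f y := fun γ y => by
    have h₁ : ∀ {x : X} (h : p (γ • y) = x), f (γ • y) =
        HolBundle.Hom.toFun ψ.hom x (L.tpow (L.cast h (t (γ • y))) n) := by
      intro x h
      subst h
      rfl
    rw [h₁ (hp.deck γ y), ht, HolBundle.tpow_smul]
    exact map_smul _ _ _
  have hpow : ∀ γ : Γ, ((γ : Circle) : ℂ) ^ n = 1 := fun γ => by
    obtain ⟨y⟩ := (inferInstance : Nonempty Y)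
    have h₁ := hp.eq_of_norm_invariant hfhol
      (fun γ y => by rw [hfγ, norm_mul, norm_pow, norm_inv, Circle.norm_coe, inv_one, one_pow,
        one_mul]) (γ • y) y
    rw [hfγ, inv_pow] at h₁
    exact inv_eq_one.1 ((mul_eq_right₀ (hf0 y)).1 h₁)
  have : NeZero n := ⟨hn.ne'⟩
  have hinj : Function.Injective fun γ : Γ => ((γ : Circle) : ℂ) := fun γ δ h =>
    Subtype.ext (Circle.ext h)
  have hfin : {z : ℂ | z ^ n = 1}.Finite :=
    (Polynomial.nthRoots n (1 : ℂ)).toFinset.finite_toSet.subset fun z hz => by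
      simpa [Polynomial.mem_nthRoots hn] using hz
  exact Set.finite_univ_iff.1 ((hfin.preimage hinj.injOn).subset fun γ _ => hpow γ)

end Finite

/-! ### Operators covering a deck transformation -/

/-- Modulo a polynomial that does not vanish at `0`, the inverse of the variable has roots of every
order. -/
theorem Polynomial.exists_dvd_X_mul_pow_sub_one {m : ℕ} (hm : 0 < m) (P : Polynomial ℂ)
    (hP : P.eval 0 ≠ 0) : ∃ q : Polynomial ℂ, P ∣ Polynomial.X * q ^ m - 1 := by
  suffices h : ∀ s : Multiset ℂ, (0 : ℂ) ∉ s → ∃ q : Polynomial ℂ,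
      (s.map fun r => Polynomial.X - Polynomial.C r).prod ∣ Polynomial.X * q ^ m - 1 by
    have hP0 : P ≠ 0 := fun h0 => hP (by simp [h0])
    obtain ⟨q, hq⟩ := h P.roots fun h0 => hP (Polynomial.isRoot_of_mem_roots h0)
    refine ⟨q, ?_⟩
    rw [(IsAlgClosed.splits P).eq_prod_roots]
    exact (Polynomial.isUnit_C.2
      (Polynomial.leadingCoeff_ne_zero.2 hP0).isUnit).mul_left_dvd.2 hq
  intro s
  induction s using Multiset.induction_on with
  | empty => exact fun _ => ⟨0, by simp⟩
  | cons r s ih =>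
    intro hs
    rw [Multiset.mem_cons, not_or] at hs
    obtain ⟨q, H, hq⟩ := ih hs.2
    have hr : r ≠ 0 := Ne.symm hs.1
    set Q := (s.map fun r => Polynomial.X - Polynomial.C r).prod
    -- The new solution is sought in the form `q + c Q`.
    have key : ∀ c : ℂ, ∃ k, Polynomial.X * (q + Polynomial.C c * Q) ^ m - 1 =
        Q * (H + (m : Polynomial ℂ) * Polynomial.C c * Polynomial.X * q ^ (m - 1) + k * Q) :=
      fun c => by
      obtain ⟨k, hk⟩ := Polynomial.powAddExpansion q (Polynomial.C c * Q) m
      refine ⟨Polynomial.X * k * Polynomial.C c ^ 2, ?_⟩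
      rw [hk]
      linear_combination hq
    suffices h : ∃ c : ℂ, ∀ k, Polynomial.X * (q + Polynomial.C c * Q) ^ m - 1 =
        Q * (H + (m : Polynomial ℂ) * Polynomial.C c * Polynomial.X * q ^ (m - 1) + k * Q) →
        (H + (m : Polynomial ℂ) * Polynomial.C c * Polynomial.X * q ^ (m - 1) + k * Q).eval r = 0 by
      obtain ⟨c, hc⟩ := h
      obtain ⟨k, hk⟩ := key c
      obtain ⟨R, hR⟩ := Polynomial.dvd_iff_isRoot.2 (hc k hk)
      refine ⟨q + Polynomial.C c * Q, R, ?_⟩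
      rw [hk, hR, Multiset.map_cons, Multiset.prod_cons]
      ring
    by_cases h0 : Q.eval r = 0
    · have h1 : r * q.eval r ^ m = 1 := by
        have := congrArg (Polynomial.eval r) hq
        simpa [h0, sub_eq_zero] using this
      have h2 : (m : ℂ) * r * q.eval r ^ (m - 1) ≠ 0 := by
        have hq0 : q.eval r ≠ 0 := fun h => by
          rw [h, zero_pow hm.ne', mul_zero] at h1
          exact zero_ne_one h1
        exact mul_ne_zero (mul_ne_zero (Nat.cast_ne_zero.2 hm.ne') hr) (pow_ne_zero _ hq0)
      refine ⟨-H.eval r / ((m : ℂ) * r * q.eval r ^ (m - 1)), fun k _ => ?_⟩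
      simp only [Polynomial.eval_add, Polynomial.eval_mul, Polynomial.eval_natCast,
        Polynomial.eval_C, Polynomial.eval_X, Polynomial.eval_pow, h0, mul_zero, add_zero]
      linear_combination div_mul_cancel₀ (-H.eval r) h2
    · obtain ⟨ρ, hρ⟩ := IsAlgClosed.exists_pow_nat_eq r⁻¹ hm
      refine ⟨(ρ - q.eval r) / Q.eval r, fun k hk => ?_⟩
      have h := congrArg (Polynomial.eval r) hk
      rw [Polynomial.eval_mul] at h
      refine (mul_eq_zero.1 (h.symm.trans ?_)).resolve_left h0
      simp only [Polynomial.eval_sub, Polynomial.eval_add, Polynomial.eval_mul,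
        Polynomial.eval_C, Polynomial.eval_X, Polynomial.eval_pow, Polynomial.eval_one]
      rw [div_mul_cancel₀ _ h0, add_sub_cancel, hρ, mul_inv_cancel₀ hr, sub_self]

theorem HiggsAux.rid_rTensor {E F : Type*} [AddCommGroup E] [Module ℂ E]
    [AddCommGroup F] [Module ℂ F] (α : E →ₗ[ℂ] F) (t : E ⊗[ℂ] ℂ) :
    TensorProduct.rid ℂ F (α.rTensor ℂ t) = α (TensorProduct.rid ℂ E t) := by
  induction t using TensorProduct.induction_on with
  | zero => simp
  | tmul _ _ => simp
  | add t t' h h' => simp only [map_add, h, h']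

section Lift

variable {V : Type w} [NormedAddCommGroup V] [NormedSpace ℂ V]
  {X : Type u} [TopologicalSpace X] [ChartedSpace V X]
  {Y : Type u} [TopologicalSpace Y] [ChartedSpace V Y]
  {Γ : Subgroup Circle} [MulAction Γ Y]
  {p : C^ω⟮𝓘(ℂ, V), Y; 𝓘(ℂ, V), X⟯}
  [IsManifold 𝓘(ℂ, V) ω Y]

open Classical in
/-- The matrix entry `F_z → F_y` of an operator on the space of all set-theoretic sections. -/
def HolBundle.entry {F : HolBundle V Y} (O : Module.End ℂ (∀ y, F.fiber y)) (z y : Y) :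
    F.fiber z →ₗ[ℂ] F.fiber y :=
  LinearMap.proj y ∘ₗ O ∘ₗ LinearMap.single ℂ F.fiber z

/-- The endomorphism `φ_y(v)` of the fibre `F_y`. -/
def HiggsBundle.endo (F : HiggsBundle V Y) (y : Y) (v : TangentSpace 𝓘(ℂ, V) y) :
    F.bundle.fiber y →ₗ[ℂ] F.bundle.fiber y :=
  (TensorProduct.rid ℂ (F.bundle.fiber y)).toLinearMap ∘ₗ F.field y v

namespace IsGaloisCover

/-- The operator on sections of `F` given by the contraction of the Higgs field with the lift to the
covering of the (set-theoretic) vector field `w` on the base. -/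
def contract (hp : IsGaloisCover Γ p) (F : HiggsBundle V Y)
    (w : ∀ x : X, TangentSpace 𝓘(ℂ, V) x) : Module.End ℂ (∀ y, F.bundle.fiber y) :=
  LinearMap.pi fun y =>
    F.endo y ((hp.tangentEquiv y).symm (w (p y))) ∘ₗ LinearMap.proj y

/-- The operator `O` on the sections of `F` comes from a morphism `γ^*F → F` which carries
`γ^*φ` to `γ φ`. Working with operators on sections, the composites of such morphisms for different
`γ` are just products. -/
structure IsLift (hp : IsGaloisCover Γ p) (F : HiggsBundle V Y) (γ : Γ)
    (O : Module.End ℂ (∀ y, F.bundle.fiber y)) : Prop where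
  eq_zero : ∀ s y, s (γ • y) = 0 → O s y = 0
  holo : ∀ s y, F.bundle.IsHolAt 𝓘(ℂ, V) (fun y' => y') s (γ • y) →
    F.bundle.IsHolAt 𝓘(ℂ, V) (fun y' => y') (O s) y
  field : ∀ w, O * hp.contract F w = ((γ : Circle) : ℂ) • (hp.contract F w * O)

namespace IsLift

variable {hp : IsGaloisCover Γ p} {F : HiggsBundle V Y} {γ δ : Γ}
  {O O' A : Module.End ℂ (∀ y, F.bundle.fiber y)}

theorem one : IsLift hp F 1 1 where
  eq_zero s y h := by rwa [one_smul] at h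
  holo s y h := by rwa [one_smul] at h
  field w := by simp

theorem add (h : IsLift hp F γ O) (h' : IsLift hp F γ O') : IsLift hp F γ (O + O') where
  eq_zero s y hs := by
    rw [LinearMap.add_apply, Pi.add_apply, h.eq_zero s y hs, h'.eq_zero s y hs, add_zero]
  holo s y hs := (h.holo s y hs).add (h'.holo s y hs)
  field w := by rw [add_mul, h.field, h'.field, mul_add, smul_add]

theorem smul (c : ℂ) (h : IsLift hp F γ O) : IsLift hp F γ (c • O) where
  eq_zero s y hs := by
    rw [LinearMap.smul_apply, Pi.smul_apply, h.eq_zero s y hs, smul_zero]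
  holo s y hs := (h.holo s y hs).const_smul c
  field w := by rw [smul_mul_assoc, h.field, mul_smul_comm, smul_comm]

theorem mul (h : IsLift hp F γ O) (h' : IsLift hp F δ O') : IsLift hp F (γ * δ) (O * O') where
  eq_zero s y hs := h.eq_zero _ _ (h'.eq_zero _ _ (by rwa [smul_smul, mul_comm]))
  holo s y hs := h.holo _ _ (h'.holo _ _ (by rwa [smul_smul, mul_comm]))
  field w := by
    rw [mul_assoc, h'.field, mul_smul_comm, ← mul_assoc, h.field, smul_mul_assoc, smul_smul,
      mul_assoc, mul_comm]
    rfl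

theorem pow (h : IsLift hp F γ O) : ∀ k : ℕ, IsLift hp F (γ ^ k) (O ^ k)
  | 0 => by simpa using one
  | k + 1 => by
    rw [pow_succ, pow_succ]
    exact (pow h k).mul h

theorem aeval (h : IsLift hp F 1 A) (q : Polynomial ℂ) :
    IsLift hp F 1 (Polynomial.aeval A q) := by
  induction q using Polynomial.induction_on' with
  | add q q' hq hq' => simpa using hq.add hq'
  | monomial n c =>
    rw [Polynomial.aeval_monomial, ← Algebra.smul_def]
    simpa using (h.pow n).smul c

open Classical in
theorem apply_eq (h : IsLift hp F γ O) {y z : Y} (hz : z = γ • y) (s : ∀ y, F.bundle.fiber y) :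
    O s y = HolBundle.entry O z y (s z) := by
  have := h.eq_zero (s - Pi.single z (s z)) y (by
    subst hz
    rw [Pi.sub_apply, Pi.single_eq_same, sub_self])
  rwa [map_sub, Pi.sub_apply, sub_eq_zero] at this

theorem entry_mul (h : IsLift hp F γ O) {y z z' : Y} (hz : z = γ • y) :
    HolBundle.entry (O * O') z' y = HolBundle.entry O z y ∘ₗ HolBundle.entry O' z' z :=
  LinearMap.ext fun _ => h.apply_eq hz _

end IsLift

end IsGaloisCover

end Lift

/-! ### Normalizing a lift of a generator -/

section Lift

variable {V : Type w} [NormedAddCommGroup V] [NormedSpace ℂ V]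
  {X : Type u} [TopologicalSpace X] [ChartedSpace V X]
  {Y : Type u} [TopologicalSpace Y] [ChartedSpace V Y]
  {Γ : Subgroup Circle} [MulAction Γ Y]
  {p : C^ω⟮𝓘(ℂ, V), Y; 𝓘(ℂ, V), X⟯}

namespace HolBundle

instance (F : HolBundle V Y) (y : Y) : Module.Finite ℂ (F.fiber y) :=
  .of_basis (F.frame (F.exists_mem_dom y).choose y)

theorem finrank_fiber (F : HolBundle V Y) (y : Y) :
    Module.finrank ℂ (F.fiber y) = Fintype.card F.κ :=
  Module.finrank_eq_card_basis (F.frame (F.exists_mem_dom y).choose y)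

theorem entry_one (F : HolBundle V Y) {z y : Y} (h : z = y) (e : F.fiber z) :
    entry (F := F) 1 z y e = F.cast h e := by
  classical
  subst h
  exact Pi.single_eq_same z e

theorem entry_cast {F : HolBundle V Y} (O : Module.End ℂ (∀ y, F.fiber y)) {z z' : Y}
    (h : z = z') (y : Y) (e : F.fiber z) : entry O z' y (F.cast h e) = entry O z y e := by
  subst h
  rfl

end HolBundle

variable [IsManifold 𝓘(ℂ, V) ω Y]

namespace IsGaloisCover.IsLift

variable {hp : IsGaloisCover Γ p} {F : HiggsBundle V Y} {γ δ : Γ}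
  {O O' A : Module.End ℂ (∀ y, F.bundle.fiber y)}

theorem entry_aeval (hA : IsLift hp F 1 A) (q : Polynomial ℂ) (y : Y) :
    HolBundle.entry (Polynomial.aeval A q) y y =
      Polynomial.aeval (HolBundle.entry A y y) q := by
  have hpow : ∀ n : ℕ, HolBundle.entry (A ^ n) y y = HolBundle.entry A y y ^ n := by
    intro n
    induction n with
    | zero => exact LinearMap.ext fun e => F.bundle.entry_one rfl e
    | succ n ih =>
      rw [pow_succ', pow_succ', ← ih]
      exact hA.entry_mul (one_smul Γ y).symm
  induction q using Polynomial.induction_on' with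
  | add q q' hq hq' =>
    rw [map_add, map_add, ← hq, ← hq']
    rfl
  | monomial n c =>
    rw [Polynomial.aeval_monomial, Polynomial.aeval_monomial, ← Algebra.smul_def,
      ← Algebra.smul_def, ← hpow]
    rfl

theorem entry_injective (hinj : ∀ s y, O s y = 0 → s (γ • y) = 0) (y : Y) :
    Function.Injective (HolBundle.entry O (γ • y) y) := by
  classical
  refine (injective_iff_map_eq_zero _).2 fun e he => ?_
  exact (Pi.single_eq_same (γ • y) e).symm.trans (hinj _ y he)

/-- An operator over the identity which commutes with an isomorphism `γ^*F ≅ F` has conjugate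
values at `γ y` and `y`. -/
theorem charpoly_entry_smul (hO : IsLift hp F γ O) (hinj : ∀ s y, O s y = 0 → s (γ • y) = 0)
    (hA : IsLift hp F 1 A) (hc : Commute O A) (y : Y) :
    (HolBundle.entry A (γ • y) (γ • y)).charpoly = (HolBundle.entry A y y).charpoly := by
  let α := LinearEquiv.ofInjectiveOfFinrankEq (HolBundle.entry O (γ • y) y)
    (entry_injective hinj y) (by rw [HolBundle.finrank_fiber, HolBundle.finrank_fiber])
  rw [← LinearEquiv.charpoly_conj α]
  congr 1
  refine LinearMap.ext fun e => ?_
  obtain ⟨e, rfl⟩ := α.surjective e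
  have h₁ := hO.entry_mul (O' := A) (z' := γ • y) (y := y) rfl
  have h₂ := hA.entry_mul (O' := O) (z' := γ • y) (y := y) (one_smul Γ y).symm
  rw [hc.eq, h₂] at h₁
  rw [LinearEquiv.conj_apply_apply, LinearEquiv.symm_apply_apply]
  exact (LinearMap.congr_fun h₁ e).symm

/-- The values of the characteristic polynomial are determinants of holomorphic matrices. -/
theorem contMDiffAt_eval_charpoly (hA : IsLift hp F 1 A) (c : ℂ) (y : Y) :
    ContMDiffAt 𝓘(ℂ, V) 𝓘(ℂ, ℂ) ω
      (fun y' => (HolBundle.entry A y' y').charpoly.eval c) y := by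
  classical
  obtain ⟨i, hi⟩ := F.bundle.exists_mem_dom y
  have h : (fun y' => (HolBundle.entry A y' y').charpoly.eval c) = fun y' =>
      ∑ σ : Equiv.Perm F.bundle.κ, ((Equiv.Perm.sign σ : ℤ) : ℂ) * ∏ a,
        (Matrix.scalar F.bundle.κ c (σ a) a -
          (F.bundle.frame i y').repr (A (fun y => F.bundle.frame i y a) y') (σ a)) := by
    funext y'
    rw [← LinearMap.charpoly_toMatrix _ (F.bundle.frame i y'), Matrix.eval_charpoly,
      Matrix.det_apply]
    refine Finset.sum_congr rfl fun σ _ => ?_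
    rw [Units.smul_def, zsmul_eq_mul]
    congr 1
    refine Finset.prod_congr rfl fun a _ => ?_
    rw [Matrix.sub_apply, LinearMap.toMatrix_apply]
    rw [hA.apply_eq (one_smul Γ y').symm]
  rw [h]
  refine contMDiffAt_finsetSum fun σ _ => contMDiffAt_const.mul (contMDiffAt_finsetProd fun a _ =>
    contMDiffAt_const.sub ?_)
  exact hA.holo _ y (by
    rw [one_smul]
    exact F.bundle.isHolAt_frame' i a hi) i hi (σ a)

/-- The characteristic polynomial of an operator over the identity is constant, by the maximum
principle, when it is invariant under the Galois group. -/
theorem charpoly_entry_eq [CompactSpace X] [ConnectedSpace Y] (hA : IsLift hp F 1 A)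
    (h : ∀ (γ : Γ) y,
      (HolBundle.entry A (γ • y) (γ • y)).charpoly = (HolBundle.entry A y y).charpoly) (y y' : Y) :
    (HolBundle.entry A y y).charpoly = (HolBundle.entry A y' y').charpoly :=
  Polynomial.funext fun c => hp.eq_of_norm_invariant (hA.contMDiffAt_eval_charpoly c)
    (fun γ y => by rw [h γ y]) y y'

/-- An isomorphism `γ^*F ≅ F` over a generator `γ` of the Galois group can be corrected so that its
`m`-th power is the identity: its `m`-th power is an automorphism `A` of `F` with constant
characteristic polynomial, and a polynomial in `A` is an `m`-th root of `A⁻¹`. -/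
theorem exists_pow_eq_one [CompactSpace X] [ConnectedSpace Y] (hO : IsLift hp F γ O)
    (hinj : ∀ s y, O s y = 0 → s (γ • y) = 0) (hγ : ∀ δ : Γ, ∃ k : ℕ, γ ^ k = δ) {m : ℕ}
    (hm : 0 < m) (hγm : γ ^ m = 1) : ∃ O', IsLift hp F γ O' ∧ O' ^ m = 1 := by
  have hinj' : ∀ (k : ℕ) s y, (O ^ k) s y = 0 → s (γ ^ k • y) = 0 := by
    intro k
    induction k with
    | zero => exact fun s y h => by rwa [pow_zero, one_smul]
    | succ k ih =>
      intro s y h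
      rw [pow_succ, Module.End.mul_apply] at h
      rw [pow_succ', ← smul_smul]
      exact hinj _ _ (ih _ _ h)
  have hA : IsLift hp F 1 (O ^ m) := hγm ▸ hO.pow m
  obtain ⟨y₀⟩ := (inferInstance : Nonempty Y)
  set P := (HolBundle.entry (O ^ m) y₀ y₀).charpoly
  have hcp : ∀ y, (HolBundle.entry (O ^ m) y y).charpoly = P := fun y =>
    hA.charpoly_entry_eq (fun δ y => by
      obtain ⟨k, rfl⟩ := hγ δ
      exact (hO.pow k).charpoly_entry_smul (hinj' k) hA (Commute.pow_pow_self O k m) y) y y₀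
  have hPA : Polynomial.aeval (O ^ m) P = 0 := by
    refine LinearMap.ext fun s => funext fun y => ?_
    rw [(hA.aeval P).apply_eq (one_smul Γ y).symm, hA.entry_aeval, ← hcp y,
      LinearMap.aeval_self_charpoly]
    rfl
  have hP0 : P.eval 0 ≠ 0 := fun h0 => by
    obtain ⟨e, he⟩ := (Module.End.hasEigenvalue_iff_isRoot_charpoly
      (HolBundle.entry (O ^ m) y₀ y₀) 0).2 h0 |>.exists_hasEigenvector
    have h1 := he.apply_eq_smul
    rw [zero_smul] at h1
    have hinj₁ := hinj' m
    rw [hγm] at hinj₁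
    have h2 := entry_injective hinj₁ y₀
    rw [one_smul] at h2
    exact he.2 (h2 (h1.trans (map_zero _).symm))
  obtain ⟨q, R, hq⟩ := P.exists_dvd_X_mul_pow_sub_one hm hP0
  have h₁ : O ^ m * Polynomial.aeval (O ^ m) q ^ m = 1 := by
    have := congrArg (Polynomial.aeval (O ^ m)) hq
    rwa [map_sub, map_mul, map_pow, Polynomial.aeval_X, map_one, map_mul, hPA, zero_mul,
      sub_eq_zero] at this
  have hc : Commute O (Polynomial.aeval (O ^ m) q) := by
    rw [← Polynomial.expand_aeval]
    have := congrArg (Polynomial.aeval O)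
      (mul_comm (Polynomial.X) (Polynomial.expand ℂ m q))
    rwa [map_mul, map_mul, Polynomial.aeval_X] at this
  refine ⟨O * Polynomial.aeval (O ^ m) q, by simpa using hO.mul (hA.aeval q), ?_⟩
  rw [hc.mul_pow, h₁]

variable [HolomorphicAction V Γ Y]

/-- The operator on sections given by a morphism `γ^*F → F`. -/
theorem of_hom (hp : IsGaloisCover Γ p)
    (α : HolBundle.Hom (HolBundle.pullback (smulMap V Y γ) F.bundle) F.bundle)
    (hα : ∀ y v (e : F.bundle.fiber (γ • y)),
      α.toFun y (F.endo (γ • y) (mfderiv 𝓘(ℂ, V) 𝓘(ℂ, V) (smulMap V Y γ) y v) e) =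
        ((γ : Circle) : ℂ) • F.endo y v (α.toFun y e)) :
    IsLift hp F γ (LinearMap.pi fun y => α.toFun y ∘ₗ LinearMap.proj (γ • y)) where
  eq_zero _ y h := (congrArg (α.toFun y) h).trans (map_zero _)
  holo _ _ h := HolBundle.Hom.isHolAt α contMDiffAt_id
    (HolBundle.IsHolAt.comp (h := smulMap V Y γ) h (smulMap V Y γ).contMDiff.contMDiffAt)
  field w := LinearMap.ext fun s => funext fun y =>
    (congrArg (fun v => α.toFun y (F.endo (γ • y) v (s (γ • y))))
      (hp.tangentEquiv_symm_smul γ y w)).trans (hα y _ _)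

/-- The converse of `of_hom`: the entries of a lift carry `γ^*φ` to `γ φ`. -/
theorem entry_endo (hO : IsLift hp F γ O) (y : Y) (v : TangentSpace 𝓘(ℂ, V) y)
    (e : F.bundle.fiber (γ • y)) :
    HolBundle.entry O (γ • y) y
        (F.endo (γ • y) (mfderiv 𝓘(ℂ, V) 𝓘(ℂ, V) (smulMap V Y γ) y v) e) =
      ((γ : Circle) : ℂ) • F.endo y v (HolBundle.entry O (γ • y) y e) := by
  classical
  -- Vector fields need not be continuous here, so one supported at a single point will do.
  let w : ∀ x : X, TangentSpace 𝓘(ℂ, V) x := Pi.single (p y) (hp.tangentEquiv y v)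
  have hw : (hp.tangentEquiv y).symm (w (p y)) = v := by
    rw [show w (p y) = hp.tangentEquiv y v from Pi.single_eq_same _ _,
      ContinuousLinearEquiv.symm_apply_apply]
  have h := congrFun (LinearMap.congr_fun (hO.field w) (Pi.single (γ • y) e)) y
  have hl := hO.apply_eq rfl (hp.contract F w (Pi.single (γ • y) e)) (y := y)
  have h₁ : hp.contract F w (Pi.single (γ • y) e) (γ • y) =
      F.endo (γ • y) (mfderiv 𝓘(ℂ, V) 𝓘(ℂ, V) (smulMap V Y γ) y v) e := by
    have := hp.tangentEquiv_symm_smul γ y w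
    rw [hw] at this
    exact congrArg₂ (fun v e => F.endo (γ • y) v e) this
      (show Pi.single (M := F.bundle.fiber) (γ • y) e (γ • y) = e from Pi.single_eq_same _ _)
  rw [h₁] at hl
  refine (hl.symm.trans h).trans ?_
  exact congrArg (fun v => ((γ : Circle) : ℂ) • F.endo y v (HolBundle.entry O (γ • y) y e)) hw

end IsGaloisCover.IsLift

variable [HolomorphicAction V Γ Y]

/-- Compatibility with Higgs fields twisted by `𝓞` may be tested after the identification
`F ⊗ ℂ = F`. -/
theorem HiggsBundle.rTensor_pullback_field_iff {F G : HiggsBundle V Y} {γ : Γ} {y : Y}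
    (α : F.bundle.fiber (γ • y) →ₗ[ℂ] G.bundle.fiber y) (v : TangentSpace 𝓘(ℂ, V) y)
    (e : F.bundle.fiber (γ • y)) (c : ℂ) :
    α.rTensor ℂ ((HiggsBundle.pullback (smulMap V Y γ) F).field y v e) =
        c • G.field y v (α e) ↔
      α (F.endo (γ • y) (mfderiv 𝓘(ℂ, V) 𝓘(ℂ, V) (smulMap V Y γ) y v) e) =
        c • G.endo y v (α e) := by
  refine (TensorProduct.rid ℂ (G.bundle.fiber y)).injective.eq_iff.symm.trans ?_
  have h₁ := (HiggsAux.rid_rTensor α _).trans (congrArg (fun t => α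
    (TensorProduct.rid ℂ (F.bundle.fiber (γ • y)) t))
    (HiggsBundle.pullback_field (smulMap V Y γ) F y v e))
  have h₂ := map_smul (TensorProduct.rid ℂ (G.bundle.fiber y)) c (G.field y v (α e))
  exact ⟨fun h => h₁.symm.trans (h.trans h₂), fun h => h₁.trans (h.trans h₂.symm)⟩

/-- A representation of the Galois group on the sections of `F` by operators covering the deck
transformations is an equivariant structure. -/
def EquivariantHiggs.ofRep (hp : IsGaloisCover Γ p) (F : HiggsBundle V Y)
    (ρ : Γ →* Module.End ℂ (∀ y, F.bundle.fiber y)) (hρ : ∀ γ, hp.IsLift F γ (ρ γ)) :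
    EquivariantHiggs V Y Γ where
  higgs := F
  lin γ :=
    { toFun := fun y => HolBundle.entry (ρ γ) (γ • y) y
      holo := fun i a y hy => by
        have h := (hρ γ).holo _ y (F.bundle.isHolAt_frame' i a hy)
        refine h.congr (Filter.Eventually.of_forall fun y' => ?_)
        exact (hρ γ).apply_eq rfl (fun y => F.bundle.frame i y a) }
  lin_one y e := by
    change HolBundle.entry (ρ 1) _ y e = _
    rw [map_one]
    exact F.bundle.entry_one _ e
  lin_mul γ δ y e :=
    (congrArg (fun O => HolBundle.entry O ((γ * δ) • y) y e)
      (show ρ (γ * δ) = ρ δ * ρ γ by rw [mul_comm, map_mul])).trans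
    ((LinearMap.congr_fun ((hρ δ).entry_mul rfl) e).trans
      (congrArg (HolBundle.entry (ρ δ) (δ • y) y)
        (HolBundle.entry_cast (ρ γ) (mul_smul γ δ y) (δ • y) e).symm))
  lin_field γ y v e :=
    (HiggsBundle.rTensor_pullback_field_iff (HolBundle.entry (ρ γ) (γ • y) y) v e _).2
      ((hρ γ).entry_endo y v e)

end Lift

/-! ### Higgs bundles isomorphic to pullbacks -/

/-- The isomorphism of bundles underlying an isomorphism of Higgs bundles. -/
def TwistedHiggs.bundleIso {V : Type w} [NormedAddCommGroup V] [NormedSpace ℂ V]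
    {X : Type u} [TopologicalSpace X] [ChartedSpace V X] [IsManifold 𝓘(ℂ, V) ω X]
    {L : HolLineBundle V X} {P Q : TwistedHiggs L} (f : P ≅ Q) : P.bundle ≅ Q.bundle where
  hom := TwistedHiggs.Hom.hom f.hom
  inv := TwistedHiggs.Hom.hom f.inv
  hom_inv_id := congrArg TwistedHiggs.Hom.hom f.hom_inv_id
  inv_hom_id := congrArg TwistedHiggs.Hom.hom f.inv_hom_id

section Cyclic

variable {V : Type w} [NormedAddCommGroup V] [NormedSpace ℂ V]
  {X : Type u} [TopologicalSpace X] [ChartedSpace V X]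
  {Y : Type u} [TopologicalSpace Y] [ChartedSpace V Y]
  {Γ : Subgroup Circle} [MulAction Γ Y] [HolomorphicAction V Γ Y]
  {p : C^ω⟮𝓘(ℂ, V), Y; 𝓘(ℂ, V), X⟯}
  [IsManifold 𝓘(ℂ, V) ω Y]

theorem HiggsBundle.endo_hom {F G : HiggsBundle V Y} (f : F ⟶ G) (y : Y)
    (v : TangentSpace 𝓘(ℂ, V) y) (e : F.bundle.fiber y) :
    HolBundle.Hom.toFun (TwistedHiggs.Hom.hom f) y (F.endo y v e) =
      G.endo y v (HolBundle.Hom.toFun (TwistedHiggs.Hom.hom f) y e) :=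
  (HiggsAux.rid_rTensor _ (F.field y v e)).symm.trans
    (congrArg (TensorProduct.rid ℂ (G.bundle.fiber y)) (TwistedHiggs.Hom.comm f y v e))

/-- If `F` underlies an equivariant Higgs bundle, then `γ^*F` is isomorphic to `F` with the field
multiplied by `γ`. -/
theorem EquivariantHiggs.exists_pullback_iso_scale (P : EquivariantHiggs V Y Γ)
    (hp : IsGaloisCover Γ p) {F : HiggsBundle V Y} (f : P.higgs ≅ F) (γ : Γ) :
    Nonempty (HiggsBundle.pullback (smulMap V Y γ) F ≅ F.scale ((γ : Circle) : ℂ)) := by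
  let Φ := TwistedHiggs.bundleIso f
  have hγ : ContMDiff 𝓘(ℂ, V) 𝓘(ℂ, V) ω fun y : Y => γ • y :=
    HolomorphicAction.contMDiff_smul γ
  let e : ∀ y, F.bundle.fiber (γ • y) ≃ₗ[ℂ] F.bundle.fiber y := fun y =>
    ((HolBundle.fiberEquiv Φ (γ • y)).symm ≪≫ₗ P.transport hp (hp.deck γ y)) ≪≫ₗ
      HolBundle.fiberEquiv Φ y
  let E : (HiggsBundle.pullback (smulMap V Y γ) F).bundle ≅
      (F.scale ((γ : Circle) : ℂ)).bundle :=
    HolBundle.mkIso e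
      (fun i a y hy => Φ.hom.isHolAt contMDiffAt_id
        (P.isHolAt_transportHom hp hγ.continuous.continuousAt contMDiffAt_id (hp.deck γ)
          (Φ.inv.isHolAt hγ.contMDiffAt (F.bundle.isHolAt_frame hγ.contMDiffAt i hy a))))
      (fun i a y hy => Φ.hom.isHolAt (g := fun y : Y => γ • y) hγ.contMDiffAt
        (P.isHolAt_transportHom hp continuousAt_id hγ.contMDiffAt (fun y => (hp.deck γ y).symm)
          (Φ.inv.isHolAt contMDiffAt_id (F.bundle.isHolAt_frame' i a hy))))
  refine ⟨TwistedHiggs.mkIso E fun y v t =>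
    (HiggsBundle.rTensor_pullback_field_iff (e y).toLinearMap v t _).2 ?_⟩
  have hα : ∀ t, P.transportHom hp (hp.deck γ y) t = (P.lin γ).toFun y t := fun t => by
    rw [P.transportHom_eq hp (hp.deck γ y) rfl]
    rfl
  have h₁ := HiggsBundle.endo_hom f.inv (γ • y)
    (mfderiv 𝓘(ℂ, V) 𝓘(ℂ, V) (smulMap V Y γ) y v) t
  have h₂ := (HiggsBundle.rTensor_pullback_field_iff ((P.lin γ).toFun y) v
    (HolBundle.Hom.toFun Φ.inv (γ • y) t) _).1 (P.lin_field γ y v _)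
  have h₃ := HiggsBundle.endo_hom f.hom y v
    ((P.lin γ).toFun y (HolBundle.Hom.toFun Φ.inv (γ • y) t))
  refine (congrArg (fun s => HolBundle.Hom.toFun Φ.hom y (P.transportHom hp (hp.deck γ y) s))
    h₁).trans ?_
  refine (congrArg (HolBundle.Hom.toFun Φ.hom y) ((hα _).trans h₂)).trans ?_
  refine (map_smul (HolBundle.Hom.toFun Φ.hom y) _ _).trans ?_
  refine (congrArg (fun s => ((γ : Circle) : ℂ) • s) h₃).trans ?_
  exact congrArg (fun s => ((γ : Circle) : ℂ) • F.endo y v (HolBundle.Hom.toFun Φ.hom y s))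
    (hα _).symm

/-- When the Galois group is finite, hence cyclic, isomorphisms `γ^*F ≅ F` without any
compatibility suffice for an equivariant structure. -/
theorem IsGaloisCover.exists_equivariantHiggs [CompactSpace X] [ConnectedSpace Y] [Finite Γ]
    (hp : IsGaloisCover Γ p) (F : HiggsBundle V Y)
    (h : ∀ γ : Γ, Nonempty
      (HiggsBundle.pullback (smulMap V Y γ) F ≅ F.scale ((γ : Circle) : ℂ))) :
    ∃ P : EquivariantHiggs V Y Γ, P.higgs = F := by
  have hcyc : IsCyclic Γ := isCyclic_of_injective_ringHom
    (Circle.coeHom.comp Γ.subtype) fun γ δ hγδ => Subtype.ext (Circle.ext hγδ)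
  obtain ⟨g, hg⟩ := hcyc.exists_generator
  have hg' : ∀ δ : Γ, ∃ k : ℕ, g ^ k = δ := fun δ =>
    (mem_powers_iff_mem_zpowers.2 (hg δ))
  obtain ⟨Ψ⟩ := h g
  have hO := IsGaloisCover.IsLift.of_hom (F := F) (γ := g) hp (TwistedHiggs.Hom.hom Ψ.hom)
    fun y v e => (HiggsBundle.rTensor_pullback_field_iff _ v e _).1
      (TwistedHiggs.Hom.comm Ψ.hom y v e)
  obtain ⟨O, hO, hOm⟩ := hO.exists_pow_eq_one (fun s y hs =>
    (HolBundle.fiberEquiv (TwistedHiggs.bundleIso Ψ) y).map_eq_zero_iff.1 hs) hg'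
    (orderOf_pos g) (pow_orderOf_eq_one g)
  let U : (Module.End ℂ (∀ y, F.bundle.fiber y))ˣ :=
    Units.ofPowEqOne O (orderOf g) hOm (orderOf_pos g).ne'
  let ρ := (Units.coeHom _).comp (monoidHomOfForallMemZpowers (g' := U) hg
    (orderOf_dvd_of_pow_eq_one (Units.ext hOm)))
  refine ⟨EquivariantHiggs.ofRep hp F ρ fun δ => ?_, rfl⟩
  obtain ⟨k, rfl⟩ := hg' δ
  have hρ : ρ g = O := congrArg Units.val (monoidHomOfForallMemZpowers_apply_gen hg _)
  rw [map_pow, hρ]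
  exact hO.pow k

/-- A Higgs bundle on the covering is isomorphic to a pullback exactly when its translate by
each `γ` is isomorphic to it with the field multiplied by `γ`. -/
theorem pullbackFunctor_exists_iso_iff [IsManifold 𝓘(ℂ, V) ω X] [CompactSpace X]
    [ConnectedSpace Y] [Finite Γ] (hp : IsGaloisCover Γ p) {L : HolLineBundle V X}
    {τ : HolBundle.pullback p L.toHolBundle ≅
      (HolLineBundle.trivial (V := V) (X := Y)).toHolBundle}
    (hτ : IsEquivariantTrivialization Γ p hp.deck L τ) (F : HiggsBundle V Y) :
    (∃ E : TwistedHiggs L, Nonempty (((pullbackFunctor p hp.deck τ hτ).obj E).higgs ≅ F)) ↔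
      ∀ γ : Γ, Nonempty
        (HiggsBundle.pullback (smulMap V Y γ) F ≅ F.scale ((γ : Circle) : ℂ)) := by
  refine ⟨fun ⟨E, ⟨f⟩⟩ γ => EquivariantHiggs.exists_pullback_iso_scale _ hp f γ, fun h => ?_⟩
  obtain ⟨P, rfl⟩ := hp.exists_equivariantHiggs F h
  obtain ⟨E, ⟨e⟩⟩ := P.exists_descend hp hτ
  exact ⟨E, ⟨⟨EquivariantHiggs.Hom.hom e.hom, EquivariantHiggs.Hom.hom e.inv,
    congrArg EquivariantHiggs.Hom.hom e.hom_inv_id,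
    congrArg EquivariantHiggs.Hom.hom e.inv_hom_id⟩⟩⟩

end Cyclic

end

theorem mainTheorem9
    {V : Type w} [NormedAddCommGroup V] [NormedSpace ℂ V] [FiniteDimensional ℂ V]
    {X : Type u} [TopologicalSpace X] [ChartedSpace V X] [IsManifold 𝓘(ℂ, V) ω X]
    [T2Space X] [CompactSpace X] [ConnectedSpace X]
    (L : HolLineBundle V X)
    (hL : ∃ n : ℕ, 0 < n ∧ Nonempty (L.tensorPow n ≅ HolBundle.unit))
    (x₀ : X) (χ : FundamentalGroup X x₀ →* Circle) (hχ : Nonempty (FlatFrame L x₀ χ))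
    {Y : Type u} [TopologicalSpace Y] [ChartedSpace V Y] [IsManifold 𝓘(ℂ, V) ω Y]
    [ConnectedSpace Y] [MulAction χ.range Y] [HolomorphicAction V χ.range Y]
    (p : C^ω⟮𝓘(ℂ, V), Y; 𝓘(ℂ, V), X⟯) (y₀ : Y) (hp : IsCharacterCover χ p y₀) :
    (∃ τ, IsEquivariantTrivialization χ.range p hp.deck L τ) ∧
    ∀ τ (hτ : IsEquivariantTrivialization χ.range p hp.deck L τ),
      (pullbackFunctor p hp.deck τ hτ).IsEquivalence ∧
      Nonempty (pullbackFunctor p hp.deck τ hτ).Braided ∧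
      ∀ F : HiggsBundle V Y,
        (∃ E : TwistedHiggs L, Nonempty (((pullbackFunctor p hp.deck τ hτ).obj E).higgs ≅ F)) ↔
          ∀ γ : χ.range, Nonempty
            (HiggsBundle.pullback (smulMap V Y γ) F ≅ F.scale ((γ : Circle) : ℂ)) := by
  obtain rfl := hp.base
  obtain ⟨s⟩ := hχ
  have : LocallyPathConnectedSpace X := ChartedSpace.locallyPathConnectedSpace V X
  have : LocallyPathConnectedSpace Y := ChartedSpace.locallyPathConnectedSpace V Y
  have : PathConnectedSpace X := pathConnectedSpace_iff_connectedSpace.2 inferInstance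
  have : PathConnectedSpace Y := pathConnectedSpace_iff_connectedSpace.2 inferInstance
  have hG := hp.isGaloisCover
  refine ⟨hp.exists_isEquivariantTrivialization s, fun τ hτ => ⟨pullbackFunctor_isEquivalence hG hτ,
    pullbackFunctor_braided hp.deck hτ, fun F => ?_⟩⟩
  have := hG.finite hτ hL
  exact pullbackFunctor_exists_iso_iff hG hτ F
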